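/- **Theorem (logarithmic version of Faltings' gluing theorem).** Let $p>2$ be a prime, $k$ a perfect field of characteristic $p$, $W=W(k)$, and let $R$ be a $W$-algebra with an étale map $W[T_1,\dots,T_d]\to R$ over $W$. Let $0\le s\le d$, let $Y=\mathrm{Spec}\,R$, and let $Z\subset Y$ be defined by $T_1\cdots T_s=0$. Let $\widehat R$ be the $p$-adic completion of $R$. Put $\omega_j=d\log T_j$ for $j\le s$ and $\omega_j=dT_j$ for $j>s$. A *Frobenius lift* is a ring endomorphism $\Phi$ of $\widehat R$ that lifts the absolute Frobenius of $R/pR$ and satisfies $\Phi(T_j)=w_jT_j^p$ with $w_j\in\widehat R^\times$ for $1\le j\le d$. Let $a\le b$ be integers with $b-a\le p-1$. A *filtered logarithmic de Rham module* is a triple $(V,\nabla,\mathrm{Fil})$, where $V$ is a finitely generated $\widehat R$-module, $\nabla v=\sum_j\nabla_j v\otimes\omega_j$ is an integrable connection with logarithmic poles along $T_1\cdots T_s=0$, and $V=\mathrm{Fil}^aV\supset\dots\supset\mathrm{Fil}^bV\supset\mathrm{Fil}^{b+1}V=0$ is a filtration by locally split submodules. The graded pieces are required to be, locally on $\mathrm{Spf}\,\widehat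 R$, finite direct sums of modules $\mathcal O/p^e$ ($e\le\infty$, $p^\infty=0$), and $\nabla_j(\mathrm{Fil}^i)\subset\mathrm{Fil}^{i-1}$ for all $i,j$. Let $\widetilde V=\bigoplus_{i=a}^b\mathrm{Fil}^iV/\!\sim$, where $[x]_{i-1}=p[x]_i$ for $x\in\mathrm{Fil}^iV$; put $[x]_{a-1}=p[x]_a$. The module $\widetilde V\otimes_\Phi\widehat R$ carries the logarithmic connection $\Phi_*\widetilde\nabla$ with $\Phi_*\widetilde\nabla([v]_i\otimes1)=\sum_j([\nabla_jv]_{i-1}\otimes1)\otimes\frac1p\Phi^*\omega_j$. A *logarithmic Fontaine–Faltings module* for $\Phi$ with Hodge–Tate weights in $[a,b]$ is a filtered logarithmic de Rham module with a horizontal $\widehat R$-linear isomorphism $\varphi:\widetilde V\otimes_\Phi\widehat R\to V$. Morphisms are horizontal $\widehat R$-linear maps that respect the filtrations strictly and commute with $\varphi$. Let $\mathcal{MF}^{\nabla,\Phi}_{[a,b]}$ be the resulting category. Then for all Frobenius lifts $\Phi,\Psi$ there are $\widehat R$-linear isomorphisms $$\alpha_{\Phi,\Psi}:\widetilde V\otimes_\Phi\widehat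 R\ \xrightarrow{\ \sim\ }\ \widetilde V\otimes_\Psi\widehat R,$$ natural in the filtered logarithmic de Rham module $(V,\nabla,\mathrm{Fil})$ and parallel for $\Phi_*\widetilde\nabla$ and $\Psi_*\widetilde\nabla$, such that the following hold. 1. For $a\le i\le b$ and $m\in\mathrm{Fil}^iV$, $$\alpha_{\Phi,\Psi}([m]_i\otimes_\Phi1)=\sum_{I\in\mathbb N^d}\big[\nabla(\partial)^{\{I\}}m\big]_{\max\{a,\,i-|I|\}}\otimes_\Psi\frac{(\Phi(T)/\Psi(T)-1)^I}{I!\;p^{\min\{i-a,\,|I|\}}},$$ where $\partial_j=T_j\,\partial/\partial T_j$, $\nabla(\partial)^{\{I\}}=\prod_j\prod_{l=0}^{I_j-1}(\nabla(\partial_j)-l)$, $I!=\prod_jI_j!$, the element $\Phi(T_j)/\Psi(T_j)$ is the quotient of the units $w_j$ of $\Phi$ and $\Psi$, the fractions are elements of $\widehat R$, and the sum converges $p$-adically. 2. $\alpha_{\Phi_1,\Phi_3}=\alpha_{\Phi_2,\Phi_3}\circ\alpha_{\Phi_1,\Phi_2}$ for any three Frobenius lifts. 3. $(V,\nabla,\mathrm{Fil},\varphi)\mapsto(V,\nabla,\mathrm{Fil},\varphi\circ\alpha_{\Phi,\Psi})$,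 with the identity on underlying maps, is an equivalence of categories $F_{\Phi,\Psi}:\mathcal{MF}^{\nabla,\Psi}_{[a,b]}\to\mathcal{MF}^{\nabla,\Phi}_{[a,b]}$. 4. $F_{\Phi,\Phi}=\mathrm{id}$ and $F_{\Phi_1,\Phi_2}\circ F_{\Phi_2,\Phi_3}=F_{\Phi_1,\Phi_3}$; hence, up to canonical equivalence, the category does not depend on $\Phi$. -/

import Mathlib

set_option linter.unusedSectionVars false

open scoped TensorProduct DirectSum
open CategoryTheory

universe u v w

namespace LogGluing

noncomputable section

/- The ring and its logarithmic derivations -/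

section Completion

variable {p : ℕ} {R : Type v} [CommRing R]

/-- The `p`-adic completion `R̂` of `R`. -/
abbrev RHat (p : ℕ) (R : Type v) [CommRing R] : Type v := AdicCompletion (Ideal.span {(p : R)}) R

theorem exists_eq_of_val_eq_zero {n : ℕ} {x : RHat p R} (hx : x.val n = 0) :
    ∃ y : RHat p R, x = (p : RHat p R) ^ n * y := by
  have h : x ∈ (AdicCompletion.eval (Ideal.span {(p : R)}) R n).ker := hx
  rw [← AdicCompletion.pow_smul_top_eq_ker_eval ⟨{(p : R)}, by simp⟩,
    Ideal.span_singleton_pow, Submodule.ideal_span_singleton_smul] at h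
  obtain ⟨y, -, hy⟩ := h
  refine ⟨y, ?_⟩
  rw [← hy]
  simp [Algebra.smul_def]

theorem val_p_pow (n : ℕ) : ((p : RHat p R) ^ n).val n = 0 := by
  have : ((p : RHat p R) ^ n) = algebraMap R (RHat p R) ((p : R) ^ n) := by simp
  rw [this, AdicCompletion.algebraMap_apply]
  simp only [AdicCompletion.of_apply, Submodule.mkQ_apply]
  rw [Submodule.Quotient.mk_eq_zero, Ideal.span_singleton_pow]
  simp

theorem eq_zero_of_pow_dvd {x : RHat p R}
    (hx : ∀ n : ℕ, ∃ y : RHat p R, x = (p : RHat p R) ^ n * y) : x = 0 := by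
  apply AdicCompletion.ext
  intro n
  obtain ⟨y, rfl⟩ := hx n
  rw [AdicCompletion.val_mul, val_p_pow, zero_mul]; rfl

theorem exists_rep (x : RHat p R) (n : ℕ) :
    ∃ r : R, Submodule.Quotient.mk r = x.val n :=
  Submodule.Quotient.mk_surjective _ _

theorem transitionMap_mk {m n : ℕ} (hmn : m ≤ n) (r : R) :
    AdicCompletion.transitionMap (Ideal.span {(p : R)}) R hmn (Submodule.Quotient.mk r) =
      Submodule.Quotient.mk r := rfl

theorem exists_eq_add (x : RHat p R) (n : ℕ) :
    ∃ (r : R) (y : RHat p R), x = algebraMap R (RHat p R) r + (p : RHat p R) ^ n * y := by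
  obtain ⟨r, hr⟩ := exists_rep x n
  obtain ⟨y, hy⟩ := exists_eq_of_val_eq_zero (n := n) (x := x - algebraMap R (RHat p R) r) (by
    rw [AdicCompletion.val_sub, Pi.sub_apply, ← hr, AdicCompletion.algebraMap_apply]
    exact sub_self _)
  exact ⟨r, y, by rw [← hy]; ring⟩

theorem exists_eq_of_algebraMap_eq {r : R} {y : RHat p R}
    (h : algebraMap R (RHat p R) r = (p : RHat p R) ^ 1 * y) : ∃ z, r = (p : R) * z := by
  have h2 : (algebraMap R (RHat p R) r).val 1 = 0 := by
    rw [h, AdicCompletion.val_mul, val_p_pow, zero_mul]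
  rw [AdicCompletion.algebraMap_apply] at h2
  have h4 := (Submodule.Quotient.mk_eq_zero _).1 h2
  rw [Ideal.span_singleton_pow, Submodule.ideal_span_singleton_smul, pow_one] at h4
  obtain ⟨z, -, hz⟩ := h4
  exact ⟨z, hz.symm⟩

end Completion

theorem exists_eq_mul_of_flat {S : Type u} {R : Type v} [CommRing S] [CommRing R] [Algebra S R]
    [Module.Flat S R] {x q : S} (hx : ∀ f g, x * f = q * g → ∃ g', f = q * g') {r z : R}
    (h : algebraMap S R x * r = algebraMap S R q * z) : ∃ r', r = algebraMap S R q * r' := by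
  have h7 : ∑ i : Fin 2, (![x, -q] i) • (![r, z] i) = 0 := by
    simp only [Fin.sum_univ_two, Algebra.smul_def, Matrix.cons_val_zero, Matrix.cons_val_one,
      map_neg]
    rw [h]; ring
  obtain ⟨l, a, y, h8, h9⟩ := Module.Flat.isTrivialRelation_of_sum_smul_eq_zero (R := S) (M := R) h7
  have h10 : ∀ i, ∃ g', a 0 i = q * g' := fun i => by
    have := h9 i
    simp only [Fin.sum_univ_two, Matrix.cons_val_zero, Matrix.cons_val_one] at this
    exact hx _ (a 1 i) (by linear_combination this)
  choose g hg using h10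
  refine ⟨∑ i, g i • y i, ?_⟩
  have := h8 0
  simp only [Matrix.cons_val_zero] at this
  rw [this, Finset.mul_sum]
  refine Finset.sum_congr rfl fun i _ => ?_
  rw [hg, Algebra.smul_def, Algebra.smul_def, map_mul, mul_assoc]

section Ring

variable (p : ℕ) [Fact p.Prime] (k : Type u) [Field k]
  (d s : ℕ) (R : Type v) [CommRing R]
  [Algebra (WittVector p k) R] [Algebra (MvPolynomial (Fin d) (WittVector p k)) R]
  [IsScalarTower (WittVector p k) (MvPolynomial (Fin d) (WittVector p k)) R]
  [Algebra.Etale (MvPolynomial (Fin d) (WittVector p k)) R]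

/-- The derivation `∂/∂T_j` of `R`: the unique extension of `∂/∂T_j` on `W[T_1, …, T_d]` along
the étale chart, obtained from `R ⊗ Ω_{W[T]/W} ≃ Ω_{R/W}`. -/
def partialR (j : Fin d) : Derivation (WittVector p k) R R :=
  ((Algebra.TensorProduct.rid (MvPolynomial (Fin d) (WittVector p k)) R R).toLinearMap ∘ₗ
    (MvPolynomial.pderiv j : Derivation (WittVector p k)
      (MvPolynomial (Fin d) (WittVector p k)) _).liftKaehlerDifferential.baseChange R ∘ₗ
    (KaehlerDifferential.tensorKaehlerEquivOfFormallyEtale (WittVector p k)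
      (MvPolynomial (Fin d) (WittVector p k)) R).symm.toLinearMap).compDer
    (KaehlerDifferential.D (WittVector p k) R)

theorem partialR_algebraMap (j : Fin d) (f : MvPolynomial (Fin d) (WittVector p k)) :
    partialR p k d R j (algebraMap _ R f) = algebraMap _ R (MvPolynomial.pderiv j f) := by
  change Algebra.TensorProduct.rid (MvPolynomial (Fin d) (WittVector p k)) R R (LinearMap.baseChange R _
    ((KaehlerDifferential.tensorKaehlerEquivOfFormallyEtale (WittVector p k)
      (MvPolynomial (Fin d) (WittVector p k)) R).symm
      (KaehlerDifferential.D (WittVector p k) R (algebraMap _ R f)))) = _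
  rw [KaehlerDifferential.tensorKaehlerEquivOfFormallyEtale_symm_D_algebraMap]
  simp [Algebra.smul_def]

theorem partialR_pow_mul (j : Fin d) (n : ℕ) (x : R) :
    partialR p k d R j ((p : R) ^ n * x) = (p : R) ^ n * partialR p k d R j x := by
  have h : ∀ y : R, (p : R) ^ n * y = (p ^ n : ℕ) • y := fun y => by simp [nsmul_eq_mul]
  rw [h, h, map_nsmul]

/-- `∂/∂T_j` on `R ⧸ p ^ n`. -/
def partialMod (j : Fin d) (n : ℕ) :
    R ⧸ (Ideal.span {(p : R)} ^ n • ⊤ : Submodule R R) →+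
      R ⧸ (Ideal.span {(p : R)} ^ n • ⊤ : Submodule R R) :=
  QuotientAddGroup.map (Submodule.toAddSubgroup _) (Submodule.toAddSubgroup _)
    (partialR p k d R j : R →+ R) (by
      intro x hx
      have hx' : x ∈ (Ideal.span {(p : R)} ^ n • ⊤ : Submodule R R) := hx
      show partialR p k d R j x ∈ (Ideal.span {(p : R)} ^ n • ⊤ : Submodule R R)
      rw [Ideal.span_singleton_pow, Submodule.ideal_span_singleton_smul] at hx' ⊢
      obtain ⟨y, -, rfl⟩ := hx'
      refine ⟨partialR p k d R j y, trivial, ?_⟩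
      exact (partialR_pow_mul p k d R j n y).symm)

theorem partialMod_mk (j : Fin d) (n : ℕ) (r : R) :
    partialMod p k d R j n (Submodule.Quotient.mk r) =
      Submodule.Quotient.mk (partialR p k d R j r) := rfl

/-- The additive map underlying the derivation `∂/∂T_j` of `R̂`. -/
def partialHatFun (j : Fin d) : RHat p R →+ RHat p R where
  toFun x := ⟨fun n => partialMod p k d R j n (x.val n), by
    intro m n hmn
    obtain ⟨r, hr⟩ := exists_rep x n
    have hm : x.val m = Submodule.Quotient.mk r := by
      rw [← x.2 hmn, ← hr]; exact transitionMap_mk hmn r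
    change AdicCompletion.transitionMap _ R hmn (partialMod p k d R j n (x.val n)) =
      partialMod p k d R j m (x.val m)
    rw [hm, ← hr, partialMod_mk, partialMod_mk]
    exact transitionMap_mk hmn _⟩
  map_zero' := by
    apply AdicCompletion.ext; intro n
    exact map_zero (partialMod p k d R j n)
  map_add' x y := by
    apply AdicCompletion.ext; intro n
    exact map_add (partialMod p k d R j n) _ _

theorem partialHatFun_val {j : Fin d} {n : ℕ} {x : RHat p R} {r : R}
    (h : Ideal.Quotient.mk _ r = x.val n) :
    (partialHatFun p k d R j x).val n = Ideal.Quotient.mk _ (partialR p k d R j r) := by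
  change partialMod p k d R j n (x.val n) = _
  rw [← h]; rfl

theorem partialHatFun_algebraMap (j : Fin d) (r : R) :
    partialHatFun p k d R j (algebraMap R _ r) = algebraMap R _ (partialR p k d R j r) := by
  apply AdicCompletion.ext; intro n
  rw [partialHatFun_val p k d R (r := r) (by rw [AdicCompletion.algebraMap_apply]; rfl)]
  rw [AdicCompletion.algebraMap_apply]; rfl

theorem partialHatFun_mul (j : Fin d) (x y : RHat p R) :
    partialHatFun p k d R j (x * y) =
      x * partialHatFun p k d R j y + y * partialHatFun p k d R j x := by
  apply AdicCompletion.ext; intro n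
  obtain ⟨r, hr⟩ := Ideal.Quotient.mk_surjective (x.val n)
  obtain ⟨t, ht⟩ := Ideal.Quotient.mk_surjective (y.val n)
  rw [partialHatFun_val p k d R (x := x * y) (r := r * t)
      (by rw [map_mul, hr, ht, AdicCompletion.val_mul]),
    AdicCompletion.val_add, Pi.add_apply, AdicCompletion.val_mul, AdicCompletion.val_mul,
    partialHatFun_val p k d R hr, partialHatFun_val p k d R ht, ← hr, ← ht, Derivation.leibniz]
  simp

/-- The derivation `∂/∂T_j` of `R̂`: the `p`-adically continuous extension of `∂/∂T_j` on `R`. -/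
def partialHat (j : Fin d) : Derivation (WittVector p k) (RHat p R) (RHat p R) :=
  Derivation.mk'
    { partialHatFun p k d R j with
      map_smul' := fun c x => by
        have h : algebraMap (WittVector p k) (RHat p R) c =
            algebraMap R (RHat p R) (algebraMap (WittVector p k) R c) := rfl
        change partialHatFun p k d R j (c • x) = c • partialHatFun p k d R j x
        rw [Algebra.smul_def, Algebra.smul_def, partialHatFun_mul, h, partialHatFun_algebraMap,
          Derivation.map_algebraMap, map_zero, mul_zero, add_zero] }
    (partialHatFun_mul p k d R j)

theorem partialHat_algebraMap (j : Fin d) (r : R) :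
    partialHat p k d R j (algebraMap R _ r) = algebraMap R _ (partialR p k d R j r) :=
  partialHatFun_algebraMap p k d R j r

/-- The coordinate `T_j` as an element of `R̂`. -/
def coord (j : Fin d) : RHat p R :=
  algebraMap R (RHat p R) (algebraMap (MvPolynomial (Fin d) (WittVector p k)) R (MvPolynomial.X j))

theorem partialHat_coord (i j : Fin d) :
    partialHat p k d R i (coord p k d R j) = if i = j then 1 else 0 := by
  rw [coord, partialHat_algebraMap, partialR_algebraMap, MvPolynomial.pderiv_X]
  by_cases h : i = j
  · subst h; simp
  · simp [h, Ne.symm h]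

/-- The basis of the logarithmic derivations dual to the basis `dlog T_1, …, dlog T_s`,
`dT_{s+1}, …, dT_d` of the logarithmic differentials: `T_j ∂/∂T_j` for `j` among the first `s`
indices and `∂/∂T_j` for the others. -/
def logDer (j : Fin d) : Derivation (WittVector p k) (RHat p R) (RHat p R) :=
  if (j : ℕ) < s then coord p k d R j • partialHat p k d R j else partialHat p k d R j

theorem logDer_coord (i j : Fin d) :
    logDer p k d s R i (coord p k d R j) =
      if i = j then (if (j : ℕ) < s then coord p k d R j else 1) else 0 := by
  unfold logDer
  by_cases h : i = j
  · subst h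
    by_cases hs : (i : ℕ) < s <;> simp [hs, partialHat_coord]
  · by_cases hs : (i : ℕ) < s <;> simp [hs, h, partialHat_coord]

end Ring

/- Frobenius lifts -/

section Frobenius

variable (p : ℕ) [Fact p.Prime] (k : Type u) [Field k]
  (d s : ℕ) (R : Type v) [CommRing R]
  [Algebra (WittVector p k) R] [Algebra (MvPolynomial (Fin d) (WittVector p k)) R]

/-- A lifting `Φ : R̂ → R̂` of the absolute Frobenius of `R / p R` that respects the logarithmic
structure: `Φ (T_j) = w_j T_j ^ p` with units `w_j`. -/
@[ext]
structure FrobLift where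
  toRingHom : RHat p R →+* RHat p R
  lifts : ∀ x, ∃ y, toRingHom x = x ^ p + (p : RHat p R) * y
  log : ∀ j : Fin d, ∃ w : (RHat p R)ˣ,
    toRingHom (coord p k d R j) = (w : RHat p R) * coord p k d R j ^ p

variable {p k d R}

/-- The unit `w_j` with `Φ (T_j) = w_j T_j ^ p`; it is unique, as `T_j` is not a zero divisor. -/
def FrobLift.w (Φ : FrobLift p k d R) (j : Fin d) : (RHat p R)ˣ := (Φ.log j).choose

theorem FrobLift.map_coord (Φ : FrobLift p k d R) (j : Fin d) :
    Φ.toRingHom (coord p k d R j) = (Φ.w j : RHat p R) * coord p k d R j ^ p :=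
  (Φ.log j).choose_spec

variable [IsScalarTower (WittVector p k) (MvPolynomial (Fin d) (WittVector p k)) R]
  [Algebra.Etale (MvPolynomial (Fin d) (WittVector p k)) R]

variable (p k d) in
theorem X_regular_mod_p (j : Fin d) (n : ℕ) {f g : MvPolynomial (Fin d) (WittVector p k)}
    (hfg : MvPolynomial.X j ^ n * f = (p : MvPolynomial (Fin d) (WittVector p k)) * g) :
    ∃ g', f = (p : MvPolynomial (Fin d) (WittVector p k)) * g' := by
  have hp : (p : MvPolynomial (Fin d) (WittVector p k)) =
      MvPolynomial.C (p : WittVector p k) := by simp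
  have h5 : MvPolynomial.C (p : WittVector p k) ∣ f := by
    rw [MvPolynomial.C_dvd_iff_dvd_coeff]
    intro m
    have h6 := congrArg (MvPolynomial.coeff (Finsupp.single j n + m)) hfg
    rw [MvPolynomial.X_pow_eq_monomial, MvPolynomial.coeff_monomial_mul, one_mul, hp,
      MvPolynomial.coeff_C_mul] at h6
    exact ⟨_, h6⟩
  obtain ⟨g', hg'⟩ := h5
  exact ⟨g', by rw [hp, hg']⟩

variable (k d) in
theorem algebraMap_X_regular_mod_p (j : Fin d) (n : ℕ) {r z : R}
    (h : (algebraMap (MvPolynomial (Fin d) (WittVector p k)) R (MvPolynomial.X j)) ^ n * r =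
      (p : R) * z) : ∃ r', r = (p : R) * r' := by
  have h' : algebraMap (MvPolynomial (Fin d) (WittVector p k)) R (MvPolynomial.X j ^ n) * r =
      algebraMap (MvPolynomial (Fin d) (WittVector p k)) R (p : MvPolynomial _ _) * z := by
    rw [map_pow, map_natCast]; exact h
  obtain ⟨r', hr'⟩ := exists_eq_mul_of_flat (fun f g => X_regular_mod_p p k d j n) h'
  exact ⟨r', by rw [hr', map_natCast]⟩

variable (k d) in
theorem coord_regular_mod_p (j : Fin d) (n : ℕ) {x : RHat p R}
    (hx : ∃ y, coord p k d R j ^ n * x = (p : RHat p R) * y) :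
    ∃ y, x = (p : RHat p R) * y := by
  obtain ⟨y, hy⟩ := hx
  obtain ⟨r, x', rfl⟩ := exists_eq_add x 1
  suffices h : ∃ r', r = (p : R) * r' by
    obtain ⟨r', rfl⟩ := h
    exact ⟨algebraMap R _ r' + x', by simp [mul_add]⟩
  have h3 : algebraMap R (RHat p R) ((algebraMap (MvPolynomial (Fin d) (WittVector p k)) R
      (MvPolynomial.X j)) ^ n * r) = (p : RHat p R) ^ 1 * (y - coord p k d R j ^ n * x') := by
    rw [pow_one, mul_sub, ← hy, map_mul, map_pow, coord]
    ring
  obtain ⟨z, hz⟩ := exists_eq_of_algebraMap_eq h3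
  exact algebraMap_X_regular_mod_p k d j n hz

theorem FrobLift.exists_u (Φ : FrobLift p k d R) (j : Fin d) :
    ∃ u : RHat p R, (Φ.w j : RHat p R) = 1 + (p : RHat p R) * u := by
  obtain ⟨y, hy⟩ := Φ.lifts (coord p k d R j)
  rw [Φ.map_coord] at hy
  obtain ⟨u, hu⟩ := coord_regular_mod_p k d j p (x := (Φ.w j : RHat p R) - 1)
    ⟨y, by linear_combination hy⟩
  exact ⟨u, by rw [← hu]; ring⟩

/-- The element `u_j` with `Φ (T_j) = (1 + p u_j) T_j ^ p`. -/
def FrobLift.u (Φ : FrobLift p k d R) (j : Fin d) : RHat p R := (Φ.exists_u j).choose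

theorem FrobLift.w_eq (Φ : FrobLift p k d R) (j : Fin d) :
    (Φ.w j : RHat p R) = 1 + (p : RHat p R) * Φ.u j := (Φ.exists_u j).choose_spec

/-- The coefficients of `(1/p) Φ^* ω_j = ∑ₖ (λ_{jk}) ω_k`, where `ω_j` is `dlog T_j` for `j` among
the first `s` indices and `dT_j` for the others. As `Φ (T_j) = w_j T_j ^ p` and
`w_j = 1 + p u_j`, one has `(1/p) Φ^* dlog T_j = dlog T_j + w_j⁻¹ du_j` and
`(1/p) Φ^* dT_j = w_j T_j ^ (p - 1) dT_j + T_j ^ p du_j`. -/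
def FrobLift.lam (s : ℕ) (Φ : FrobLift p k d R) (j i : Fin d) : RHat p R :=
  if (j : ℕ) < s then
    (if i = j then 1 else 0) + ((Φ.w j)⁻¹ : (RHat p R)ˣ) * logDer p k d s R i (Φ.u j)
  else
    (if i = j then (Φ.w j : RHat p R) * coord p k d R j ^ (p - 1) else 0) +
      coord p k d R j ^ p * logDer p k d s R i (Φ.u j)

/-- `R̂` as an `R`-module through a ring endomorphism of `R̂`. -/
def PhiMod (_f : RHat p R →+* RHat p R) : Type v := RHat p R

theorem frobDer_eq_zero [CharP k p] [PerfectRing k p] (f : RHat p R →+* RHat p R)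
    (δ : RHat p R →+ RHat p R) (hδ : ∀ x y, δ (x * y) = f x * δ y + f y * δ x)
    (hT : ∀ j, δ (coord p k d R j) = 0) (x : RHat p R) : δ x = 0 := by
  have hone : δ 1 = 0 := by
    have := hδ 1 1
    simp only [mul_one, map_one, one_mul] at this
    exact left_eq_add.1 this
  have hp : ∀ y, δ ((p : RHat p R) * y) = (p : RHat p R) * δ y := fun y => by
    rw [← nsmul_eq_mul, map_nsmul, nsmul_eq_mul]
  have hppow : ∀ n y, δ ((p : RHat p R) ^ n * y) = (p : RHat p R) ^ n * δ y := fun n y => by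
    induction n with
    | zero => simp
    | succ n ih => rw [pow_succ', mul_assoc, hp, ih, mul_assoc]
  have hpow : ∀ n y, δ (y ^ (n + 1)) = (n + 1 : ℕ) * f y ^ n * δ y := fun n y => by
    induction n with
    | zero => simp
    | succ n ih =>
      rw [pow_succ, hδ, ih, map_pow]
      push_cast; ring
  -- constants
  have hW : ∀ n : ℕ, ∀ c : WittVector p k, ∃ y, δ (algebraMap _ (RHat p R) c) =
      (p : RHat p R) ^ n * y := by
    intro n
    induction n with
    | zero => intro c; exact ⟨_, by rw [pow_zero, one_mul]⟩
    | succ n ih =>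
      intro c
      obtain ⟨b, hb⟩ := (frobeniusEquiv k p).surjective (c.coeff 0)
      have hb' : b ^ p = c.coeff 0 := hb
      let x := WittVector.teichmuller p b
      have hx : c - x ^ p ∈ Ideal.span {(p : WittVector p k)} := by
        rw [← WittVector.ker_constantCoeff, RingHom.mem_ker, map_sub, map_pow]
        simp [x, WittVector.constantCoeff_apply, hb']
      obtain ⟨z, hz⟩ := Ideal.mem_span_singleton'.1 hx
      have hc : c = x ^ p + (p : WittVector p k) * z := by rw [mul_comm, hz]; ring
      obtain ⟨y1, hy1⟩ := ih x
      obtain ⟨y2, hy2⟩ := ih z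
      have hp1 : p - 1 + 1 = p := Nat.sub_add_cancel (Fact.out : p.Prime).one_le
      have h11 : δ ((algebraMap (WittVector p k) (RHat p R) x) ^ p) =
          p * f (algebraMap _ _ x) ^ (p - 1) * δ (algebraMap _ _ x) := by
        have := hpow (p - 1) (algebraMap _ (RHat p R) x)
        rwa [hp1] at this
      refine ⟨f (algebraMap _ _ x) ^ (p - 1) * y1 + y2, ?_⟩
      rw [hc, map_add, map_pow, map_mul, map_natCast, map_add, h11, hp, hy1, hy2]
      ring
  have hW0 : ∀ c : WittVector p k, δ (algebraMap _ (RHat p R) c) = 0 := fun c =>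
    eq_zero_of_pow_dvd fun n => hW n c
  -- polynomials
  have hS : ∀ g : MvPolynomial (Fin d) (WittVector p k),
      δ (algebraMap R (RHat p R) (algebraMap _ R g)) = 0 := by
    intro g
    induction g using MvPolynomial.induction_on with
    | C c =>
      have : algebraMap R (RHat p R) (algebraMap (MvPolynomial (Fin d) (WittVector p k)) R
          (MvPolynomial.C c)) =
          algebraMap (WittVector p k) (RHat p R) c := by
        rw [← MvPolynomial.algebraMap_eq, ← IsScalarTower.algebraMap_apply (WittVector p k)
          (MvPolynomial (Fin d) (WittVector p k)) R]; rfl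
      rw [this, hW0]
    | add g h hg hh => rw [map_add, map_add, map_add, hg, hh, add_zero]
    | mul_X g j hg =>
      rw [map_mul, map_mul, hδ, hg, mul_zero, add_zero]
      have := hT j
      rw [coord] at this
      rw [this, mul_zero]
  -- the étale extension
  have hR : ∀ r : R, δ (algebraMap R (RHat p R) r) = 0 := by
    let : AddCommGroup (PhiMod f) := inferInstanceAs (AddCommGroup (RHat p R))
    let : Module R (PhiMod f) :=
      Module.compHom (RHat p R) (f.comp (algebraMap R (RHat p R)))
    let : Module (MvPolynomial (Fin d) (WittVector p k)) (PhiMod f) :=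
      Module.compHom (PhiMod f) (algebraMap (MvPolynomial (Fin d) (WittVector p k)) R)
    have : IsScalarTower (MvPolynomial (Fin d) (WittVector p k)) R (PhiMod f) :=
      IsScalarTower.of_algebraMap_smul fun _ _ => rfl
    let D : Derivation (MvPolynomial (Fin d) (WittVector p k)) R (PhiMod f) :=
      Derivation.mk'
        { toFun := fun r => (δ (algebraMap R (RHat p R) r) : RHat p R)
          map_add' := fun a b => by rw [map_add, map_add]; rfl
          map_smul' := fun c a => by
            rw [Algebra.smul_def, map_mul, hδ, hS, mul_zero, add_zero]
            rfl }
        (fun a b => by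
          change δ (algebraMap R (RHat p R) (a * b)) = _
          rw [map_mul, hδ]; rfl)
    intro r
    have h12 : D r = D.liftKaehlerDifferential (KaehlerDifferential.D _ R r) :=
      (D.liftKaehlerDifferential_comp_D r).symm
    rw [Subsingleton.elim (KaehlerDifferential.D (MvPolynomial (Fin d) (WittVector p k)) R r) 0,
      map_zero] at h12
    exact h12
  refine eq_zero_of_pow_dvd fun n => ?_
  obtain ⟨r, y, rfl⟩ := exists_eq_add x n
  exact ⟨δ y, by rw [map_add, hR, hppow, zero_add]⟩

/-- The chain rule `d (Φ r) = ∑ⱼ Φ (∂_j r) Φ^* ω_j`. -/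
theorem FrobLift.logDer_map [CharP k p] [PerfectRing k p] (Φ : FrobLift p k d R) (i : Fin d)
    (r : RHat p R) :
    logDer p k d s R i (Φ.toRingHom r) =
      (p : RHat p R) * ∑ j, Φ.lam s j i * Φ.toRingHom (logDer p k d s R j r) := by
  let δ : RHat p R →+ RHat p R :=
    { toFun := fun r => logDer p k d s R i (Φ.toRingHom r) -
        (p : RHat p R) * ∑ j, Φ.lam s j i * Φ.toRingHom (logDer p k d s R j r)
      map_zero' := by simp
      map_add' := fun x y => by
        simp only [map_add, mul_add, Finset.sum_add_distrib]; ring }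
  refine sub_eq_zero.1 (frobDer_eq_zero (k := k) (d := d) Φ.toRingHom δ (fun x y => ?_)
    (fun j => ?_) r)
  · change logDer p k d s R i (Φ.toRingHom (x * y)) -
        (p : RHat p R) * ∑ j, Φ.lam s j i * Φ.toRingHom (logDer p k d s R j (x * y)) =
      Φ.toRingHom x * (logDer p k d s R i (Φ.toRingHom y) -
        (p : RHat p R) * ∑ j, Φ.lam s j i * Φ.toRingHom (logDer p k d s R j y)) +
      Φ.toRingHom y * (logDer p k d s R i (Φ.toRingHom x) -
        (p : RHat p R) * ∑ j, Φ.lam s j i * Φ.toRingHom (logDer p k d s R j x))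
    simp only [map_mul, Derivation.leibniz, smul_eq_mul, map_add, mul_add,
      Finset.sum_add_distrib]
    have h1 : ∀ a b : RHat p R, ∑ j, Φ.lam s j i *
        (Φ.toRingHom a * Φ.toRingHom (logDer p k d s R j b)) =
        Φ.toRingHom a * ∑ j, Φ.lam s j i * Φ.toRingHom (logDer p k d s R j b) := by
      intro a b
      rw [Finset.mul_sum]
      exact Finset.sum_congr rfl fun _ _ => by ring
    rw [h1, h1]; ring
  · change logDer p k d s R i (Φ.toRingHom (coord p k d R j)) -
        (p : RHat p R) * ∑ l, Φ.lam s l i *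
          Φ.toRingHom (logDer p k d s R l (coord p k d R j)) = 0
    have hp1 : p - 1 + 1 = p := Nat.sub_add_cancel (Fact.out : p.Prime).one_le
    have hsum : ∑ l, Φ.lam s l i * Φ.toRingHom (logDer p k d s R l (coord p k d R j)) =
        Φ.lam s j i * Φ.toRingHom (logDer p k d s R j (coord p k d R j)) := by
      refine Finset.sum_eq_single j (fun l _ hl => ?_) (by simp)
      rw [logDer_coord, if_neg hl, map_zero, mul_zero]
    have hw : logDer p k d s R i (Φ.w j : RHat p R) =
        (p : RHat p R) * logDer p k d s R i (Φ.u j) := by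
      rw [Φ.w_eq]; simp [Derivation.leibniz]
    have hinv : (Φ.w j : RHat p R) * ((Φ.w j)⁻¹ : (RHat p R)ˣ) = 1 := Units.mul_inv _
    have hpow : coord p k d R j ^ p = coord p k d R j ^ (p - 1) * coord p k d R j := by
      rw [← pow_succ, hp1]
    rw [hsum, Φ.map_coord, Derivation.leibniz, Derivation.leibniz_pow, hw]
    simp only [smul_eq_mul, nsmul_eq_mul, logDer_coord, if_true, FrobLift.lam]
    by_cases hs : (j : ℕ) < s
    · simp only [hs, if_true, Φ.map_coord]
      by_cases hij : i = j
      · simp only [hij, if_true]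
        rw [hpow]
        linear_combination (-(p : RHat p R) * coord p k d R j ^ (p - 1) * coord p k d R j *
          logDer p k d s R j (Φ.u j)) * hinv
      · simp only [hij, if_false]
        linear_combination (-(p : RHat p R) * coord p k d R j ^ p *
          logDer p k d s R i (Φ.u j)) * hinv
    · simp only [hs, if_false, map_one, mul_one]
      by_cases hij : i = j
      · simp only [hij, if_true]; ring
      · simp only [hij, if_false]; ring

end Frobenius

/- Base change along a Frobenius lift -/

section BaseChange

variable {p : ℕ} [Fact p.Prime] {k : Type u} [Field k]
  {d : ℕ} {R : Type v} [CommRing R]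
  [Algebra (WittVector p k) R] [Algebra (MvPolynomial (Fin d) (WittVector p k)) R]

/-- `R̂` regarded as an `R̂`-algebra through `Φ`. -/
def FrobTwist (_Φ : FrobLift p k d R) : Type v := RHat p R

instance (Φ : FrobLift p k d R) : CommRing (FrobTwist Φ) := inferInstanceAs (CommRing (RHat p R))

instance (Φ : FrobLift p k d R) : Algebra (RHat p R) (FrobTwist Φ) := Φ.toRingHom.toAlgebra

/-- The base change `M ⊗_Φ R̂` of an `R̂`-module `M` along `Φ`. -/
def FrobBC (Φ : FrobLift p k d R) (M : Type w) [AddCommGroup M] [Module (RHat p R) M] :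
    Type (max v w) := FrobTwist Φ ⊗[RHat p R] M

section

variable (Φ : FrobLift p k d R) (M : Type w) [AddCommGroup M] [Module (RHat p R) M]

instance : AddCommGroup (FrobBC Φ M) :=
  inferInstanceAs (AddCommGroup (FrobTwist Φ ⊗[RHat p R] M))

/-- The `R̂`-module structure of `M ⊗_Φ R̂` is that of the factor `R̂`. -/
instance : Module (RHat p R) (FrobBC Φ M) :=
  inferInstanceAs (Module (FrobTwist Φ) (FrobTwist Φ ⊗[RHat p R] M))

end

variable {Φ : FrobLift p k d R} {M : Type w} [AddCommGroup M] [Module (RHat p R) M]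

/-- The element `x ⊗_Φ r` of `M ⊗_Φ R̂`. -/
def FrobBC.tmul (Φ : FrobLift p k d R) (x : M) (r : RHat p R) : FrobBC Φ M :=
  TensorProduct.tmul (RHat p R) (M := FrobTwist Φ) r x

theorem FrobBC.smul_tmul (x : M) (a r : RHat p R) :
    a • FrobBC.tmul Φ x r = FrobBC.tmul Φ x (a * r) := rfl

theorem FrobBC.tmul_smul (x : M) (a r : RHat p R) :
    FrobBC.tmul Φ (a • x) r = FrobBC.tmul Φ x (Φ.toRingHom a * r) :=
  (TensorProduct.smul_tmul (R := RHat p R) (M := FrobTwist Φ) a r x).symm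

theorem FrobBC.tmul_add (x y : M) (r : RHat p R) :
    FrobBC.tmul Φ (x + y) r = FrobBC.tmul Φ x r + FrobBC.tmul Φ y r :=
  TensorProduct.tmul_add _ _ _

theorem FrobBC.tmul_add' (x : M) (r t : RHat p R) :
    FrobBC.tmul Φ x (r + t) = FrobBC.tmul Φ x r + FrobBC.tmul Φ x t :=
  TensorProduct.add_tmul _ _ _

theorem FrobBC.tmul_zero (r : RHat p R) : FrobBC.tmul Φ (0 : M) r = 0 :=
  TensorProduct.tmul_zero _ _

theorem FrobBC.zero_tmul (x : M) : FrobBC.tmul Φ x 0 = 0 :=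
  TensorProduct.zero_tmul _ _

/-- The base change `g ⊗_Φ 1` of a linear map `g`. -/
def FrobBC.map (Φ : FrobLift p k d R) {N : Type w} [AddCommGroup N] [Module (RHat p R) N]
    (g : M →ₗ[RHat p R] N) : FrobBC Φ M →ₗ[RHat p R] FrobBC Φ N :=
  (LinearMap.baseChange (FrobTwist Φ) g :
    (FrobTwist Φ ⊗[RHat p R] M) →ₗ[FrobTwist Φ] (FrobTwist Φ ⊗[RHat p R] N))

theorem FrobBC.map_tmul {N : Type w} [AddCommGroup N] [Module (RHat p R) N]
    (g : M →ₗ[RHat p R] N) (x : M) (r : RHat p R) :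
    FrobBC.map Φ g (FrobBC.tmul Φ x r) = FrobBC.tmul Φ (g x) r := rfl

theorem FrobBC.map_id (x : FrobBC Φ M) : FrobBC.map Φ (LinearMap.id (M := M)) x = x :=
  congrArg (fun f : (FrobTwist Φ ⊗[RHat p R] M) →ₗ[FrobTwist Φ] _ => f x)
    (LinearMap.baseChange_id (A := FrobTwist Φ) (R := RHat p R) (M := M))

theorem FrobBC.map_comp {N P : Type w} [AddCommGroup N] [Module (RHat p R) N]
    [AddCommGroup P] [Module (RHat p R) P]
    (g : M →ₗ[RHat p R] N) (h : N →ₗ[RHat p R] P) (x : FrobBC Φ M) :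
    FrobBC.map Φ (h ∘ₗ g) x = FrobBC.map Φ h (FrobBC.map Φ g x) :=
  congrArg (fun f : (FrobTwist Φ ⊗[RHat p R] M) →ₗ[FrobTwist Φ] _ => f x)
    (LinearMap.baseChange_comp (A := FrobTwist Φ) g h)

/-- The additive map on `M ⊗_Φ R̂` with `x ⊗_Φ r ↦ r • θ x + x ⊗_Φ δ r`, for a map `θ` that
satisfies the Leibniz rule with respect to `δ ∘ Φ`. -/
def FrobBC.extend (δ : RHat p R →+ RHat p R)
    (hδ : ∀ a b, δ (a * b) = a * δ b + b * δ a) (θ : M →+ FrobBC Φ M)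
    (hθ : ∀ (a : RHat p R) (x : M), θ (a • x) =
      Φ.toRingHom a • θ x + FrobBC.tmul Φ x (δ (Φ.toRingHom a))) : FrobBC Φ M →+ FrobBC Φ M :=
  TensorProduct.liftAddHom (R := RHat p R) (M := FrobTwist Φ) (N := M)
    { toFun := fun (r : RHat p R) =>
        { toFun := fun x => r • θ x + FrobBC.tmul Φ x (δ r)
          map_zero' := by rw [map_zero, smul_zero, FrobBC.tmul_zero, add_zero]
          map_add' := fun x y => by rw [map_add, smul_add, FrobBC.tmul_add]; abel }
      map_zero' := by
        ext x
        change (0 : RHat p R) • θ x + FrobBC.tmul Φ x (δ 0) = 0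
        rw [zero_smul, map_zero, FrobBC.zero_tmul, add_zero]
      map_add' := fun (r t : RHat p R) => by
        ext x
        change (r + t) • θ x + FrobBC.tmul Φ x (δ (r + t)) =
          (r • θ x + FrobBC.tmul Φ x (δ r)) + (t • θ x + FrobBC.tmul Φ x (δ t))
        rw [add_smul, map_add, FrobBC.tmul_add']; abel }
    (fun a (r : RHat p R) x => by
      change (Φ.toRingHom a * r) • θ x + FrobBC.tmul Φ x (δ (Φ.toRingHom a * r)) =
        r • θ (a • x) + FrobBC.tmul Φ (a • x) (δ r)
      rw [hθ, hδ, FrobBC.tmul_add', FrobBC.tmul_smul, smul_add, smul_smul, FrobBC.smul_tmul,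
        mul_comm r (Φ.toRingHom a), add_assoc, add_comm (FrobBC.tmul Φ x (Φ.toRingHom a * δ r))])

theorem FrobBC.extend_tmul (δ : RHat p R →+ RHat p R)
    (hδ : ∀ a b, δ (a * b) = a * δ b + b * δ a) (θ : M →+ FrobBC Φ M)
    (hθ : ∀ (a : RHat p R) (x : M), θ (a • x) =
      Φ.toRingHom a • θ x + FrobBC.tmul Φ x (δ (Φ.toRingHom a))) (x : M) (r : RHat p R) :
    FrobBC.extend δ hδ θ hθ (FrobBC.tmul Φ x r) = r • θ x + FrobBC.tmul Φ x (δ r) := rfl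

end BaseChange

/- Filtered logarithmic de Rham modules -/

section Local

variable (p : ℕ) (A : Type v) [CommRing A]

/-- The ideal `p ^ e A`, with `p ^ ∞ = 0`. -/
def pPowIdeal (e : ℕ∞) : Ideal A :=
  if e = ⊤ then ⊥ else Ideal.span {(p : A) ^ e.toNat}

/-- `N` is a direct summand of `M` in a neighbourhood of every point of the special fibre. -/
def IsLocallySplit {M : Type w} [AddCommGroup M] [Module A M] (N : Submodule A M) : Prop :=
  ∀ 𝔭 : PrimeSpectrum A, (p : A) ∈ 𝔭.asIdeal → ∃ f : A, f ∉ 𝔭.asIdeal ∧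
    ∃ C : Submodule (Localization (Submonoid.powers f)) (LocalizedModule (Submonoid.powers f) M),
      IsCompl (N.localized (Submonoid.powers f)) C

/-- In a neighbourhood of every point of the special fibre, `M` is a finite direct sum of modules
`𝒪 / p ^ e`, where `e = ∞` is allowed. -/
def IsLocallySumOfPrimary (M : Type w) [AddCommGroup M] [Module A M] : Prop :=
  ∀ 𝔭 : PrimeSpectrum A, (p : A) ∈ 𝔭.asIdeal → ∃ f : A, f ∉ 𝔭.asIdeal ∧
    ∃ (n : ℕ) (e : Fin n → ℕ∞), Nonempty
      (LocalizedModule (Submonoid.powers f) M ≃ₗ[Localization (Submonoid.powers f)]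
        ∀ i, Localization (Submonoid.powers f) ⧸
          pPowIdeal p (Localization (Submonoid.powers f)) (e i))

end Local

section DeRham

variable (p : ℕ) [Fact p.Prime] (k : Type u) [Field k]
  (d s : ℕ) (R : Type v) [CommRing R]
  [Algebra (WittVector p k) R] [Algebra (MvPolynomial (Fin d) (WittVector p k)) R]
  [IsScalarTower (WittVector p k) (MvPolynomial (Fin d) (WittVector p k)) R]
  [Algebra.Etale (MvPolynomial (Fin d) (WittVector p k)) R]
  (a b : ℤ)

/-- A finitely generated `R̂`-module `V` with an integrable connection `∇` with logarithmic poles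
along `T_1 ⋯ T_s = 0` and a Hodge filtration of level in `[a, b]`. The connection is given by its
components: `∇ v = ∑ⱼ nabla j v ⊗ ω_j`, where `ω_j` is `dlog T_j` for `j` among the first `s` indices
and `dT_j` for the others, so that `nabla j` is `∇` along the dual derivation `logDer j`. -/
structure FilDeRham where
  V : Type w
  [addCommGroup : AddCommGroup V]
  [module : Module (RHat p R) V]
  finite : Module.Finite (RHat p R) V
  nabla : Fin d → AddMonoid.End V
  leibniz : ∀ (j : Fin d) (r : RHat p R) (v : V),
    nabla j (r • v) = logDer p k d s R j r • v + r • nabla j v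
  /-- The curvature vanishes (the derivations `logDer j` commute with each other). -/
  integrable : ∀ (i j : Fin d) (v : V), nabla i (nabla j v) = nabla j (nabla i v)
  Fil : ℤ → Submodule (RHat p R) V
  antitone : ∀ i : ℤ, Fil i ≤ Fil (i - 1)
  fil_of_le : ∀ i : ℤ, i ≤ a → Fil i = ⊤
  fil_of_lt : ∀ i : ℤ, b < i → Fil i = ⊥
  split : ∀ i : ℤ, IsLocallySplit p (RHat p R) (Fil i)
  graded : ∀ i : ℤ, IsLocallySumOfPrimary p (RHat p R) (Fil i ⧸ (Fil (i + 1)).submoduleOf (Fil i))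
  griffiths : ∀ (i : ℤ) (j : Fin d) (v : V), v ∈ Fil i → nabla j v ∈ Fil (i - 1)

attribute [instance] FilDeRham.addCommGroup FilDeRham.module

variable {p k d s R a b}

namespace FilDeRham

variable (X : FilDeRham.{u, v, w} p k d s R a b)

/-- `⨁_{a ≤ i ≤ b} Fil^i V`. -/
abbrev FilSum : Type w := ⨁ i : Set.Icc a b, X.Fil i

/-- The relations `p x ∼ y` for `x ∈ Fil^i V`, where `y` is the image of `x` in `Fil^{i-1} V`. -/
def tildeRel : Submodule (RHat p R) X.FilSum :=
  Submodule.span _ {z | ∃ (i j : Set.Icc a b) (x : X.V) (hi : x ∈ X.Fil i) (hj : x ∈ X.Fil j),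
    (j : ℤ) = i - 1 ∧
    z = (p : RHat p R) • DirectSum.lof (RHat p R) _ (fun i : Set.Icc a b => X.Fil i) i ⟨x, hi⟩ -
      DirectSum.lof (RHat p R) _ (fun i : Set.Icc a b => X.Fil i) j ⟨x, hj⟩}

/-- `Ṽ`, the quotient of `⨁_{a ≤ i ≤ b} Fil^i V` by the relations `p x ∼ y`. -/
abbrev Tilde : Type w := X.FilSum ⧸ X.tildeRel

/-- `[x]_i ∈ Ṽ` for `x ∈ Fil^i V`. -/
def br (i : Set.Icc a b) : X.Fil i →ₗ[RHat p R] X.Tilde :=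
  X.tildeRel.mkQ ∘ₗ DirectSum.lof (RHat p R) _ (fun i : Set.Icc a b => X.Fil i) i

theorem br_rel (i j : Set.Icc a b) (hij : (j : ℤ) = i - 1) (x : X.V) (hi : x ∈ X.Fil i)
    (hj : x ∈ X.Fil j) : X.br j ⟨x, hj⟩ = (p : RHat p R) • X.br i ⟨x, hi⟩ := by
  symm
  rw [← sub_eq_zero, ← map_smul, br, br, LinearMap.comp_apply, LinearMap.comp_apply, ← map_sub,
    Submodule.mkQ_apply, Submodule.Quotient.mk_eq_zero]
  refine Submodule.subset_span ⟨i, j, x, hi, hj, hij, ?_⟩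
  rw [map_smul]

/-- The index `max (a, i - n)`. -/
def trunc (i : Set.Icc a b) (n : ℕ) : Set.Icc a b :=
  ⟨max a (i - n), le_max_left _ _, max_le (i.2.1.trans i.2.2) (by have := i.2.2; omega)⟩

theorem mem_trunc (i : Set.Icc a b) (n : ℕ) {x : X.V} (hx : x ∈ X.Fil (i - n)) :
    x ∈ X.Fil (trunc i n) := by
  by_cases h : (i : ℤ) - n ≤ a
  · have : ((trunc i n : Set.Icc a b) : ℤ) = a := max_eq_left h
    rw [this, X.fil_of_le a le_rfl]; trivial
  · have : ((trunc i n : Set.Icc a b) : ℤ) = i - n := max_eq_right (le_of_not_ge h)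
    rwa [this]

theorem mem_trunc_one (i : Set.Icc a b) {x : X.V} (hx : x ∈ X.Fil (i - 1)) :
    x ∈ X.Fil (trunc i 1) := X.mem_trunc i 1 (by simpa using hx)

/-- `[x]_{i-1} ∈ Ṽ` for `x ∈ Fil^{i-1} V` and `a ≤ i ≤ b`, where `[x]_{a-1} = p [x]_a`. -/
def brPred (i : Set.Icc a b) : X.Fil (i - 1) →ₗ[RHat p R] X.Tilde :=
  (if (i : ℤ) = a then (p : RHat p R) else 1) •
    (X.br (trunc i 1) ∘ₗ Submodule.inclusion fun _ hx => X.mem_trunc_one i hx)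

theorem br_congr {i j : Set.Icc a b} (hij : (i : ℤ) = j) {x : X.V} (hi : x ∈ X.Fil i)
    (hj : x ∈ X.Fil j) : X.br i ⟨x, hi⟩ = X.br j ⟨x, hj⟩ := by
  obtain rfl : i = j := Subtype.ext hij
  rfl

theorem brPred_apply (i : Set.Icc a b) (x : X.V) (hx : x ∈ X.Fil (i - 1)) :
    X.brPred i ⟨x, hx⟩ = (if (i : ℤ) = a then (p : RHat p R) else 1) •
      X.br (trunc i 1) ⟨x, X.mem_trunc_one i hx⟩ := rfl

theorem brPred_of_mem (i : Set.Icc a b) (x : X.V) (hx : x ∈ X.Fil i) (hx' : x ∈ X.Fil (i - 1)) :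
    X.brPred i ⟨x, hx'⟩ = (p : RHat p R) • X.br i ⟨x, hx⟩ := by
  rw [brPred_apply]
  have h2 := i.2.1
  by_cases h : (i : ℤ) = a
  · rw [if_pos h, X.br_congr (i := trunc i 1) (j := i) (by simp [trunc, h]) _ hx]
  · rw [if_neg h, one_smul]
    exact X.br_rel i (trunc i 1) (by simp only [trunc, Nat.cast_one]; omega) x hx _

theorem brPred_of_eq (i j : Set.Icc a b) (hij : (j : ℤ) = i - 1) (x : X.V)
    (hx : x ∈ X.Fil (i - 1)) (hx' : x ∈ X.Fil j) : X.brPred i ⟨x, hx⟩ = X.br j ⟨x, hx'⟩ := by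
  rw [brPred_apply]
  have h2 := j.2.1
  rw [if_neg (by omega), one_smul]
  exact X.br_congr (by simp only [trunc, Nat.cast_one]; omega) _ _

section PullConn

variable (Φ : FrobLift p k d R) (m : Fin d)

/-- The map `[v]_i ↦ ∑ⱼ [∇_j v]_{i-1} ⊗ λ_{jm}` on `⨁ Fil^i V`. -/
def preConn : X.FilSum →+ FrobBC Φ X.Tilde :=
  DirectSum.toAddMonoid fun i =>
    { toFun := fun v => ∑ j, FrobBC.tmul Φ
        (X.brPred i ⟨X.nabla j v, X.griffiths i j v v.2⟩) (Φ.lam s j m)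
      map_zero' := by
        refine Finset.sum_eq_zero fun j _ => ?_
        have : (⟨X.nabla j ((0 : X.Fil i) : X.V), X.griffiths i j _ (0 : X.Fil i).2⟩ :
          X.Fil (i - 1)) = 0 := Subtype.ext (by simp)
        rw [this, map_zero, FrobBC.tmul_zero]
      map_add' := fun v v' => by
        rw [← Finset.sum_add_distrib]
        refine Finset.sum_congr rfl fun j _ => ?_
        rw [← FrobBC.tmul_add, ← map_add]
        congr 2
        exact Subtype.ext (by simp) }

theorem preConn_lof (i : Set.Icc a b) (v : X.Fil i) :
    X.preConn Φ m (DirectSum.lof (RHat p R) _ (fun i : Set.Icc a b => X.Fil i) i v) =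
      ∑ j, FrobBC.tmul Φ (X.brPred i ⟨X.nabla j v, X.griffiths i j v v.2⟩) (Φ.lam s j m) := by
  rw [DirectSum.lof_eq_of, preConn, DirectSum.toAddMonoid_of]
  rfl

variable [CharP k p] [PerfectRing k p]

theorem preConn_smul (r : RHat p R) (z : X.FilSum) :
    X.preConn Φ m (r • z) = Φ.toRingHom r • X.preConn Φ m z +
      FrobBC.tmul Φ (X.tildeRel.mkQ z) (logDer p k d s R m (Φ.toRingHom r)) := by
  induction z using DirectSum.induction_on with
  | zero => rw [smul_zero, map_zero, smul_zero, map_zero, FrobBC.tmul_zero, add_zero]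
  | add x y hx hy =>
    rw [smul_add, map_add, hx, hy, map_add, map_add, smul_add, FrobBC.tmul_add]; abel
  | of i v =>
    change X.preConn Φ m (r • DirectSum.lof (RHat p R) _ (fun i : Set.Icc a b => X.Fil i) i v) =
      Φ.toRingHom r • X.preConn Φ m
        (DirectSum.lof (RHat p R) _ (fun i : Set.Icc a b => X.Fil i) i v) +
      FrobBC.tmul Φ (X.br i v) (logDer p k d s R m (Φ.toRingHom r))
    rw [← map_smul, preConn_lof, preConn_lof, Φ.logDer_map, Finset.smul_sum, Finset.mul_sum]
    have hsum : ∀ f : Fin d → RHat p R,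
        FrobBC.tmul Φ (X.br i v) (∑ j, f j) = ∑ j, FrobBC.tmul Φ (X.br i v) (f j) := fun f =>
      map_sum (AddMonoidHom.mk' (FrobBC.tmul Φ (X.br i v)) fun _ _ => FrobBC.tmul_add' _ _ _) _ _
    rw [hsum, ← Finset.sum_add_distrib]
    refine Finset.sum_congr rfl fun j _ => ?_
    have h1 : X.brPred i ⟨X.nabla j ((r • v : X.Fil i) : X.V),
          X.griffiths i j _ (r • v : X.Fil i).2⟩ =
        r • X.brPred i ⟨X.nabla j v, X.griffiths i j v v.2⟩ +
          logDer p k d s R j r • (p : RHat p R) • X.br i v := by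
      rw [← X.brPred_of_mem i v v.2 (X.antitone i v.2), ← map_smul, ← map_smul, ← map_add]
      congr 1
      refine Subtype.ext ?_
      change X.nabla j (r • (v : X.V)) = r • X.nabla j v + logDer p k d s R j r • (v : X.V)
      rw [X.leibniz, add_comm]
    rw [h1, FrobBC.tmul_add, FrobBC.tmul_smul, FrobBC.tmul_smul, FrobBC.tmul_smul,
      FrobBC.smul_tmul, map_natCast]
    congr 2
    ring

theorem preConn_rel (z : X.FilSum) (hz : z ∈ X.tildeRel) : X.preConn Φ m z = 0 := by
  induction hz using Submodule.span_induction with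
  | zero => exact map_zero _
  | add x y _ _ hx hy => rw [map_add, hx, hy, add_zero]
  | smul r x hx' hx =>
    have h0 : X.tildeRel.mkQ x = 0 := (Submodule.Quotient.mk_eq_zero X.tildeRel).2 hx'
    rw [preConn_smul, hx, smul_zero, zero_add, h0, FrobBC.tmul_zero]
  | mem z hz =>
    obtain ⟨i, j, x, hi, hj, hij, rfl⟩ := hz
    rw [map_sub, preConn_smul, map_natCast, Derivation.map_natCast, FrobBC.zero_tmul, add_zero,
      preConn_lof, preConn_lof, sub_eq_zero, Finset.smul_sum]
    refine Finset.sum_congr rfl fun l _ => ?_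
    have hl : X.nabla l x ∈ X.Fil j := by rw [hij]; exact X.griffiths i l x hi
    rw [X.brPred_of_mem j _ hl, X.brPred_of_eq i j hij _ _ hl, FrobBC.tmul_smul, map_natCast,
      FrobBC.smul_tmul]

/-- The map `[v]_i ↦ ∑ⱼ [∇_j v]_{i-1} ⊗ λ_{jm}` on `Ṽ`. -/
def preConnTilde : X.Tilde →+ FrobBC Φ X.Tilde :=
  QuotientAddGroup.lift X.tildeRel.toAddSubgroup (X.preConn Φ m) fun z hz => X.preConn_rel Φ m z hz

theorem preConnTilde_smul (r : RHat p R) (z : X.Tilde) :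
    X.preConnTilde Φ m (r • z) = Φ.toRingHom r • X.preConnTilde Φ m z +
      FrobBC.tmul Φ z (logDer p k d s R m (Φ.toRingHom r)) := by
  obtain ⟨z, rfl⟩ := X.tildeRel.mkQ_surjective z
  exact X.preConn_smul Φ m r z

/-- The component along `logDer m` of the logarithmic connection `Φ_* ∇̃` on `Ṽ ⊗_Φ R̂` with
`Φ_* ∇̃ ([v]_i ⊗ 1) = ∑ⱼ ([∇_j v]_{i-1} ⊗ 1) ⊗ (1/p) Φ^* ω_j`. -/
def pullConn : FrobBC Φ X.Tilde →+ FrobBC Φ X.Tilde :=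
  FrobBC.extend (logDer p k d s R m : RHat p R →+ RHat p R)
    (fun x y => (logDer p k d s R m).leibniz x y) (X.preConnTilde Φ m) (X.preConnTilde_smul Φ m)

theorem pullConn_tmul (z : X.Tilde) (r : RHat p R) :
    X.pullConn Φ m (FrobBC.tmul Φ z r) =
      r • X.preConnTilde Φ m z + FrobBC.tmul Φ z (logDer p k d s R m r) := rfl

theorem preConnTilde_br (i : Set.Icc a b) (v : X.Fil i) :
    X.preConnTilde Φ m (X.br i v) =
      ∑ j, FrobBC.tmul Φ (X.brPred i ⟨X.nabla j v, X.griffiths i j v v.2⟩) (Φ.lam s j m) :=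
  X.preConn_lof Φ m i v

end PullConn

section Taylor

/-- The operator `∇(∂_j)` for the logarithmic derivation `∂_j = T_j ∂/∂T_j`, for all `j`. -/
def nablaLog (j : Fin d) : AddMonoid.End X.V :=
  AddMonoidHom.mk' (fun v => if (j : ℕ) < s then X.nabla j v else coord p k d R j • X.nabla j v)
    fun v v' => by split_ifs <;> simp

/-- `∏_{l < n} (∇(∂_j) - l)`. -/
def nablaFalling (j : Fin d) (n : ℕ) : AddMonoid.End X.V :=
  ((List.range n).map fun l : ℕ => X.nablaLog j - (l : AddMonoid.End X.V)).prod

/-- `∇(∂)^{I} = ∏ⱼ ∏_{l < I_j} (∇(∂_j) - l)` for a multi-index `I`. -/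
def nablaMulti (I : Fin d → ℕ) : AddMonoid.End X.V :=
  (List.ofFn fun j => X.nablaFalling j (I j)).prod

theorem nablaLog_sub_mem (j : Fin d) (l : ℕ) (i : ℤ) {v : X.V} (hv : v ∈ X.Fil i) :
    (X.nablaLog j - (l : AddMonoid.End X.V)) v ∈ X.Fil (i - 1) := by
  have h1 : (X.nablaLog j - (l : AddMonoid.End X.V)) v = X.nablaLog j v - (l : ℕ) • v := by
    rfl
  rw [h1]
  refine Submodule.sub_mem _ ?_ (Submodule.smul_of_tower_mem _ _ (X.antitone i hv))
  change (if (j : ℕ) < s then X.nabla j v else coord p k d R j • X.nabla j v) ∈ X.Fil (i - 1)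
  split_ifs
  · exact X.griffiths i j v hv
  · exact Submodule.smul_mem _ _ (X.griffiths i j v hv)

theorem nablaFalling_mem (j : Fin d) (n : ℕ) (i : ℤ) {v : X.V} (hv : v ∈ X.Fil i) :
    X.nablaFalling j n v ∈ X.Fil (i - n) := by
  induction n generalizing i v with
  | zero => simpa [nablaFalling] using hv
  | succ n ih =>
    have h1 : X.nablaFalling j (n + 1) v =
        X.nablaFalling j n ((X.nablaLog j - (n : AddMonoid.End X.V)) v) := by
      simp [nablaFalling, List.range_succ]
    rw [h1]
    have := ih (i - 1) (X.nablaLog_sub_mem j n i hv)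
    rwa [show i - ((n + 1 : ℕ) : ℤ) = i - 1 - n by push_cast; ring]

theorem list_prod_mem (L : List (AddMonoid.End X.V × ℕ))
    (hL : ∀ D ∈ L, ∀ (i : ℤ) (v : X.V), v ∈ X.Fil i → D.1 v ∈ X.Fil (i - D.2)) (i : ℤ) {v : X.V}
    (hv : v ∈ X.Fil i) : (L.map Prod.fst).prod v ∈ X.Fil (i - (L.map Prod.snd).sum) := by
  induction L with
  | nil => simpa using hv
  | cons D L ih =>
    have h1 := hL D (by simp) _ _ (ih fun E hE => hL E (by simp [hE]))
    simp only [List.map_cons, List.prod_cons, List.sum_cons]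
    rw [show i - ((D.2 + (L.map Prod.snd).sum : ℕ) : ℤ) =
      i - ((L.map Prod.snd).sum : ℕ) - D.2 by push_cast; ring]
    exact h1

/-- Griffiths transversality for `∇(∂)^{I}`. -/
theorem nablaMulti_mem (I : Fin d → ℕ) (i : ℤ) {v : X.V} (hv : v ∈ X.Fil i) :
    X.nablaMulti I v ∈ X.Fil (i - (∑ j, I j : ℕ)) := by
  have := X.list_prod_mem (List.ofFn fun j => (X.nablaFalling j (I j), I j)) (by
    intro D hD i v hv
    obtain ⟨j, rfl⟩ := (List.mem_ofFn' _ _).1 hD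
    exact X.nablaFalling_mem j (I j) i hv) i hv
  simp only [List.map_ofFn, List.sum_ofFn] at this
  exact this

end Taylor

end FilDeRham

end DeRham
section Category

variable {p : ℕ} [Fact p.Prime] {k : Type u} [Field k]
  {d s : ℕ} {R : Type v} [CommRing R]
  [Algebra (WittVector p k) R] [Algebra (MvPolynomial (Fin d) (WittVector p k)) R]
  [IsScalarTower (WittVector p k) (MvPolynomial (Fin d) (WittVector p k)) R]
  [Algebra.Etale (MvPolynomial (Fin d) (WittVector p k)) R]
  {a b : ℤ}

/- Morphisms -/

/-- Horizontal `R̂`-linear maps that preserve the filtrations. -/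
@[ext]
structure FilHom (X Y : FilDeRham.{u, v, w} p k d s R a b) where
  toLin : X.V →ₗ[RHat p R] Y.V
  map_fil : ∀ (i : ℤ) (x : X.V), x ∈ X.Fil i → toLin x ∈ Y.Fil i
  map_nabla : ∀ (j : Fin d) (x : X.V), toLin (X.nabla j x) = Y.nabla j (toLin x)

namespace FilHom

variable {X Y Z : FilDeRham.{u, v, w} p k d s R a b}

/-- Strictness for the filtrations: `f (V) ∩ Fil^i = f (Fil^i)`. -/
def IsStrict (f : FilHom X Y) : Prop :=
  ∀ (i : ℤ) (x : X.V), f.toLin x ∈ Y.Fil i → ∃ x' ∈ X.Fil i, f.toLin x' = f.toLin x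

/-- The identity. -/
def id (X : FilDeRham.{u, v, w} p k d s R a b) : FilHom X X :=
  ⟨LinearMap.id, fun _ _ h => h, fun _ _ => rfl⟩

/-- The composition `g ∘ f`. -/
def comp (f : FilHom X Y) (g : FilHom Y Z) : FilHom X Z :=
  ⟨g.toLin ∘ₗ f.toLin, fun i x h => g.map_fil i _ (f.map_fil i x h), fun j x => by
    rw [LinearMap.comp_apply, f.map_nabla, g.map_nabla]; rfl⟩

/-- The map induced on `⨁ Fil^i V`. -/
def sumMap (f : FilHom X Y) : X.FilSum →ₗ[RHat p R] Y.FilSum :=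
  DirectSum.lmap fun i : Set.Icc a b => f.toLin.restrict (f.map_fil i)

theorem sumMap_lof (f : FilHom X Y) (i : Set.Icc a b) (x : X.V) (hx : x ∈ X.Fil i) :
    f.sumMap (DirectSum.lof (RHat p R) _ (fun i : Set.Icc a b => X.Fil i) i ⟨x, hx⟩) =
      DirectSum.lof (RHat p R) _ (fun i : Set.Icc a b => Y.Fil i) i
        ⟨f.toLin x, f.map_fil i x hx⟩ := by
  rw [sumMap, DirectSum.lmap_lof]; rfl

/-- The map `Ṽ → Ṽ'` induced by `f : V → V'`, with `[x]_i ↦ [f x]_i`. -/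
def tildeMap (f : FilHom X Y) : X.Tilde →ₗ[RHat p R] Y.Tilde :=
  Submodule.mapQ X.tildeRel Y.tildeRel f.sumMap (by
    refine Submodule.span_le.2 ?_
    rintro _ ⟨i, j, x, hi, hj, hij, rfl⟩
    change f.sumMap _ ∈ Y.tildeRel
    rw [map_sub, map_smul, sumMap_lof, sumMap_lof]
    exact Submodule.subset_span ⟨i, j, f.toLin x, f.map_fil i x hi, f.map_fil j x hj, hij, rfl⟩)

theorem tildeMap_br (f : FilHom X Y) (i : Set.Icc a b) (x : X.V) (hx : x ∈ X.Fil i) :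
    f.tildeMap (X.br i ⟨x, hx⟩) = Y.br i ⟨f.toLin x, f.map_fil i x hx⟩ :=
  congrArg Y.tildeRel.mkQ (f.sumMap_lof i x hx)

theorem tilde_hom_ext {N : Type w} [AddCommGroup N] [Module (RHat p R) N]
    {g h : X.Tilde →ₗ[RHat p R] N} (H : ∀ i x, g (X.br i x) = h (X.br i x)) : g = h := by
  refine Submodule.linearMap_qext _ (DirectSum.linearMap_ext _ fun i => ?_)
  ext x
  exact H i x

theorem tildeMap_id : (id X).tildeMap = LinearMap.id :=
  tilde_hom_ext fun i x => (id X).tildeMap_br i x x.2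

theorem tildeMap_comp (f : FilHom X Y) (g : FilHom Y Z) :
    (f.comp g).tildeMap = g.tildeMap ∘ₗ f.tildeMap :=
  tilde_hom_ext fun i x => by
    rw [LinearMap.comp_apply, f.tildeMap_br i x x.2, g.tildeMap_br]
    exact (f.comp g).tildeMap_br i x x.2

end FilHom

/- Logarithmic Fontaine–Faltings modules -/

variable [CharP k p] [PerfectRing k p]

/-- A logarithmic Fontaine–Faltings module `(V, ∇, Fil, φ)` with respect to `Φ`, with Hodge–Tate
weights in `[a, b]`. -/
structure LogFF (s : ℕ) (a b : ℤ) (Φ : FrobLift p k d R) where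
  X : FilDeRham.{u, v, w} p k d s R a b
  φ : FrobBC Φ X.Tilde ≃ₗ[RHat p R] X.V
  horizontal : ∀ (m : Fin d) (x : FrobBC Φ X.Tilde), φ (X.pullConn Φ m x) = X.nabla m (φ x)

variable {Φ Ψ Ξ : FrobLift p k d R}

/-- Morphisms of filtered de Rham modules that commute with the `φ`-structures. -/
@[ext]
structure LogFF.Hom (M N : LogFF.{u, v, w} s a b Φ) where
  hom : FilHom M.X N.X
  comm : ∀ x : FrobBC Φ M.X.Tilde, hom.toLin (M.φ x) = N.φ (FrobBC.map Φ hom.tildeMap x)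

instance : Category (LogFF.{u, v, w} s a b Φ) where
  Hom M N := LogFF.Hom M N
  id M := ⟨FilHom.id M.X, fun x => by rw [FilHom.tildeMap_id, FrobBC.map_id]; rfl⟩
  comp f g := ⟨f.hom.comp g.hom, fun x => by
    rw [FilHom.tildeMap_comp, FrobBC.map_comp, ← g.comm, ← f.comm]; rfl⟩

/-- The morphisms that are strict for the filtrations. -/
def LogFF.strict (s : ℕ) (a b : ℤ) (Φ : FrobLift p k d R) :
    MorphismProperty (LogFF.{u, v, w} s a b Φ) :=
  fun _ _ f => f.hom.IsStrict

/-- The category of logarithmic Fontaine–Faltings modules with respect to `Φ`: its morphisms are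
those of filtered de Rham modules that commute with `φ` and are strict for the filtrations
(and their composites, which are again strict). -/
abbrev MF (s : ℕ) (a b : ℤ) (Φ : FrobLift p k d R) : Type (max v (w + 1)) :=
  WideSubcategory (LogFF.strict.{u, v, w} s a b Φ).multiplicativeClosure

/- Gluing functors -/

/-- A family of `R̂`-linear isomorphisms `Ṽ ⊗_Φ R̂ ≃ Ṽ ⊗_Ψ R̂`, natural in the filtered logarithmic
de Rham module `V` and parallel for the connections `Φ_* ∇̃` and `Ψ_* ∇̃`. -/
@[ext]
structure ParallelIso (s : ℕ) (a b : ℤ) (Φ Ψ : FrobLift p k d R) where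
  app : ∀ X : FilDeRham.{u, v, w} p k d s R a b,
    FrobBC Φ X.Tilde ≃ₗ[RHat p R] FrobBC Ψ X.Tilde
  parallel : ∀ (X : FilDeRham.{u, v, w} p k d s R a b) (m : Fin d) (x : FrobBC Φ X.Tilde),
    app X (X.pullConn Φ m x) = X.pullConn Ψ m (app X x)
  natural : ∀ {X Y : FilDeRham.{u, v, w} p k d s R a b} (f : FilHom X Y) (x : FrobBC Φ X.Tilde),
    app Y (FrobBC.map Φ f.tildeMap x) = FrobBC.map Ψ f.tildeMap (app X x)

/-- `(V, ∇, Fil, φ) ↦ (V, ∇, Fil, φ ∘ α)`. -/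
def ParallelIso.glueObj (α : ParallelIso.{u, v, w} s a b Φ Ψ) (M : LogFF.{u, v, w} s a b Ψ) :
    LogFF.{u, v, w} s a b Φ where
  X := M.X
  φ := (α.app M.X).trans M.φ
  horizontal m x := by
    rw [LinearEquiv.trans_apply, LinearEquiv.trans_apply, α.parallel, M.horizontal]

/-- `glueObj` is functorial, with the same underlying maps. -/
def ParallelIso.glueHom (α : ParallelIso.{u, v, w} s a b Φ Ψ) {M N : LogFF.{u, v, w} s a b Ψ}
    (f : LogFF.Hom M N) : LogFF.Hom (α.glueObj M) (α.glueObj N) where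
  hom := f.hom
  comm x := (f.comm (α.app M.X x)).trans (congrArg N.φ (α.natural f.hom x).symm)

/-- The functor `(V, ∇, Fil, φ) ↦ (V, ∇, Fil, φ ∘ α)`, the identity on underlying maps. -/
def ParallelIso.glueFF (α : ParallelIso.{u, v, w} s a b Φ Ψ) :
    LogFF.{u, v, w} s a b Ψ ⥤ LogFF.{u, v, w} s a b Φ where
  obj M := α.glueObj M
  map f := α.glueHom f
  map_id _ := rfl
  map_comp _ _ := rfl

theorem ParallelIso.glueFF_closure (α : ParallelIso.{u, v, w} s a b Φ Ψ)
    {M N : LogFF.{u, v, w} s a b Ψ} (f : M ⟶ N)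
    (hf : (LogFF.strict s a b Ψ).multiplicativeClosure f) :
    (LogFF.strict s a b Φ).multiplicativeClosure (α.glueFF.map f) := by
  induction hf with
  | of f hf => exact .of _ hf
  | id M => rw [α.glueFF.map_id]; exact .id _
  | comp_of f g _ hg ih => rw [α.glueFF.map_comp]; exact .comp_of _ _ ih hg

/-- The functor `(V, ∇, Fil, φ) ↦ (V, ∇, Fil, φ ∘ α)` from the category of logarithmic
Fontaine–Faltings modules for `Ψ` to the one for `Φ`; it is the identity on underlying maps. -/
def ParallelIso.glue (α : ParallelIso.{u, v, w} s a b Φ Ψ) :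
    MF.{u, v, w} s a b Ψ ⥤ MF.{u, v, w} s a b Φ where
  obj M := ⟨α.glueFF.obj M.obj⟩
  map f := ⟨α.glueFF.map f.hom, α.glueFF_closure f.hom f.property⟩
  map_id M := by ext1; exact α.glueFF.map_id M.obj
  map_comp f g := by ext1; exact α.glueFF.map_comp f.hom g.hom

/-- `x` is the sum of the family `f` for the `p`-adic topology of the `R̂`-module `M`. -/
def HasPAdicSum {A : Type v} [CommRing A] (p : ℕ) {M : Type w} [AddCommGroup M] [Module A M]
    {ι : Type*} (f : ι → M) (x : M) : Prop :=
  ∀ n : ℕ, ∃ S₀ : Finset ι, ∀ S : Finset ι, S₀ ⊆ S →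
    x - ∑ i ∈ S, f i ∈ (Ideal.span {(p : A)}) ^ n • (⊤ : Submodule A M)

/-- The logarithmic Taylor formula: for `m ∈ Fil^i V`,
`α ([m]_i ⊗_Φ 1) = ∑_I [∇(∂)^{I} m]_{max (a, i - |I|)} ⊗_Ψ c_{i,I}` (a `p`-adically convergent sum
over multi-indices), where
`c_{i,I} = (Φ(T)/Ψ(T) - 1)^I / (I! p ^ min (i - a, |I|))` lies in `R̂`. -/
def ParallelIso.IsLogTaylor (α : ParallelIso.{u, v, w} s a b Φ Ψ) : Prop :=
  ∃ c : Set.Icc a b → (Fin d → ℕ) → RHat p R,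
    (∀ (i : Set.Icc a b) (I : Fin d → ℕ),
      ((∏ j, (I j).factorial : ℕ) : RHat p R) *
          (p : RHat p R) ^ min ((i : ℤ) - a).toNat (∑ j, I j) * c i I =
        ∏ j, ((Φ.w j * (Ψ.w j)⁻¹ : (RHat p R)ˣ) - 1 : RHat p R) ^ I j) ∧
    ∀ (X : FilDeRham.{u, v, w} p k d s R a b) (i : Set.Icc a b) (m : X.V) (hm : m ∈ X.Fil i),
      HasPAdicSum (A := RHat p R) p
        (fun I : Fin d → ℕ => FrobBC.tmul Ψ
          (X.br (FilDeRham.trunc i (∑ j, I j))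
            ⟨X.nablaMulti I m, X.mem_trunc i _ (X.nablaMulti_mem I i hm)⟩) (c i I))
        (α.app X (FrobBC.tmul Φ (X.br i ⟨m, hm⟩) 1))

end Category

end

end LogGluing

open LogGluing

/-! The comparison map is a Taylor series. Let `z_j` (`FrobLift.ratio`) be the increment
`(Φ(T_j)/Ψ(T_j) - 1)/p` in a logarithmic direction and `(Φ(T_j) - Ψ(T_j))/p` in a plain one, and let
`e_j` (`logStep`) be `1`, respectively `0`. The operators `∏ⱼ ∏_{l < I_j} (∇_j - l e_j)`, multiplied
by `p ^ (|I| - min (i - a, |I|)) / I!`, induce operators `E_I` on `Ṽ` (`hasseTilde`), and `α (x ⊗ 1)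
= ∑_I E_I x ⊗ z ^ I` (`transport`, `compare`). The coefficients are integral because `b - a ≤ p - 1`
(`padicValNat_factorial_add_min_le`), and they tend to zero because `p > 2`
(`two_mul_padicValNat_factorial_le`). Since `R̂` is noetherian, the modules in play are finite,
hence `p`-adically complete and separated; so the series have unique sums.

The rest is formal and uses three compatibilities between the `E_I` and the `z_j`.

Leibniz rule. The operators on `R̂` and on `Ṽ` satisfy `E_I (r x) = ∑_{J+K=I} E_J(r) E_K(x)`
(`hasseTilde_smul`), and `Φ(r) = ∑_I Ψ(E_I r) z ^ I` (`hasPAdicSum_hasse`). The second series is a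
ring endomorphism of `R̂` that agrees with `Φ` modulo `p` and on the coordinates; étaleness and
perfectness of `k` force it to be `Φ` (`ringHom_eq_of_dvd_sub`). Together they make `transport`
semilinear.

Group law. The increments compose by `z'' = z + z' + p e_j z z'`, the additive group or a rescaled
multiplicative one (`ratio_trans`), and the `E_I` multiply with the dual structure constants
(`hasseTilde_hasseTilde`). This is the cocycle identity `compare_comp_compare`; as the increments of
`Φ` against itself vanish, `α` is invertible.

Invariant differential. One has `dz_j = (1 + p e_j z_j) (Φ^* ω_j - Ψ^* ω_j) / p` (`logDer_ratio`),
while composing with the weight-one operator `E_j` amounts to applying `(1 + p e_j z_j) ∂/∂z_j` to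
the series (`exists_transport_deriv`). Hence `α` is parallel (`pullConn_transport`).

The identity `T ^ n ∂ ^ n = T∂ (T∂ - 1) ⋯ (T∂ - n + 1)` rewrites the series in the logarithmic form
(`nablaMulti_apply`). The functors change only `φ`, so the cocycle identity for `α` gives equalities
of functors, and the functor for the swapped pair is a strict inverse. -/

namespace LogGluing

noncomputable section

/- Generalised falling factorials -/

section Falling

variable {S : Type*} [Ring S] {S' : Type*} [Ring S'] {C : Type*} [CommRing C]

/-- The product `x (x - e) ⋯ (x - (n - 1) e)`. -/
def falling (x : S) (e n : ℕ) : S :=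
  ((List.range n).map fun l : ℕ => x - ((e * l : ℕ) : S)).prod

theorem falling_zero (x : S) (e : ℕ) : falling x e 0 = 1 := by simp [falling]

theorem falling_succ (x : S) (e n : ℕ) :
    falling x e (n + 1) = falling x e n * (x - ((e * n : ℕ) : S)) := by
  simp [falling, List.range_succ]

theorem falling_one (x : S) (e : ℕ) : falling x e 1 = x := by
  simp [falling_succ, falling_zero]

theorem map_falling (f : S →+* S') (x : S) (e n : ℕ) :
    f (falling x e n) = falling (f x) e n := by
  simp [falling, map_list_prod, Function.comp_def]

theorem dvd_falling_succ (x : C) (e n : ℕ) : x ∣ falling x e (n + 1) := by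
  induction n with
  | zero => rw [falling_one]
  | succ n ih => rw [falling_succ]; exact ih.mul_right _

theorem dvd_falling_succ_succ (x : C) (e n : ℕ) : x * (x - e) ∣ falling x e (n + 2) := by
  induction n with
  | zero => rw [falling_succ, falling_one, mul_one]
  | succ n ih => rw [falling_succ]; exact ih.mul_right _

/-- The Chu–Vandermonde identity. -/
theorem falling_add (x y : C) (e n : ℕ) :
    falling (x + y) e n = ∑ ab ∈ Finset.HasAntidiagonal.antidiagonal n,
      (n.choose ab.1 : C) * (falling x e ab.1 * falling y e ab.2) := by
  induction n with
  | zero => simp [falling_zero]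
  | succ n ih =>
    have h := Finset.sum_antidiagonal_choose_succ_mul
      (fun a b => falling x e a * falling y e b) n
    rw [h, falling_succ, ih, Finset.sum_mul, ← Finset.sum_add_distrib]
    refine Finset.sum_congr rfl fun ab hab => ?_
    obtain ⟨a, b⟩ := ab
    obtain rfl : a + b = n := by simpa using hab
    have h2 : (a + b).choose b = (a + b).choose a := by
      rw [Nat.choose_symm_add]
    simp only [falling_succ, h2]
    push_cast
    ring

theorem falling_mul_self (x : S) (e n : ℕ) :
    falling x e n * x = falling x e (n + 1) + ((e * n : ℕ) : S) * falling x e n := by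
  rw [falling_succ, mul_sub, Nat.cast_comm]
  abel

/-- The number of partial matchings of size `c` between an `n`-element and an `m`-element set. -/
def matchings (n m c : ℕ) : ℕ := c.factorial * n.choose c * m.choose c

/-- Induction on `m`: next to a factor of length `n + m - c`, the new factor splits as `x - e m = (x
- e (n + m - c)) + e (n - c)`. The first summand lengthens the falling factorial, the second
enlarges the matching by one pair, and Pascal's rule adds the two contributions. -/
theorem falling_mul_falling (x : C) (e n m : ℕ) :
    falling x e n * falling x e m = ∑ c ∈ Finset.range (m + 1),
      ((matchings n m c * e ^ c : ℕ) : C) * falling x e (n + m - c) := by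
  induction m with
  | zero => simp [matchings, falling_zero]
  | succ m ih =>
    rw [falling_succ, ← mul_assoc, ih, Finset.sum_mul]
    have hstep : ∀ c ∈ Finset.range (m + 1),
        ((matchings n m c * e ^ c : ℕ) : C) * falling x e (n + m - c) * (x - ((e * m : ℕ) : C)) =
        ((matchings n m c * e ^ c : ℕ) : C) * falling x e (n + (m + 1) - c) +
        ((matchings n m c * (n - c) * e ^ (c + 1) : ℕ) : C) *
          falling x e (n + (m + 1) - (c + 1)) := by
      intro c hc
      have hc : c ≤ m := Nat.lt_succ_iff.1 (Finset.mem_range.1 hc)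
      by_cases hcn : c ≤ n
      · obtain ⟨k, rfl⟩ := Nat.exists_eq_add_of_le hcn
        obtain ⟨l, rfl⟩ := Nat.exists_eq_add_of_le hc
        rw [show c + k + (c + l) - c = c + k + l by omega,
          show c + k + (c + l + 1) - c = c + k + l + 1 by omega,
          show c + k + (c + l + 1) - (c + 1) = c + k + l by omega,
          show c + k - c = k by omega, falling_succ]
        push_cast; ring
      -- For `c > n` the truncated difference `n - c` is meaningless, but its coefficient vanishes.
      · have : matchings n m c = 0 := by simp [matchings, Nat.choose_eq_zero_of_lt (not_le.1 hcn)]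
        simp [this]
    rw [Finset.sum_congr rfl hstep, Finset.sum_add_distrib]
    have h1 : ∑ c ∈ Finset.range (m + 1), ((matchings n m c * e ^ c : ℕ) : C) *
        falling x e (n + (m + 1) - c) = ∑ c ∈ Finset.range (m + 1 + 1),
        ((matchings n m c * e ^ c : ℕ) : C) * falling x e (n + (m + 1) - c) := by
      rw [Finset.sum_range_succ _ (m + 1)]
      simp [matchings]
    rw [h1, Finset.sum_range_succ', Finset.sum_range_succ' _ (m + 1), add_right_comm,
      ← Finset.sum_add_distrib]
    congr 1
    · refine Finset.sum_congr rfl fun c _ => ?_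
      rw [← add_mul]
      congr 1
      norm_cast
      rw [← add_mul]
      congr 1
      have h2 : (c + 1).factorial * n.choose (c + 1) = c.factorial * n.choose c * (n - c) := by
        rw [Nat.factorial_succ]
        linear_combination c.factorial * Nat.choose_succ_right_eq n c
      simp only [matchings]
      rw [h2, Nat.choose_succ_succ m c]
      ring
    · simp [matchings]

end Falling

/-! ### Falling factorials of commuting families, with multi-indices -/

section Multi

variable {d : ℕ} {S : Type*} [Ring S] {S' : Type*} [Ring S'] {C : Type*} [CommRing C]

/-- The ordered product of the falling factorials of the entries of `N`. -/
def multiFalling (N : Fin d → S) (e I : Fin d → ℕ) : S :=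
  (List.ofFn fun j => falling (N j) (e j) (I j)).prod

theorem map_multiFalling (f : S →+* S') (N : Fin d → S) (e I : Fin d → ℕ) :
    f (multiFalling N e I) = multiFalling (fun j => f (N j)) e I := by
  simp [multiFalling, map_list_prod, Function.comp_def, List.map_ofFn, map_falling]

theorem multiFalling_eq_prod (N : Fin d → C) (e I : Fin d → ℕ) :
    multiFalling N e I = ∏ j, falling (N j) (e j) (I j) := List.prod_ofFn

theorem multiFalling_zero (N : Fin d → S) (e : Fin d → ℕ) : multiFalling N e 0 = 1 := by
  simp [multiFalling, falling_zero]

open scoped IsMulCommutative in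
/-- A commuting family is the image of a family in a commutative ring. -/
theorem exists_commRing_of_commute {ι : Type*} {S : Type w} [Ring S] (N : ι → S)
    (h : ∀ i j, N i * N j = N j * N i) :
    ∃ (C : Type w) (_ : CommRing C) (f : C →+* S) (n : ι → C), ∀ i, f (n i) = N i := by
  let C := Algebra.adjoin ℤ (Set.range N)
  have hc : ∀ a ∈ Set.range N, ∀ b ∈ Set.range N, a * b = b * a := by
    rintro _ ⟨i, rfl⟩ _ ⟨j, rfl⟩; exact h i j
  have : IsMulCommutative C := Algebra.isMulCommutative_adjoin ℤ hc
  exact ⟨C, inferInstance, C.val.toRingHom,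
    fun i => ⟨N i, Algebra.subset_adjoin ⟨i, rfl⟩⟩, fun i => rfl⟩

/-- Identities for a commuting family are proved in the commutative ring given by
`exists_commRing_of_commute`, where the ordered product is an ordinary one and can be treated
coordinate by coordinate. -/
theorem multiFalling_commute (N : Fin d → S) (e : Fin d → ℕ)
    (h : ∀ i j, N i * N j = N j * N i) (I J : Fin d → ℕ) :
    multiFalling N e I * multiFalling N e J = multiFalling N e J * multiFalling N e I := by
  obtain ⟨C, _, f, n, hn⟩ := exists_commRing_of_commute N h
  obtain rfl : (fun i => f (n i)) = N := funext hn
  rw [← map_multiFalling, ← map_multiFalling, ← map_mul, mul_comm, map_mul]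

theorem multiFalling_single (N : Fin d → S) (e : Fin d → ℕ)
    (h : ∀ i j, N i * N j = N j * N i) (j : Fin d) :
    multiFalling N e (Pi.single j 1) = N j := by
  obtain ⟨C, _, f, n, hn⟩ := exists_commRing_of_commute N h
  obtain rfl : (fun i => f (n i)) = N := funext hn
  rw [← map_multiFalling, multiFalling_eq_prod]
  congr 1
  rw [Finset.prod_eq_single j]
  · simp [falling_one]
  · intro b _ hb; simp [hb, falling_zero]
  · simp

theorem multiFalling_mul_self (N : Fin d → S) (e : Fin d → ℕ)
    (h : ∀ i j, N i * N j = N j * N i) (I : Fin d → ℕ) (j : Fin d) :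
    multiFalling N e I * N j = multiFalling N e (I + Pi.single j 1) +
      ((e j * I j : ℕ) : S) * multiFalling N e I := by
  obtain ⟨C, _, f, n, hn⟩ := exists_commRing_of_commute N h
  obtain rfl : (fun i => f (n i)) = N := funext hn
  rw [← map_multiFalling, ← map_multiFalling, ← map_mul, ← map_natCast f, ← map_mul, ← map_add]
  congr 1
  simp only [multiFalling_eq_prod]
  have h1 : ∀ F : Fin d → C, ∏ i, F i = F j * ∏ i ∈ Finset.univ.erase j, F i := fun F =>
    (Finset.mul_prod_erase _ _ (Finset.mem_univ j)).symm
  refine (congrArg (· * n j) (h1 _)).trans (Eq.trans ?_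
    (congrArg₂ (· + ·) (h1 _).symm (congrArg (_ * ·) (h1 _).symm)))
  have h2 : ∏ i ∈ Finset.univ.erase j, falling (n i) (e i) (I i + Pi.single (M := fun _ => ℕ) j 1 i) =
      ∏ i ∈ Finset.univ.erase j, falling (n i) (e i) (I i) :=
    Finset.prod_congr rfl fun i hi => by simp [Finset.ne_of_mem_erase hi]
  have h3 := falling_mul_self (n j) (e j) (I j)
  simp only [h2, Pi.add_apply, Pi.single_eq_same]
  linear_combination (∏ i ∈ Finset.univ.erase j, falling (n i) (e i) (I i)) * h3

theorem multiFalling_mul (N : Fin d → S) (e : Fin d → ℕ)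
    (h : ∀ i j, N i * N j = N j * N i) (I J : Fin d → ℕ) :
    multiFalling N e I * multiFalling N e J =
      ∑ c ∈ Fintype.piFinset fun j => Finset.range (J j + 1),
        ((∏ j, (matchings (I j) (J j) (c j) * e j ^ c j) : ℕ) : S) *
          multiFalling N e (I + J - c) := by
  obtain ⟨C, _, f, n, hn⟩ := exists_commRing_of_commute N h
  obtain rfl : (fun i => f (n i)) = N := funext hn
  simp only [← map_multiFalling, ← map_natCast f, ← map_mul, ← map_sum]
  congr 1
  simp only [multiFalling_eq_prod, ← Finset.prod_mul_distrib, falling_mul_falling,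
    Finset.prod_univ_sum]
  refine Finset.sum_congr rfl fun c _ => ?_
  rw [Finset.prod_mul_distrib]
  push_cast
  rfl

/-- `N` annihilates an element killed by one of the factors. -/
theorem multiFalling_apply_eq_zero {V : Type*} [AddCommGroup V] (N : Fin d → AddMonoid.End V)
    (e : Fin d → ℕ) (h : ∀ i j, N i * N j = N j * N i) (I : Fin d → ℕ) (v : V) (j : Fin d)
    (hv : (I j ≠ 0 ∧ N j v = 0) ∨ (2 ≤ I j ∧ N j (N j v) = e j • N j v)) :
    multiFalling N e I v = 0 := by
  obtain ⟨C, _, f, n, hn⟩ := exists_commRing_of_commute N h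
  obtain rfl : (fun i => f (n i)) = N := funext hn
  have key : ∀ x : C, f x v = 0 → x ∣ falling (n j) (e j) (I j) →
      multiFalling (fun i => f (n i)) e I v = 0 := by
    intro x hx hd
    rw [← map_multiFalling, multiFalling_eq_prod]
    obtain ⟨y, hy⟩ := hd.trans (Finset.dvd_prod_of_mem
      (fun i => falling (n i) (e i) (I i)) (Finset.mem_univ j))
    rw [hy, mul_comm, map_mul]
    change f y (f x v) = 0
    rw [hx, map_zero]
  rcases hv with ⟨hI, hv⟩ | ⟨hI, hv⟩
  · obtain ⟨k, hk⟩ := Nat.exists_eq_succ_of_ne_zero hI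
    exact key (n j) hv (by rw [hk]; exact dvd_falling_succ _ _ _)
  -- Here `N j v` is an eigenvector with value `e j`, killed by `x - e`; and `x (x - e)` divides
  -- every falling factorial of length at least two.
  · obtain ⟨k, hk⟩ := Nat.exists_eq_add_of_le' hI
    refine key (n j * (n j - e j)) ?_ (by rw [hk]; exact dvd_falling_succ_succ _ _ _)
    rw [mul_comm, sub_mul, map_sub, map_mul, map_mul, map_natCast]
    change f (n j) (f (n j) v) - e j • f (n j) v = 0
    rw [hv, sub_self]

/-- The pairs of multi-indices with sum `I`. -/
def multiAntidiagonal (I : Fin d → ℕ) : Finset ((Fin d → ℕ) × (Fin d → ℕ)) :=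
  (Finset.Iic I ×ˢ Finset.Iic I).filter fun JK => JK.1 + JK.2 = I

theorem mem_multiAntidiagonal {I : Fin d → ℕ} {JK : (Fin d → ℕ) × (Fin d → ℕ)} :
    JK ∈ multiAntidiagonal I ↔ JK.1 + JK.2 = I := by
  simp only [multiAntidiagonal, Finset.mem_filter, Finset.mem_product, Finset.mem_Iic,
    and_iff_right_iff_imp]
  rintro rfl
  exact ⟨le_self_add, le_add_self⟩

theorem prod_sum_antidiagonal (I : Fin d → ℕ) (F : Fin d → ℕ → ℕ → C) :
    ∏ j, ∑ ab ∈ Finset.HasAntidiagonal.antidiagonal (I j), F j ab.1 ab.2 =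
      ∑ JK ∈ multiAntidiagonal I, ∏ j, F j (JK.1 j) (JK.2 j) := by
  rw [Finset.prod_univ_sum]
  refine Finset.sum_nbij' (fun f => (fun j => (f j).1, fun j => (f j).2))
    (fun JK j => (JK.1 j, JK.2 j)) ?_ ?_ ?_ ?_ ?_
  · intro f hf
    rw [mem_multiAntidiagonal]
    funext j
    exact Finset.HasAntidiagonal.mem_antidiagonal.1 (Fintype.mem_piFinset.1 hf j)
  · intro JK h
    rw [Fintype.mem_piFinset]
    intro j
    exact Finset.HasAntidiagonal.mem_antidiagonal.2 (congrFun (mem_multiAntidiagonal.1 h) j)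
  · intros; rfl
  · intros; rfl
  · intros; rfl

/-- Operators that intertwine the entries of `N` and `N'` intertwine their falling factorials. -/
theorem map_multiFalling_apply {G H : Type*} [AddCommGroup G] [AddCommGroup H] (f : G →+ H)
    (N : Fin d → AddMonoid.End G) (N' : Fin d → AddMonoid.End H)
    (h : ∀ j x, f (N j x) = N' j (f x)) (e I : Fin d → ℕ) (x : G) :
    f (multiFalling N e I x) = multiFalling N' e I (f x) := by
  -- Pairs of operators intertwined by `f` form a subring of the product ring, so every
  -- noncommutative integer polynomial in the pairs `(N j, N' j)` stays intertwined.
  let S : Subring (AddMonoid.End G × AddMonoid.End H) :=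
    { carrier := {φ | ∀ x, f (φ.1 x) = φ.2 (f x)}
      mul_mem' := fun {φ ψ} hφ hψ x => (hφ (ψ.1 x)).trans (congrArg φ.2 (hψ x))
      one_mem' := fun x => rfl
      add_mem' := fun {φ ψ} hφ hψ x =>
        (map_add f _ _).trans (congrArg₂ (· + ·) (hφ x) (hψ x))
      zero_mem' := fun x => map_zero f
      neg_mem' := fun {φ} hφ x => (map_neg f _).trans (congrArg Neg.neg (hφ x)) }
  let P : Fin d → S := fun j => ⟨(N j, N' j), h j⟩
  have h1 := map_multiFalling ((RingHom.fst _ _).comp S.subtype) P e I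
  have h2 := map_multiFalling ((RingHom.snd _ _).comp S.subtype) P e I
  have h3 := (multiFalling P e I).2 x
  change f (((RingHom.fst _ _).comp S.subtype) (multiFalling P e I) x) =
    ((RingHom.snd _ _).comp S.subtype) (multiFalling P e I) (f x) at h3
  rwa [h1, h2] at h3

/-- The Leibniz rule for products of falling factorials of a commuting family of operators. -/
theorem multiFalling_smul {A V : Type*} [CommRing A] [AddCommGroup V] [Module A V]
    (D : Fin d → AddMonoid.End A) (N : Fin d → AddMonoid.End V)
    (hD : ∀ i j, D i * D j = D j * D i) (hN : ∀ i j, N i * N j = N j * N i)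
    (hDN : ∀ j (r : A) (x : V), N j (r • x) = D j r • x + r • N j x)
    (e I : Fin d → ℕ) (r : A) (x : V) :
    multiFalling N e I (r • x) = ∑ JK ∈ multiAntidiagonal I,
      (∏ j, (I j).choose (JK.1 j)) •
        (multiFalling D e JK.1 r • multiFalling N e JK.2 x) := by
  -- On `A ⊗ V` the operators `D i ⊗ 1` and `1 ⊗ N j` all commute, and scalar multiplication `β`
  -- intertwines `D j ⊗ 1 + 1 ⊗ N j` with `N j`. The Leibniz rule is therefore the Chu–Vandermonde
  -- identity for these sums, pushed forward along `β`.
  let fA : AddMonoid.End A →+* Module.End ℤ (A ⊗[ℤ] V) :=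
    (Module.End.rTensorAlgHom (R := ℤ) (M := A) (N := V)).toRingHom.comp
      (addMonoidEndRingEquivInt A).toRingHom
  let fV : AddMonoid.End V →+* Module.End ℤ (A ⊗[ℤ] V) :=
    (Module.End.lTensorAlgHom (R := ℤ) (M := V) (N := A)).toRingHom.comp
      (addMonoidEndRingEquivInt V).toRingHom
  have hfA : ∀ φ a v, fA φ (a ⊗ₜ v) = φ a ⊗ₜ v := fun φ a v => rfl
  have hfV : ∀ φ a v, fV φ (a ⊗ₜ v) = a ⊗ₜ φ v := fun φ a v => rfl
  let β : A ⊗[ℤ] V →ₗ[ℤ] V := TensorProduct.lift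
    (LinearMap.mk₂ ℤ (fun (r : A) (x : V) => r • x) (fun _ _ _ => add_smul _ _ _)
      (fun _ _ _ => smul_assoc _ _ _) (fun _ _ _ => smul_add _ _ _)
      (fun _ _ _ => smul_comm _ _ _))
  have hβ : ∀ a v, β (a ⊗ₜ v) = a • v := fun a v => rfl
  obtain ⟨C, _, f, n, hn⟩ := exists_commRing_of_commute
    (Sum.elim (fun j => fA (D j)) (fun j => fV (N j))) (by
      rintro (i | i) (j | j)
      · change fA _ * fA _ = fA _ * fA _
        rw [← map_mul, hD, map_mul]
      · refine TensorProduct.ext' fun a v => ?_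
        rfl
      · refine TensorProduct.ext' fun a v => ?_
        rfl
      · change fV _ * fV _ = fV _ * fV _
        rw [← map_mul, hN, map_mul])
  have h1 : ∀ t, β (f (multiFalling (fun j => n (.inl j) + n (.inr j)) e I) t) =
      multiFalling N e I (β t) := by
    intro t
    rw [map_multiFalling]
    have := map_multiFalling_apply β.toAddMonoidHom
      (fun j => (addMonoidEndRingEquivInt _).symm
        (f (n (.inl j) + n (.inr j)))) N ?_ e I t
    · exact (congrArg (fun φ => β (φ t)) (map_multiFalling
        (addMonoidEndRingEquivInt (A ⊗[ℤ] V)).symm.toRingHom _ e I)).trans this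
    · intro j t
      change β (f (n (.inl j) + n (.inr j)) t) = N j (β t)
      rw [map_add, hn, hn]
      induction t with
      | zero => simp
      | add x y hx hy => rw [map_add, map_add, map_add, map_add, hx, hy]
      | tmul a v =>
        change β (fA (D j) (a ⊗ₜ v) + fV (N j) (a ⊗ₜ v)) = N j (a • v)
        rw [map_add, hfA, hfV, hβ, hβ, hDN]
  rw [← hβ, ← h1, multiFalling_eq_prod]
  simp only [falling_add]
  rw [prod_sum_antidiagonal I (fun j a b => ((I j).choose a : C) *
    (falling (n (.inl j)) (e j) a * falling (n (.inr j)) (e j) b)), map_sum, LinearMap.sum_apply,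
    map_sum]
  refine Finset.sum_congr rfl fun JK _ => ?_
  rw [Finset.prod_mul_distrib, Finset.prod_mul_distrib, ← Nat.cast_prod, ← nsmul_eq_mul,
    map_nsmul, ← multiFalling_eq_prod (fun j => n (.inl j)),
    ← multiFalling_eq_prod (fun j => n (.inr j)), map_mul, map_multiFalling, map_multiFalling]
  simp only [hn, Sum.elim_inl, Sum.elim_inr]
  rw [← map_multiFalling fA, ← map_multiFalling fV, LinearMap.smul_apply, map_nsmul]
  congr 1

end Multi

/- `p`-adically convergent sums -/

section PAdicSum

variable {A : Type v} [CommRing A] {p : ℕ} {M : Type w} [AddCommGroup M] [Module A M]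
  {N : Type*} [AddCommGroup N] [Module A N] {ι κ : Type*}

theorem mem_span_pow_smul_top {n : ℕ} {x : M} :
    x ∈ (Ideal.span {(p : A)}) ^ n • (⊤ : Submodule A M) ↔ ∃ y, x = (p ^ n : ℕ) • y := by
  rw [Ideal.span_singleton_pow, Submodule.ideal_span_singleton_smul]
  constructor
  · rintro ⟨y, -, rfl⟩
    exact ⟨y, by rw [← Nat.cast_smul_eq_nsmul A]; push_cast; rfl⟩
  · rintro ⟨y, rfl⟩
    exact ⟨y, trivial, by rw [← Nat.cast_smul_eq_nsmul A]; push_cast; rfl⟩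

/-- Additivity suffices, since multiplication by `p ^ n` is an integer multiple. Connections and
divided operators are additive but not linear. -/
theorem map_mem_span_pow_smul_top (f : M →+ N) {n : ℕ} {x : M}
    (hx : x ∈ (Ideal.span {(p : A)}) ^ n • (⊤ : Submodule A M)) :
    f x ∈ (Ideal.span {(p : A)}) ^ n • (⊤ : Submodule A N) := by
  obtain ⟨y, rfl⟩ := mem_span_pow_smul_top.1 hx
  exact mem_span_pow_smul_top.2 ⟨f y, map_nsmul f _ _⟩

theorem mul_smul_mem_span_pow_smul_top {n : ℕ} (c : A) (x : M) :
    ((p : A) ^ n * c) • x ∈ (Ideal.span {(p : A)}) ^ n • (⊤ : Submodule A M) :=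
  mem_span_pow_smul_top.2 ⟨c • x, by rw [mul_smul, ← Nat.cast_smul_eq_nsmul A]; push_cast; rfl⟩

/-- A family that tends to zero `p`-adically. -/
def IsPAdicNull (A : Type v) [CommRing A] (p : ℕ) {M : Type w} [AddCommGroup M] [Module A M]
    (f : ι → M) : Prop :=
  ∀ n : ℕ, ∃ S₀ : Finset ι, ∀ i ∉ S₀, f i ∈ (Ideal.span {(p : A)}) ^ n • (⊤ : Submodule A M)

theorem IsPAdicNull.smul_prod {f : ι → A} {g : κ → M} (hf : IsPAdicNull A p f)
    (hg : IsPAdicNull A p g) : IsPAdicNull A p fun x : ι × κ => f x.1 • g x.2 := fun n => by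
  obtain ⟨S, hS⟩ := hf n
  obtain ⟨T, hT⟩ := hg n
  refine ⟨S ×ˢ T, fun x hx => ?_⟩
  by_cases h : x.1 ∈ S
  · exact Submodule.smul_mem _ _ (hT _ fun h' => hx (Finset.mem_product.2 ⟨h, h'⟩))
  · exact map_mem_span_pow_smul_top (AddMonoidHom.mk' (fun r : A => r • g x.2)
      fun _ _ => add_smul _ _ _) (hS _ h)

theorem HasPAdicSum.unique [IsHausdorff (Ideal.span {(p : A)}) M] {f : ι → M} {x y : M}
    (hx : HasPAdicSum (A := A) p f x) (hy : HasPAdicSum (A := A) p f y) : x = y := by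
  rw [← sub_eq_zero]
  refine IsHausdorff.haus (I := Ideal.span {(p : A)}) inferInstance _ fun n => ?_
  rw [SModEq.zero]
  obtain ⟨S, hS⟩ := hx n
  obtain ⟨T, hT⟩ := hy n
  classical
  have := Submodule.sub_mem _ (hS (S ∪ T) Finset.subset_union_left)
    (hT (S ∪ T) Finset.subset_union_right)
  simpa using this

/-- The finite sums over the increasing sets `T n` form a Cauchy sequence: every index outside `T n`
contributes a multiple of `p ^ n`. -/
theorem IsPAdicNull.exists_hasPAdicSum [IsPrecomplete (Ideal.span {(p : A)}) M] {f : ι → M}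
    (hf : IsPAdicNull A p f) : ∃ x, HasPAdicSum (A := A) p f x := by
  classical
  choose S hS using hf
  let T : ℕ → Finset ι := fun n => (Finset.range (n + 1)).biUnion S
  have hT : ∀ m n, m ≤ n → T m ⊆ T n := fun m n h =>
    Finset.biUnion_subset_biUnion_of_subset_left _ (Finset.range_subset_range.2 (by omega))
  have hdiff : ∀ n (U : Finset ι), T n ⊆ U → ∑ i ∈ U, f i - ∑ i ∈ T n, f i ∈
      (Ideal.span {(p : A)}) ^ n • (⊤ : Submodule A M) := fun n U hU => by
    rw [← Finset.sum_sdiff hU, add_sub_cancel_right]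
    refine Submodule.sum_mem _ fun i hi => hS n i fun h => (Finset.mem_sdiff.1 hi).2 ?_
    exact Finset.mem_biUnion.2 ⟨n, by simp, h⟩
  obtain ⟨L, hL⟩ := IsPrecomplete.prec (I := Ideal.span {(p : A)}) inferInstance
    (f := fun n => ∑ i ∈ T n, f i) (fun {m n} hmn => by
      rw [SModEq.sub_mem, ← neg_mem_iff, neg_sub]
      exact hdiff m _ (hT m n hmn))
  refine ⟨L, fun n => ⟨T n, fun U hU => ?_⟩⟩
  have h1 := SModEq.sub_mem.1 (hL n)
  have h2 := hdiff n U hU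
  have := neg_mem (add_mem h1 h2)
  convert this using 1
  abel

theorem HasPAdicSum.map {f : ι → M} {x : M} (hx : HasPAdicSum (A := A) p f x) (g : M →+ N) :
    HasPAdicSum (A := A) p (fun i => g (f i)) (g x) := fun n => by
  obtain ⟨S, hS⟩ := hx n
  refine ⟨S, fun T hT => ?_⟩
  rw [← map_sum, ← map_sub]
  exact map_mem_span_pow_smul_top g (hS T hT)

theorem HasPAdicSum.add {f g : ι → M} {x y : M} (hx : HasPAdicSum (A := A) p f x)
    (hy : HasPAdicSum (A := A) p g y) :
    HasPAdicSum (A := A) p (fun i => f i + g i) (x + y) := fun n => by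
  classical
  obtain ⟨S, hS⟩ := hx n
  obtain ⟨T, hT⟩ := hy n
  refine ⟨S ∪ T, fun U hU => ?_⟩
  rw [Finset.sum_add_distrib, add_sub_add_comm]
  exact add_mem (hS U (Finset.union_subset_left hU)) (hT U (Finset.union_subset_right hU))

theorem HasPAdicSum.zero : HasPAdicSum (A := A) p (fun _ : ι => (0 : M)) 0 := fun n =>
  ⟨∅, fun S _ => by simp⟩

theorem HasPAdicSum.finset_sum {f : κ → ι → M} {x : κ → M} (S : Finset κ)
    (h : ∀ k ∈ S, HasPAdicSum (A := A) p (f k) (x k)) :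
    HasPAdicSum (A := A) p (fun i => ∑ k ∈ S, f k i) (∑ k ∈ S, x k) := by
  classical
  induction S using Finset.induction_on with
  | empty => simpa using HasPAdicSum.zero
  | insert k S hk ih =>
    simp only [Finset.sum_insert hk]
    exact (h k (Finset.mem_insert_self _ _)).add
      (ih fun l hl => h l (Finset.mem_insert_of_mem hl))

theorem HasPAdicSum.of_finite {f : ι → M} (S : Finset ι) (h : ∀ i ∉ S, f i = 0) :
    HasPAdicSum (A := A) p f (∑ i ∈ S, f i) := fun n =>
  ⟨S, fun T hT => by
    rw [Finset.sum_subset hT fun i _ hi => h i hi, sub_self]; exact zero_mem _⟩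

/-- Summation over the fibres of a map. -/
theorem HasPAdicSum.fiberwise {f : ι → M} {x : M} (hx : HasPAdicSum (A := A) p f x)
    (π : ι → κ) (g : κ → M)
    (hg : ∀ (k : κ) (n : ℕ) (S : Finset ι), (∀ i ∈ S, π i = k) → ∃ T : Finset ι, S ⊆ T ∧
      (∀ i ∈ T, π i = k) ∧
      g k - ∑ i ∈ T, f i ∈ (Ideal.span {(p : A)}) ^ n • (⊤ : Submodule A M)) :
    HasPAdicSum (A := A) p g x := fun n => by
  classical
  obtain ⟨S, hS⟩ := hx n
  refine ⟨S.image π, fun K hK => ?_⟩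
  -- In each fibre over `K`, the part of `S` in that fibre is enlarged until its sum approximates `g
  -- k`. The fibres are disjoint and the union contains `S`, so the total is controlled by `hS`.
  choose T hT1 hT2 hT3 using fun k => hg k n (S.filter fun i => π i = k)
    fun i hi => (Finset.mem_filter.1 hi).2
  have hU : S ⊆ K.biUnion T := fun i hi =>
    Finset.mem_biUnion.2 ⟨π i, hK (Finset.mem_image_of_mem π hi),
      hT1 _ (Finset.mem_filter.2 ⟨hi, rfl⟩)⟩
  have h1 := hS _ hU
  rw [Finset.sum_biUnion] at h1
  · have h2 := sub_mem h1 (Submodule.sum_mem _ fun k (_ : k ∈ K) => hT3 k)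
    rw [Finset.sum_sub_distrib] at h2
    convert h2 using 1
    abel
  · intro k _ l _ hkl
    refine Finset.disjoint_left.2 fun i hi hi' => hkl ?_
    rw [← hT2 k i hi, ← hT2 l i hi']

theorem HasPAdicSum.fiberwise_finite {f : ι → M} {x : M} (hx : HasPAdicSum (A := A) p f x)
    (π : ι → κ) (S : κ → Finset ι) (hS : ∀ k i, i ∈ S k ↔ π i = k) :
    HasPAdicSum (A := A) p (fun k => ∑ i ∈ S k, f i) x :=
  hx.fiberwise π _ fun k _ _ hT => ⟨S k, fun i hi => (hS k i).2 (hT i hi),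
    fun i hi => (hS k i).1 hi, by rw [sub_self]; exact zero_mem _⟩

theorem HasPAdicSum.prod_fiberwise {f : ι × κ → M} {x : M} (hx : HasPAdicSum (A := A) p f x)
    {g : ι → M} (hg : ∀ i, HasPAdicSum (A := A) p (fun k => f (i, k)) (g i)) :
    HasPAdicSum (A := A) p g x := by
  classical
  refine hx.fiberwise Prod.fst _ fun i n S hS => ?_
  obtain ⟨T, hT⟩ := hg i n
  refine ⟨({i} : Finset ι) ×ˢ (T ∪ S.image Prod.snd), fun y hy => ?_, fun y hy => ?_, ?_⟩
  · exact Finset.mem_product.2 ⟨Finset.mem_singleton.2 (hS y hy),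
      Finset.mem_union_right _ (Finset.mem_image_of_mem _ hy)⟩
  · exact Finset.mem_singleton.1 (Finset.mem_product.1 hy).1
  · rw [Finset.sum_product, Finset.sum_singleton]
    exact hT _ Finset.subset_union_left

theorem HasPAdicSum.comp_injective {f : ι → M} {x : M} (hx : HasPAdicSum (A := A) p f x)
    (e : κ → ι) (he : Function.Injective e) (h : ∀ i ∉ Set.range e, f i = 0) :
    HasPAdicSum (A := A) p (fun k => f (e k)) x := fun n => by
  classical
  obtain ⟨S, hS⟩ := hx n
  refine ⟨S.preimage e he.injOn, fun T hT => ?_⟩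
  have h1 := hS (S ∪ T.image e) Finset.subset_union_left
  have h2 : ∑ i ∈ S ∪ T.image e, f i = ∑ k ∈ T, f (e k) := by
    rw [← Finset.sum_image (f := f) (g := e) (fun a _ b _ h => he h)]
    symm
    refine Finset.sum_subset Finset.subset_union_right fun i hi hi' => h i ?_
    rintro ⟨k, rfl⟩
    refine hi' (Finset.mem_image_of_mem e ?_)
    rcases Finset.mem_union.1 hi with h | h
    · exact hT (Finset.mem_preimage.2 h)
    · exact absurd h hi'
  rwa [h2] at h1

/-- The Cauchy product. Nullity of both families makes the double family summable, and summing it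
first over the second index identifies its value. -/
theorem HasPAdicSum.smul_prod [IsHausdorff (Ideal.span {(p : A)}) M]
    [IsPrecomplete (Ideal.span {(p : A)}) M] {f : ι → A} {g : κ → M} {r : A} {x : M}
    (hf : HasPAdicSum (A := A) p f r) (hg : HasPAdicSum (A := A) p g x)
    (hf0 : IsPAdicNull A p f) (hg0 : IsPAdicNull A p g) :
    HasPAdicSum (A := A) p (fun y : ι × κ => f y.1 • g y.2) (r • x) := by
  obtain ⟨y, hy⟩ := (hf0.smul_prod hg0).exists_hasPAdicSum
  have h1 : HasPAdicSum (A := A) p (fun i => f i • x) y :=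
    hy.prod_fiberwise fun i => hg.map (DistribSMul.toAddMonoidHom M (f i))
  have h2 := hf.map (AddMonoidHom.mk' (fun r : A => r • x) fun _ _ => add_smul _ _ _)
  have h3 : y = r • x := h1.unique h2
  rwa [← h3]

end PAdicSum

/- Completeness and noetherianity -/

section Complete

/-- Completeness depends only on the filtration and not on the ring that defines it. This passes
from `R̂` as an `R`-module to `R̂` as a module over itself. -/
theorem isAdicComplete_of_forall_mem_iff {A B M : Type*} [CommRing A] [CommRing B]
    [AddCommGroup M] [Module A M] [Module B M] (I : Ideal A) (J : Ideal B)
    (h : ∀ n (x : M), x ∈ I ^ n • (⊤ : Submodule A M) ↔ x ∈ J ^ n • (⊤ : Submodule B M))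
    [IsAdicComplete I M] : IsAdicComplete J M where
  haus' x hx := IsHausdorff.haus (I := I) inferInstance x fun n => by
    have := hx n
    rw [SModEq.zero] at this ⊢
    exact (h n x).2 this
  prec' f hf := by
    obtain ⟨L, hL⟩ := IsPrecomplete.prec (I := I) inferInstance (f := f) fun {m n} hmn => by
      have := hf hmn
      rw [SModEq.sub_mem] at this ⊢
      exact (h _ _).2 this
    refine ⟨L, fun n => ?_⟩
    have := hL n
    rw [SModEq.sub_mem] at this ⊢
    exact (h _ _).1 this

instance (p : ℕ) (R : Type v) [CommRing R] :
    IsAdicComplete (Ideal.span {(p : RHat p R)}) (RHat p R) :=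
  have : IsAdicComplete (Ideal.span {(p : R)}) (RHat p R) :=
    AdicCompletion.isAdicComplete ⟨{(p : R)}, by simp⟩
  isAdicComplete_of_forall_mem_iff (Ideal.span {(p : R)}) _ fun n x => by
    rw [mem_span_pow_smul_top, mem_span_pow_smul_top]

variable {A : Type v} [CommRing A]

/-- The successive differences of a Cauchy sequence in `N` lift to `I ^ n M`; the partial sums of
these lifts form a Cauchy sequence in `M` over the given one. -/
theorem isPrecomplete_of_surjective {I : Ideal A} {M N : Type*} [AddCommGroup M] [Module A M]
    [AddCommGroup N] [Module A N] (f : M →ₗ[A] N) (hf : Function.Surjective f)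
    [IsPrecomplete I M] : IsPrecomplete I N where
  prec' x hx := by
    have h1 : ∀ n, ∃ y ∈ I ^ n • (⊤ : Submodule A M), f y = x (n + 1) - x n := fun n => by
      have h2 : x (n + 1) - x n ∈ I ^ n • (⊤ : Submodule A N) := by
        have := hx (Nat.le_succ n)
        rw [SModEq.sub_mem, ← neg_mem_iff, neg_sub] at this
        exact this
      rwa [← LinearMap.range_eq_top.2 hf, LinearMap.range_eq_map, ← Submodule.map_smul'',
        Submodule.mem_map] at h2
    choose y hy hfy using h1
    obtain ⟨y0, hy0⟩ := hf (x 0)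
    have hz : ∀ n, f (y0 + ∑ k ∈ Finset.range n, y k) = x n := fun n => by
      rw [map_add, map_sum, hy0, Finset.sum_congr rfl fun k _ => hfy k, Finset.sum_range_sub]
      abel
    obtain ⟨L, hL⟩ := IsPrecomplete.prec (I := I) inferInstance
      (f := fun n => y0 + ∑ k ∈ Finset.range n, y k) fun {m n} hmn => by
        rw [SModEq.sub_mem, ← neg_mem_iff, neg_sub, add_sub_add_left_eq_sub,
          ← Finset.sum_sdiff (Finset.range_subset_range.2 hmn), add_sub_cancel_right]
        refine Submodule.sum_mem _ fun k hk => ?_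
        have hk : m ≤ k := by simpa using (Finset.mem_sdiff.1 hk).2
        exact Submodule.smul_mono_left (Ideal.pow_le_pow_right hk) (hy k)
    refine ⟨f L, fun n => ?_⟩
    rw [← hz n, SModEq.sub_mem, ← map_sub]
    have h3 := SModEq.sub_mem.1 (hL n)
    have h4 := Submodule.mem_map_of_mem (f := f) h3
    rw [Submodule.map_smul''] at h4
    exact Submodule.smul_mono le_rfl le_top h4

theorem mem_span_singleton_pow_smul_top {M : Type*} [AddCommGroup M] [Module A M] {t : A} {n : ℕ}
    {x : M} : x ∈ (Ideal.span {t}) ^ n • (⊤ : Submodule A M) ↔ ∃ y, x = t ^ n • y := by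
  rw [Ideal.span_singleton_pow, Submodule.ideal_span_singleton_smul]
  exact ⟨fun ⟨y, _, hy⟩ => ⟨y, hy.symm⟩, fun ⟨y, hy⟩ => ⟨y, trivial, hy.symm⟩⟩

/-- For a principal ideal, membership in `I ^ n • ⊤` means being a multiple of `t ^ n`, which can be
tested componentwise. -/
theorem isPrecomplete_pi {t : A} {ι : Type*} [IsPrecomplete (Ideal.span {t}) A] :
    IsPrecomplete (Ideal.span {t}) (ι → A) where
  prec' f hf := by
    have h1 : ∀ i, ∃ L : A, ∀ n, f n i ≡ L [SMOD (Ideal.span {t}) ^ n • (⊤ : Submodule A A)] :=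
      fun i => IsPrecomplete.prec (f := fun n => f n i) inferInstance fun {m n} hmn => by
        obtain ⟨y, hy⟩ := mem_span_singleton_pow_smul_top.1 (SModEq.sub_mem.1 (hf hmn))
        exact SModEq.sub_mem.2 (mem_span_singleton_pow_smul_top.2 ⟨y i, congrFun hy i⟩)
    choose L hL using h1
    refine ⟨L, fun n => SModEq.sub_mem.2 (mem_span_singleton_pow_smul_top.2 ?_)⟩
    choose y hy using fun i => mem_span_singleton_pow_smul_top.1 (SModEq.sub_mem.1 (hL i n))
    exact ⟨y, funext hy⟩

theorem isPrecomplete_of_finite {t : A} [IsPrecomplete (Ideal.span {t}) A] (M : Type w)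
    [AddCommGroup M] [Module A M] [Module.Finite A M] : IsPrecomplete (Ideal.span {t}) M := by
  obtain ⟨n, f, hf⟩ := Module.Finite.exists_fin' A M
  have := isPrecomplete_pi (t := t) (ι := Fin n)
  exact isPrecomplete_of_surjective f hf

theorem isHausdorff_of_finite {I : Ideal A} [IsNoetherianRing A] [IsAdicComplete I A] (M : Type w)
    [AddCommGroup M] [Module A M] [Module.Finite A M] : IsHausdorff I M :=
  IsHausdorff.of_le_jacobson I M (IsAdicComplete.le_jacobson_bot I)

/-- A ring that is complete for the topology of a principal ideal with noetherian quotient is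
noetherian. -/
theorem isNoetherianRing_of_isAdicComplete (t : A) [IsAdicComplete (Ideal.span {t}) A]
    [IsNoetherianRing (A ⧸ Ideal.span {t})] : IsNoetherianRing A := by
  classical
  -- By Cohen's theorem only prime ideals need finite generation; `Q` below is spanned by lifts of
  -- generators of the image of `P` modulo `t`.
  refine IsNoetherianRing.of_prime fun P hP => ?_
  obtain ⟨S, hS⟩ := (isNoetherianRing_iff_ideal_fg _).1 ‹_› (P.map (Ideal.Quotient.mk (.span {t})))
  have hlift : ∀ y ∈ S, ∃ x ∈ P, Ideal.Quotient.mk (Ideal.span {t}) x = y := fun y hy => by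
    have : y ∈ P.map (Ideal.Quotient.mk (Ideal.span {t})) := hS ▸ Ideal.subset_span hy
    exact (Ideal.mem_map_iff_of_surjective _ Ideal.Quotient.mk_surjective).1 this
  choose! g hgP hg using hlift
  let Q : Ideal A := Ideal.span (g '' S)
  have hQP : Q ≤ P := Ideal.span_le.2 (by rintro _ ⟨y, hy, rfl⟩; exact hgP y hy)
  have hQ : Q.FG := ⟨S.image g, by simp [Q]⟩
  have hdec : ∀ x ∈ P, ∃ q ∈ Q, ∃ y, x = q + t * y := fun x hx => by
    have h1 : Ideal.Quotient.mk (Ideal.span {t}) x ∈ Q.map (Ideal.Quotient.mk (.span {t})) := by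
      rw [Ideal.map_span, ← Set.image_comp]
      have h2 : (Ideal.Quotient.mk (Ideal.span {t}) ∘ g) '' S = (S : Set _) := by
        exact (Set.image_congr (g := id) fun y hy => hg y hy).trans (Set.image_id _)
      rw [h2]
      refine hS.symm ▸ ?_
      exact Ideal.mem_map_of_mem _ hx
    obtain ⟨q, hq, hqx⟩ := (Ideal.mem_map_iff_of_surjective _ Ideal.Quotient.mk_surjective).1 h1
    rw [eq_comm, Ideal.Quotient.mk_eq_mk_iff_sub_mem, Ideal.mem_span_singleton] at hqx
    obtain ⟨y, hy⟩ := hqx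
    exact ⟨q, hq, y, by rw [← hy]; ring⟩
  by_cases ht : t ∈ P
  · have : P = Q ⊔ Ideal.span {t} := by
      refine le_antisymm (fun x hx => ?_)
        (sup_le hQP (Ideal.span_le.2 (Set.singleton_subset_iff.2 ht)))
      obtain ⟨q, hq, y, rfl⟩ := hdec x hx
      exact Submodule.add_mem_sup hq (Ideal.mem_span_singleton.2 (dvd_mul_right _ _))
    rw [this]
    exact Submodule.FG.sup hQ ⟨{t}, by simp⟩
  -- If `t ∉ P`, then `t y ∈ P` forces `y ∈ P`, so the decomposition `x = q + t y` can be iterated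
  -- inside `P`. The resulting series converges in the finite module `Q`, and separatedness of the
  -- ring identifies its limit with `x`.
  · have hdec' : ∀ x : P, ∃ q ∈ Q, ∃ y : P, (x : A) = q + t * y := fun x => by
      obtain ⟨q, hq, y, hy⟩ := hdec x x.2
      have h1 : t * y ∈ P := by
        rw [show t * y = x - q by rw [hy]; ring]
        exact sub_mem x.2 (hQP hq)
      exact ⟨q, hq, ⟨y, (hP.mem_or_mem h1).resolve_left ht⟩, hy⟩
    choose q hqQ r hr using hdec'
    suffices P = Q by rwa [this]
    refine le_antisymm (fun x hx => ?_) hQP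
    have : Module.Finite A Q := Module.Finite.iff_fg.2 hQ
    have : IsPrecomplete (Ideal.span {t}) Q := isPrecomplete_of_finite Q
    let s : ℕ → P := fun n => r^[n] ⟨x, hx⟩
    have hs : ∀ n, (s n : A) = q (s n) + t * s (n + 1) := fun n => by
      rw [hr (s n)]
      congr 3
      exact (Function.iterate_succ_apply' _ _ _).symm
    let c : ℕ → Q := fun n => ∑ k ∈ Finset.range n, t ^ k • ⟨q (s k), hqQ _⟩
    have hc : ∀ n, x = c n + t ^ n * s n := fun n => by
      induction n with
      | zero => simp [c, s]
      | succ n ih =>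
        rw [ih, hs n]
        simp only [c, Finset.sum_range_succ, Submodule.coe_add, Submodule.coe_smul, smul_eq_mul]
        ring
    obtain ⟨L, hL⟩ := IsPrecomplete.prec (I := Ideal.span {t}) inferInstance
      (f := c) fun {m n} hmn => by
        rw [SModEq.sub_mem, ← neg_mem_iff, neg_sub]
        simp only [c]
        rw [← Finset.sum_sdiff (Finset.range_subset_range.2 hmn), add_sub_cancel_right]
        refine Submodule.sum_mem _ fun k hk => ?_
        have hk : m ≤ k := by simpa using (Finset.mem_sdiff.1 hk).2
        exact Submodule.smul_mem_smul (Ideal.pow_le_pow_right hk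
          (Ideal.pow_mem_pow (Ideal.mem_span_singleton_self t) k)) trivial
    have : x - L = 0 := by
      refine IsHausdorff.haus (I := Ideal.span {t}) inferInstance _ fun n => ?_
      have h1 := Submodule.mem_map_of_mem (f := Q.subtype) (SModEq.sub_mem.1 (hL n))
      rw [Submodule.map_smul''] at h1
      have h2 := Submodule.smul_mono (le_refl (Ideal.span {t} ^ n)) le_top h1
      rw [SModEq.zero]
      have h3 : t ^ n * s n ∈ Ideal.span {t} ^ n • (⊤ : Submodule A A) := by
        rw [smul_eq_mul, Ideal.mul_top]
        exact Ideal.mul_mem_right _ _ (Ideal.pow_mem_pow (Ideal.mem_span_singleton_self t) n)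
      have h4 := add_mem h2 h3
      convert h4 using 1
      rw [hc n, map_sub]
      simp only [Submodule.subtype_apply]
      ring
    rw [sub_eq_zero.1 this]
    exact L.2

end Complete

/-! ### Finiteness and torsion in the completed ring, valuations of factorials -/

section Ring

/-- `R` is noetherian by Hilbert's basis theorem and surjects onto `R̂ / p`, so the criterion for
complete rings applies. -/
theorem isNoetherianRing_RHat (p : ℕ) (S : Type u) [CommRing S] [IsNoetherianRing S] (R : Type v)
    [CommRing R] [Algebra S R] [Algebra.FiniteType S R] : IsNoetherianRing (RHat p R) := by
  have : IsNoetherianRing R := Algebra.FiniteType.isNoetherianRing S R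
  let f : R →+* RHat p R ⧸ Ideal.span {(p : RHat p R)} :=
    (Ideal.Quotient.mk _).comp (algebraMap R _)
  have hf : Function.Surjective f := fun x => by
    obtain ⟨x, rfl⟩ := Ideal.Quotient.mk_surjective x
    obtain ⟨r, y, rfl⟩ := exists_eq_add x 1
    refine ⟨r, ?_⟩
    change Ideal.Quotient.mk _ _ = _
    rw [Ideal.Quotient.mk_eq_mk_iff_sub_mem, Ideal.mem_span_singleton]
    exact ⟨-y, by ring⟩
  have : IsNoetherianRing (RHat p R ⧸ Ideal.span {(p : RHat p R)}) :=
    isNoetherianRing_of_surjective _ _ f hf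
  exact isNoetherianRing_of_isAdicComplete (p : RHat p R)

/-- Flatness over the domain `S` makes `p` regular on `R`. If `p x = 0` and `x = r + p ^ n y`, then
`p r` is divisible by `p ^ (n + 1)`, so `r`, and with it `x`, is divisible by `p ^ n` for every `n`.
-/
theorem p_mem_nonZeroDivisors_RHat (p : ℕ) (S : Type u) [CommRing S] [IsDomain S] (hp : (p : S) ≠ 0)
    (R : Type v) [CommRing R] [Algebra S R] [Module.Flat S R] {x : RHat p R}
    (hx : (p : RHat p R) * x = 0) : x = 0 := by
  refine eq_zero_of_pow_dvd fun n => ?_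
  obtain ⟨r, y, rfl⟩ := exists_eq_add x n
  have h0 : (algebraMap R (RHat p R) ((p : R) * r)).val (n + 1) = 0 := by
    have : algebraMap R (RHat p R) ((p : R) * r) = (p : RHat p R) ^ (n + 1) * (- y) := by
      rw [map_mul, map_natCast]
      linear_combination hx
    rw [this, AdicCompletion.val_mul, val_p_pow, zero_mul]
  rw [AdicCompletion.algebraMap_apply] at h0
  have h4 := (Submodule.Quotient.mk_eq_zero _).1 h0
  rw [Ideal.span_singleton_pow, Submodule.ideal_span_singleton_smul] at h4
  obtain ⟨z, -, hz⟩ := h4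
  have hz : (p : R) * r = (p : R) ^ (n + 1) * z := hz.symm
  have h5 : IsSMulRegular R (p : S) :=
    Module.Flat.isSMulRegular_of_nonZeroDivisors (mem_nonZeroDivisors_of_ne_zero hp)
  have h6 : r = (p : R) ^ n * z := h5 (by
    simp only [Algebra.smul_def, map_natCast]
    rw [hz]; ring)
  exact ⟨algebraMap R _ z + y, by rw [h6]; simp [mul_add]⟩

/-- In a ring in which the prime `p` is not a zero divisor and the other primes are units, no
positive integer is a zero divisor. -/
theorem natCast_mul_eq_zero {A : Type v} [CommRing A] {p : ℕ} (hp : p.Prime)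
    (hreg : ∀ x : A, (p : A) * x = 0 → x = 0) (hunit : ∀ m : ℕ, m.Coprime p → IsUnit (m : A))
    {n : ℕ} (hn : n ≠ 0) {x : A} (hx : (n : A) * x = 0) : x = 0 := by
  obtain ⟨e, m, hm, rfl⟩ := Nat.exists_eq_pow_mul_and_not_dvd hn p hp.ne_one
  have hm : m.Coprime p := ((Nat.Prime.coprime_iff_not_dvd hp).2 hm).symm
  have h1 : (p : A) ^ e * x = 0 := by
    refine (hunit m hm).mul_left_cancel ?_
    rw [mul_zero, ← hx]; push_cast; ring
  clear hx
  induction e with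
  | zero => simpa using h1
  | succ e ih => exact ih (by
      intro h
      exact hn (by rw [pow_succ, mul_assoc, mul_comm p m, ← mul_assoc, h, zero_mul])) (hreg _ (by rw [← h1]; ring))

/-- Write `n = p ^ v m` with `m` prime to `p` and take `t = m⁻¹`. The integer `m` is kept in the
conclusion because it makes multiplication by `t` commute with additive maps. -/
theorem exists_natCast_mul_eq_pow {A : Type v} [CommRing A] {p : ℕ} (hp : p.Prime)
    (hunit : ∀ m : ℕ, m.Coprime p → IsUnit (m : A)) {n e : ℕ} (hn : n ≠ 0)
    (h : padicValNat p n ≤ e) : ∃ (t : A) (m : ℕ), (m : A) * t = 1 ∧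
      (n : A) * ((p : A) ^ (e - padicValNat p n) * t) = p ^ e := by
  have : Fact p.Prime := ⟨hp⟩
  obtain ⟨v, m, hm, rfl⟩ := Nat.exists_eq_pow_mul_and_not_dvd hn p hp.ne_one
  have hm' : m.Coprime p := ((Nat.Prime.coprime_iff_not_dvd hp).2 hm).symm
  have hm0 : m ≠ 0 := by rintro rfl; simp at hm
  have hv : padicValNat p (p ^ v * m) = v := by
    rw [padicValNat.mul (pow_ne_zero _ hp.ne_zero) hm0, padicValNat.prime_pow,
      padicValNat.eq_zero_of_not_dvd hm, add_zero]
  obtain ⟨u, hu⟩ := hunit m hm'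
  rw [hv] at h ⊢
  obtain ⟨f, rfl⟩ := Nat.exists_eq_add_of_le h
  have h2 : (m : A) * (u⁻¹ : Aˣ) = 1 := by rw [← hu, Units.mul_inv]
  refine ⟨(u⁻¹ : Aˣ), m, h2, ?_⟩
  rw [Nat.add_sub_cancel_left]
  push_cast
  linear_combination (p : A) ^ v * p ^ f * h2

/-- This is the use of `b - a ≤ p - 1`. Below `p` the factorial is prime to `p`; for `n ≥ p`,
Legendre's inequality `(p - 1) v < n` gives `v ≤ n - p + 1`, which leaves room for `h ≤ p - 1`. -/
theorem padicValNat_factorial_add_min_le {p : ℕ} [hp : Fact p.Prime] (hp2 : 2 < p) {h : ℕ}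
    (hh : h ≤ p - 1) (n : ℕ) : padicValNat p n.factorial + min h n ≤ n := by
  rcases Nat.lt_or_ge n p with hn | hn
  · have : padicValNat p n.factorial = 0 :=
      padicValNat.eq_zero_of_not_dvd fun h => absurd ((hp.out.dvd_factorial).1 h) (not_le.2 hn)
    omega
  · have h1 := sub_one_mul_padicValNat_factorial_lt_of_ne_zero p (n := n)
      (by have := hp.out.pos; omega)
    generalize padicValNat p n.factorial = v at h1 ⊢
    obtain ⟨q, rfl⟩ := Nat.exists_eq_add_of_le' hp2
    obtain ⟨m, rfl⟩ := Nat.exists_eq_add_of_le hn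
    have h2 : v ≤ m + 1 := by
      by_contra hlt
      have h3 : m + 2 ≤ v := by omega
      have h4 := Nat.mul_le_mul_left (q.succ + 2 - 1) h3
      rw [show q.succ + 2 - 1 = q + 2 by omega] at h1 h4
      nlinarith
    omega

/-- Legendre's formula bounds `(p - 1) v` by `n`, and `p - 1 ≥ 2`. This is what makes `p ^ n / n!`
tend to zero. -/
theorem two_mul_padicValNat_factorial_le {p : ℕ} [hp : Fact p.Prime] (hp2 : 2 < p) (n : ℕ) :
    2 * padicValNat p n.factorial ≤ n := by
  have h1 := sub_one_mul_padicValNat_factorial (p := p) n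
  have h2 : 2 * padicValNat p n.factorial ≤ (p - 1) * padicValNat p n.factorial :=
    Nat.mul_le_mul_right _ (by omega)
  omega

theorem isUnit_natCast_wittVector {p : ℕ} [hp : Fact p.Prime] (k : Type u) [Field k] [CharP k p]
    {m : ℕ} (hm : m.Coprime p) : IsUnit (m : WittVector p k) := by
  refine WittVector.isUnit_of_coeff_zero_ne_zero _ ?_
  rw [← WittVector.constantCoeff_apply, map_natCast]
  intro h
  rw [CharP.cast_eq_zero_iff k p] at h
  exact (Nat.Prime.coprime_iff_not_dvd hp.out).1 hm.symm h

end Ring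

/- Divided powers of `p` -/

section Coef

/-- The prime `p` is not a zero divisor and all other primes are invertible. -/
class IsPIntegral (p : ℕ) (A : Type v) [CommRing A] : Prop where
  eq_zero : ∀ x : A, (p : A) * x = 0 → x = 0
  isUnit : ∀ m : ℕ, m.Coprime p → IsUnit (m : A)

variable {d : ℕ}

/-- The sum of the entries of a multi-index. -/
def weight (I : Fin d → ℕ) : ℕ := ∑ j, I j

/-- The factorial of a multi-index. -/
def multiFactorial (I : Fin d → ℕ) : ℕ := ∏ j, (I j).factorial

theorem weight_add (I J : Fin d → ℕ) : weight (I + J) = weight I + weight J :=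
  Finset.sum_add_distrib

theorem weight_zero : weight (0 : Fin d → ℕ) = 0 := by simp [weight]

theorem weight_single (j : Fin d) : weight (Pi.single j 1 : Fin d → ℕ) = 1 := by
  simp [weight]

theorem multiFactorial_ne_zero (I : Fin d → ℕ) : multiFactorial I ≠ 0 :=
  Finset.prod_ne_zero_iff.2 fun _ _ => Nat.factorial_ne_zero _

theorem multiFactorial_add_single (I : Fin d → ℕ) (j : Fin d) :
    multiFactorial (I + Pi.single j 1) = (I j + 1) * multiFactorial I := by
  have h1 : ∀ F : Fin d → ℕ, ∏ i, F i = F j * ∏ i ∈ Finset.univ.erase j, F i := fun F =>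
    (Finset.mul_prod_erase _ _ (Finset.mem_univ j)).symm
  refine (h1 _).trans (Eq.trans ?_ (congrArg ((I j + 1) * ·) (h1 _).symm))
  have h2 : ∏ i ∈ Finset.univ.erase j, (I i + Pi.single (M := fun _ => ℕ) j 1 i).factorial =
      ∏ i ∈ Finset.univ.erase j, (I i).factorial :=
    Finset.prod_congr rfl fun i hi => by simp [Finset.ne_of_mem_erase hi]
  simp only [Pi.add_apply, h2, Pi.single_eq_same, Nat.factorial_succ]
  ring

theorem finite_weight_lt (n : ℕ) : {I : Fin d → ℕ | weight I < n}.Finite :=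
  (Set.finite_Iic (fun _ : Fin d => n)).subset fun I hI j =>
    ((Finset.single_le_sum (fun i _ => Nat.zero_le (I i)) (Finset.mem_univ j)).trans_lt hI).le

variable {A : Type v} [CommRing A]

/-- The element `p ^ (|I| - min (h, |I|)) / I!`. -/
def dividedCoef (p : ℕ) (A : Type v) [CommRing A] (h : ℕ) (I : Fin d → ℕ) : A :=
  Classical.epsilon fun t : A =>
    (multiFactorial I : A) * t = (p : A) ^ (weight I - min h (weight I))

variable {p : ℕ} [Fact p.Prime] [IsPIntegral p A]

/-- Identities between divided coefficients are checked by clearing factorials and cancelling them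
with this lemma. -/
theorem natCast_mul_cancel (p : ℕ) [Fact p.Prime] [IsPIntegral p A] {n : ℕ} (hn : n ≠ 0) {x y : A}
    (h : (n : A) * x = n * y) : x = y := by
  rw [← sub_eq_zero]
  refine natCast_mul_eq_zero (Fact.out : p.Prime) (IsPIntegral.eq_zero (p := p))
    (IsPIntegral.isUnit (p := p)) hn ?_
  rw [mul_sub, h, sub_self]

/-- Since `I!` divides `|I|!`, the estimate for a single factorial applies. Besides the quotient,
the conclusion retains a lower bound for its `p`-exponent, which gives convergence, and an integer
inverse of its unit part, which gives commutation with additive maps. -/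
theorem exists_dividedCoef (hp : 2 < p) {h : ℕ} (hh : h ≤ p - 1) (I : Fin d → ℕ) :
    ∃ (t : A) (m e : ℕ), (m : A) * t = 1 ∧
      weight I - min h (weight I) - padicValNat p (weight I).factorial ≤ e ∧
      (multiFactorial I : A) * ((p : A) ^ e * t) = (p : A) ^ (weight I - min h (weight I)) := by
  have h1 := padicValNat_factorial_add_min_le hp hh (weight I)
  have h2 : padicValNat p (multiFactorial I) ≤ padicValNat p (weight I).factorial :=
    (padicValNat_dvd_iff_le (Nat.factorial_ne_zero _)).1
      (pow_padicValNat_dvd.trans (Nat.prod_factorial_dvd_factorial_sum _ _))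
  obtain ⟨t, m, hm, ht⟩ := exists_natCast_mul_eq_pow (A := A) (Fact.out : p.Prime)
    (IsPIntegral.isUnit (p := p)) (e := weight I - min h (weight I)) (multiFactorial_ne_zero I)
    (by omega)
  exact ⟨t, m, _, hm, by omega, ht⟩

/-- The choice in `dividedCoef` is arbitrary when no quotient exists; under these bounds one does.
-/
theorem dividedCoef_spec (hp : 2 < p) {h : ℕ} (hh : h ≤ p - 1) (I : Fin d → ℕ) :
    (multiFactorial I : A) * dividedCoef p A h I = (p : A) ^ (weight I - min h (weight I)) := by
  obtain ⟨t, m, e, -, -, ht⟩ := exists_dividedCoef (A := A) hp hh I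
  exact Classical.epsilon_spec (p := fun t : A =>
    (multiFactorial I : A) * t = (p : A) ^ (weight I - min h (weight I))) ⟨_, ht⟩

theorem dividedCoef_zero (hp : 2 < p) {h : ℕ} (hh : h ≤ p - 1) :
    dividedCoef p A h (0 : Fin d → ℕ) = 1 := by
  simpa [multiFactorial, weight] using dividedCoef_spec (A := A) hp hh (0 : Fin d → ℕ)

/-- With `w = |I|`, the exponent of `p` is at least `w - (p - 1) - w / 2`, so `w ≥ 2 (n + p)` is
enough. -/
theorem exists_dividedCoef_eq (hp : 2 < p) {h : ℕ} (hh : h ≤ p - 1) (I : Fin d → ℕ) {n : ℕ}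
    (hn : 2 * (n + p) ≤ weight I) : ∃ t : A, dividedCoef p A h I = (p : A) ^ n * t := by
  obtain ⟨t, m, e, -, he, ht⟩ := exists_dividedCoef (A := A) hp hh I
  have h1 := two_mul_padicValNat_factorial_le hp (weight I)
  rw [← dividedCoef_spec hp hh I] at ht
  have h2 := natCast_mul_cancel p (multiFactorial_ne_zero I) ht
  obtain ⟨c, hc⟩ := Nat.exists_eq_add_of_le (show n ≤ e by omega)
  exact ⟨(p : A) ^ c * t, by rw [← h2, hc]; ring⟩

/-- Additive maps commute with the rational scalars `dividedCoef`. -/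
theorem map_dividedCoef_smul (hp : 2 < p) {h : ℕ} (hh : h ≤ p - 1) (I : Fin d → ℕ) {M N : Type*}
    [AddCommGroup M] [Module A M] [AddCommGroup N] [Module A N] (f : M →+ N) (x : M) :
    f (dividedCoef p A h I • x) = dividedCoef p A h I • f x := by
  obtain ⟨t, m, e, hm, -, ht⟩ := exists_dividedCoef (A := A) hp hh I
  rw [← dividedCoef_spec hp hh I] at ht
  -- As `t` is the inverse of the integer `m`, the value `f (t • x)` is determined by `m f (t • x) =
  -- f x`.
  have h1 : f (t • x) = t • f x := by
    have h2 : f x = (m : A) • f (t • x) := by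
      rw [Nat.cast_smul_eq_nsmul, ← map_nsmul, ← Nat.cast_smul_eq_nsmul A, smul_smul, hm, one_smul]
    rw [h2, smul_smul, mul_comm, hm, one_smul]
  rw [← natCast_mul_cancel p (multiFactorial_ne_zero I) ht, mul_smul, mul_smul, ← Nat.cast_pow,
    Nat.cast_smul_eq_nsmul, Nat.cast_smul_eq_nsmul, map_nsmul, h1]

/-- The families with coefficients `dividedCoef` tend to zero. -/
theorem isPAdicNull_dividedCoef_smul (hp : 2 < p) {h : ℕ} (hh : h ≤ p - 1) {M : Type w}
    [AddCommGroup M] [Module A M] (f : (Fin d → ℕ) → M) :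
    IsPAdicNull A p fun I => dividedCoef p A h I • f I := fun n => by
  refine ⟨(finite_weight_lt (2 * (n + p))).toFinset, fun I hI => ?_⟩
  have hI : 2 * (n + p) ≤ weight I := by simpa using hI
  obtain ⟨t, ht⟩ := exists_dividedCoef_eq (A := A) hp hh I hI
  simp only [ht]
  exact mul_smul_mem_span_pow_smul_top _ _

/-- Here is the coefficient form of the Leibniz rule: the binomials turn `J! K!` into `(J + K)!`,
and the extra power of `p` is what the bracket loses when its index drops further, from weight `|K|`
to weight `|J + K|`. The factor for `J` has height `0` because it acts on functions, which carry no
filtration. -/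
theorem dividedCoef_add (hp : 2 < p) {h : ℕ} (hh : h ≤ p - 1) (J K : Fin d → ℕ) :
    dividedCoef p A h (J + K) * ((∏ j, ((J + K) j).choose (J j) : ℕ) *
      (p : A) ^ (min h (weight (J + K)) - min h (weight K))) =
      dividedCoef p A 0 J * dividedCoef p A h K := by
  refine natCast_mul_cancel p (mul_ne_zero (multiFactorial_ne_zero J)
    (multiFactorial_ne_zero K)) ?_
  have h2 := dividedCoef_spec (A := A) hp (Nat.zero_le (p - 1)) J
  have h3 := dividedCoef_spec (A := A) hp hh K
  have h4 := dividedCoef_spec (A := A) hp hh (J + K)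
  have h5 : multiFactorial J * multiFactorial K * ∏ j, ((J + K) j).choose (J j) =
      multiFactorial (J + K) := by
    simp only [multiFactorial, ← Finset.prod_mul_distrib]
    refine Finset.prod_congr rfl fun j _ => ?_
    have h6 := Nat.choose_mul_factorial_mul_factorial (Nat.le_add_right (J j) (K j))
    rw [Nat.add_sub_cancel_left] at h6
    rw [Pi.add_apply, ← h6]
    ring
  have h6 : (p : A) ^ (weight (J + K) - min h (weight (J + K))) *
      p ^ (min h (weight (J + K)) - min h (weight K)) =
      p ^ (weight J - min 0 (weight J)) * p ^ (weight K - min h (weight K)) := by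
    rw [← pow_add, ← pow_add, weight_add]
    congr 1; omega
  rw [← h2, ← h3, ← h4, ← h5] at h6
  push_cast at h6 ⊢
  linear_combination h6

/-- The valuation of `|I|!` is at most `|I| / 2 < |I|`. Modulo `p`, therefore, only the constant
term of a Taylor expansion survives. -/
theorem exists_dividedCoef_eq_p_mul (hp : 2 < p) {I : Fin d → ℕ} (hI : I ≠ 0) :
    ∃ t : A, dividedCoef p A 0 I = (p : A) * t := by
  obtain ⟨t, m, e, -, he, ht⟩ := exists_dividedCoef (A := A) hp (Nat.zero_le (p - 1)) I
  have h1 := two_mul_padicValNat_factorial_le hp (weight I)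
  rw [← dividedCoef_spec hp (Nat.zero_le (p - 1)) I] at ht
  have h2 := natCast_mul_cancel p (multiFactorial_ne_zero I) ht
  have h3 : weight I ≠ 0 := fun h => hI (funext fun j =>
    (Finset.sum_eq_zero_iff.1 h) j (Finset.mem_univ j))
  obtain ⟨c, hc⟩ := Nat.exists_eq_add_of_le (show 1 ≤ e by omega)
  exact ⟨(p : A) ^ c * t, by rw [← h2, hc]; ring⟩

theorem dividedCoef_single (hp : 2 < p) (j : Fin d) :
    dividedCoef p A 0 (Pi.single j 1 : Fin d → ℕ) = p := by
  have h := dividedCoef_spec (A := A) hp (Nat.zero_le (p - 1)) (Pi.single j 1 : Fin d → ℕ)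
  have h7 : multiFactorial (Pi.single j 1 : Fin d → ℕ) = 1 := by
    simpa [multiFactorial] using multiFactorial_add_single (0 : Fin d → ℕ) j
  simpa [h7, weight_single] using h

end Coef

/-! ### The completed étale chart over the Witt vectors -/

section Facts

theorem isPIntegral_RHat (p : ℕ) [Fact p.Prime] (k : Type u) [Field k] [CharP k p] [PerfectRing k p]
    (d : ℕ) (R : Type v) [CommRing R] [Algebra (WittVector p k) R]
    [Algebra (MvPolynomial (Fin d) (WittVector p k)) R]
    [Algebra.Etale (MvPolynomial (Fin d) (WittVector p k)) R] : IsPIntegral p (RHat p R) where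
  eq_zero x hx := by
    refine p_mem_nonZeroDivisors_RHat p (MvPolynomial (Fin d) (WittVector p k)) (fun h => ?_) R hx
    refine WittVector.p_nonzero p k (MvPolynomial.C_injective (Fin d) _ ?_)
    rw [map_natCast, h, map_zero]
  isUnit m hm := by
    have := (isUnit_natCast_wittVector k hm).map (algebraMap (WittVector p k) (RHat p R))
    rwa [map_natCast] at this

theorem isNoetherianRing_RHat_of_etale (p : ℕ) [Fact p.Prime] (k : Type u) [Field k] [CharP k p]
    [PerfectRing k p] (d : ℕ) (R : Type v) [CommRing R]
    [Algebra (MvPolynomial (Fin d) (WittVector p k)) R]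
    [Algebra.Etale (MvPolynomial (Fin d) (WittVector p k)) R] : IsNoetherianRing (RHat p R) :=
  isNoetherianRing_RHat p (MvPolynomial (Fin d) (WittVector p k)) R

end Facts

/-! ### Higher derivatives on `V` and their divided forms -/

section Operators

variable {p : ℕ} [Fact p.Prime] {k : Type u} [Field k]
  {d s : ℕ} {R : Type v} [CommRing R]
  [Algebra (WittVector p k) R] [Algebra (MvPolynomial (Fin d) (WittVector p k)) R]
  [IsScalarTower (WittVector p k) (MvPolynomial (Fin d) (WittVector p k)) R]
  [Algebra.Etale (MvPolynomial (Fin d) (WittVector p k)) R]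
  {a b : ℤ}

/-- The derivation `logDer j` vanishes on falling factorials with step `1` for the logarithmic
coordinates and with step `0` for the others. -/
def logStep (d s : ℕ) (j : Fin d) : ℕ := if (j : ℕ) < s then 1 else 0

/-- The commutator is a derivation that kills the coordinates; `frobDer_eq_zero` for the identity
endomorphism shows that it is zero. -/
theorem logDer_commute [CharP k p] [PerfectRing k p] (i j : Fin d) (r : RHat p R) :
    logDer p k d s R i (logDer p k d s R j r) = logDer p k d s R j (logDer p k d s R i r) := by
  refine sub_eq_zero.1 (frobDer_eq_zero (k := k) (d := d) (RingHom.id _)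
    (((logDer p k d s R i : RHat p R →+ RHat p R).comp (logDer p k d s R j : RHat p R →+ RHat p R)) -
      ((logDer p k d s R j : RHat p R →+ RHat p R).comp (logDer p k d s R i : RHat p R →+ RHat p R)))
    (fun x y => ?_) (fun l => ?_) r)
  · change logDer p k d s R i (logDer p k d s R j (x * y)) -
        logDer p k d s R j (logDer p k d s R i (x * y)) =
      x * (logDer p k d s R i (logDer p k d s R j y) - logDer p k d s R j (logDer p k d s R i y)) +
      y * (logDer p k d s R i (logDer p k d s R j x) - logDer p k d s R j (logDer p k d s R i x))
    simp only [Derivation.leibniz, map_add, smul_eq_mul]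
    ring
  · change logDer p k d s R i (logDer p k d s R j (coord p k d R l)) -
      logDer p k d s R j (logDer p k d s R i (coord p k d R l)) = 0
    simp only [logDer_coord]
    by_cases hj : j = l <;> by_cases hi : i = l <;> by_cases hl : (l : ℕ) < s <;>
      simp [hi, hj, hl, logDer_coord]

variable (p k d s R) in
/-- The derivations `logDer j` as additive endomorphisms. -/
def derEnd (j : Fin d) : AddMonoid.End (RHat p R) := (logDer p k d s R j : RHat p R →+ RHat p R)

variable (p k d s R) in
/-- The divided operator `p ^ |I| / I! ∏ⱼ ∏_{l < I_j} (logDer j - l e_j)` on `R̂`. -/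
def hasse (I : Fin d → ℕ) : RHat p R →+ RHat p R :=
  AddMonoidHom.comp (AddMonoidHom.mulLeft (dividedCoef p (RHat p R) 0 I))
    (multiFalling (derEnd p k d s R) (logStep d s) I : AddMonoid.End (RHat p R))

theorem hasse_apply (I : Fin d → ℕ) (r : RHat p R) : hasse p k d s R I r =
    dividedCoef p (RHat p R) 0 I * multiFalling (derEnd p k d s R) (logStep d s) I r := rfl

namespace FilDeRham

variable (X : FilDeRham.{u, v, w} p k d s R a b)

/-- The operator `∏ⱼ ∏_{l < I_j} (∇_j - l e_j)`, where `e_j` is `1` for the logarithmic coordinates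
and `0` for the others. -/
def mixed (I : Fin d → ℕ) : AddMonoid.End X.V := multiFalling X.nabla (logStep d s) I

theorem nabla_commute (i j : Fin d) : X.nabla i * X.nabla j = X.nabla j * X.nabla i :=
  AddMonoidHom.ext fun v => X.integrable i j v

theorem falling_nabla_mem (j : Fin d) (e n : ℕ) (i : ℤ) {v : X.V} (hv : v ∈ X.Fil i) :
    falling (X.nabla j) e n v ∈ X.Fil (i - n) := by
  induction n generalizing i v with
  | zero => simpa [falling_zero] using hv
  | succ n ih =>
    rw [falling_succ]
    have h1 : (X.nabla j - ((e * n : ℕ) : AddMonoid.End X.V)) v =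
        X.nabla j v - (e * n : ℕ) • v := rfl
    have h2 : X.nabla j v - (e * n : ℕ) • v ∈ X.Fil (i - 1) :=
      sub_mem (X.griffiths i j v hv) (Submodule.smul_of_tower_mem _ _ (X.antitone i hv))
    have := ih (i - 1) (h1 ▸ h2)
    rwa [show i - ((n + 1 : ℕ) : ℤ) = i - 1 - n by push_cast; ring]

theorem mixed_mem (I : Fin d → ℕ) (i : ℤ) {v : X.V} (hv : v ∈ X.Fil i) :
    X.mixed I v ∈ X.Fil (i - weight I) := by
  have := X.list_prod_mem
    (List.ofFn fun j => (falling (X.nabla j) (logStep d s j) (I j), I j)) (by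
    intro D hD i v hv
    obtain ⟨j, rfl⟩ := (List.mem_ofFn' _ _).1 hD
    exact X.falling_nabla_mem j _ (I j) i hv) i hv
  simp only [List.map_ofFn, List.sum_ofFn] at this
  exact this

theorem mixed_zero (v : X.V) : X.mixed 0 v = v := by
  rw [mixed, multiFalling_zero]; rfl

theorem mixed_single (j : Fin d) (v : X.V) : X.mixed (Pi.single j 1) v = X.nabla j v := by
  rw [mixed, multiFalling_single _ _ X.nabla_commute]

theorem mixed_comm (I J : Fin d → ℕ) (v : X.V) :
    X.mixed I (X.mixed J v) = X.mixed J (X.mixed I v) :=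
  DFunLike.congr_fun (multiFalling_commute X.nabla (logStep d s) X.nabla_commute I J) v

theorem mixed_nabla (I : Fin d → ℕ) (j : Fin d) (v : X.V) :
    X.mixed I (X.nabla j v) = X.mixed (I + Pi.single j 1) v +
      (logStep d s j * I j) • X.mixed I v :=
  DFunLike.congr_fun (multiFalling_mul_self X.nabla (logStep d s) X.nabla_commute I j) v

/-- Cutting the range to `c ≤ I ⊓ J`, outside of which the matching numbers vanish, makes `I - c`,
`J - c` and `c` honest multi-indices that sum to `I + J - c`. -/
theorem mixed_mixed (I J : Fin d → ℕ) (v : X.V) :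
    X.mixed I (X.mixed J v) = ∑ c ∈ Finset.Iic (I ⊓ J),
      (∏ j, (matchings (I j) (J j) (c j) * logStep d s j ^ c j)) • X.mixed (I + J - c) v := by
  have h := DFunLike.congr_fun (multiFalling_mul X.nabla (logStep d s) X.nabla_commute I J) v
  refine (h.trans (AddMonoidHom.finsetSum_apply _ _ _)).trans ?_
  have h2 : Finset.Iic (I ⊓ J) ⊆ Fintype.piFinset fun j => Finset.range (J j + 1) := fun c hc => by
    refine Fintype.mem_piFinset.2 fun j => ?_
    have := (Finset.mem_Iic.1 hc) j
    simp only [Pi.inf_apply, le_inf_iff] at this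
    exact Finset.mem_range.2 (by omega)
  symm
  refine Finset.sum_subset h2 fun c hc hc' => ?_
  have h3 : ∏ j, (matchings (I j) (J j) (c j) * logStep d s j ^ c j) = 0 := by
    by_contra hne
    refine hc' (Finset.mem_Iic.2 fun j => ?_)
    have h4 := Finset.prod_ne_zero_iff.1 hne j (Finset.mem_univ j)
    have h5 : c j ≤ I j := by
      by_contra hlt
      exact h4 (by simp [matchings, Nat.choose_eq_zero_of_lt (not_le.1 hlt)])
    have h6 := Finset.mem_range.1 (Fintype.mem_piFinset.1 hc j)
    exact le_inf h5 (Nat.lt_succ_iff.1 h6)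
  change (∏ j, (matchings (I j) (J j) (c j) * logStep d s j ^ c j)) • X.mixed (I + J - c) v = 0
  rw [h3, zero_smul]

theorem mixed_smul [CharP k p] [PerfectRing k p] (I : Fin d → ℕ) (r : RHat p R) (v : X.V) :
    X.mixed I (r • v) = ∑ JK ∈ multiAntidiagonal I, (∏ j, (I j).choose (JK.1 j)) •
      (multiFalling (derEnd p k d s R) (logStep d s) JK.1 r • X.mixed JK.2 v) :=
  multiFalling_smul (derEnd p k d s R) X.nabla
    (fun i j => AddMonoidHom.ext fun r => logDer_commute i j r) X.nabla_commute
    (fun j r x => X.leibniz j r x) _ _ _ _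

/- The brackets -/

theorem fil_le (i : ℤ) (n : ℕ) : X.Fil i ≤ X.Fil (i - n) := by
  induction n with
  | zero => simp
  | succ n ih =>
    refine ih.trans ((X.antitone _).trans (le_of_eq ?_))
    congr 1; push_cast; ring

/-- The distance of an index from the lower bound `a`. -/
def height (i : Set.Icc a b) : ℕ := ((i : ℤ) - a).toNat

theorem coe_eq_add_height (i : Set.Icc a b) : (i : ℤ) = a + height i := by
  have := i.2.1
  simp only [height]; omega

theorem height_le (hp : 2 < p) (hba : b - a ≤ (p : ℤ) - 1) (i : Set.Icc a b) :
    height i ≤ p - 1 := by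
  have := i.2.2
  have := coe_eq_add_height i
  omega

/-- Truncation at `a` is expressed as a descent by `min (height i) n` steps, so that index
computations become arithmetic in `ℕ`. -/
theorem coe_trunc (i : Set.Icc a b) (n : ℕ) :
    ((trunc i n : Set.Icc a b) : ℤ) = i - (min (height i) n : ℕ) := by
  have := coe_eq_add_height i
  simp only [trunc]; omega

theorem height_trunc (i : Set.Icc a b) (n : ℕ) :
    height (trunc i n) = height i - min (height i) n := by
  have h1 := coe_eq_add_height i
  have h2 := coe_eq_add_height (trunc i n)
  have h3 := coe_trunc i n
  omega

theorem trunc_trunc (i : Set.Icc a b) (n m : ℕ) : trunc (trunc i n) m = trunc i (n + m) := by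
  refine Subtype.ext ?_
  rw [coe_trunc, coe_trunc, coe_trunc, height_trunc]
  omega

theorem br_congr' {i j : Set.Icc a b} (hij : (i : ℤ) = j) {x y : X.V} (hxy : x = y)
    (hx : x ∈ X.Fil i) (hy : y ∈ X.Fil j) : X.br i ⟨x, hx⟩ = X.br j ⟨y, hy⟩ := by
  subst hxy; exact X.br_congr hij hx hy

/-- Brackets carry membership proofs; this moves an additive relation from `V` to `Ṽ` once all of
its terms are known to lie in the same filtration step. -/
theorem br_eq_sum {ι : Type*} (i : Set.Icc a b) (S : Finset ι) (f : ι → X.V) (F : ι → X.Tilde)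
    {x : X.V} (hx : x ∈ X.Fil i) (hxf : x = ∑ l ∈ S, f l)
    (hF : ∀ l ∈ S, ∃ h : f l ∈ X.Fil i, X.br i ⟨f l, h⟩ = F l) :
    X.br i ⟨x, hx⟩ = ∑ l ∈ S, F l := by
  classical
  induction S using Finset.induction_on generalizing x with
  | empty => rw [X.br_congr' rfl hxf hx (zero_mem _)]; exact map_zero (X.br i)
  | insert k S hk ih =>
    rw [Finset.sum_insert hk] at hxf ⊢
    obtain ⟨h1, h2⟩ := hF k (Finset.mem_insert_self _ _)
    have h3 : ∑ l ∈ S, f l ∈ X.Fil i := Submodule.sum_mem _ fun l hl =>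
      (hF l (Finset.mem_insert_of_mem hl)).1
    rw [← ih h3 rfl fun l hl => hF l (Finset.mem_insert_of_mem hl), ← h2, ← map_add]
    exact X.br_congr' rfl hxf _ _

theorem br_eq_pow_smul (i j : Set.Icc a b) (n : ℕ) (hij : (j : ℤ) = i - n) (x : X.V)
    (hi : x ∈ X.Fil i) (hj : x ∈ X.Fil j) :
    X.br j ⟨x, hj⟩ = (p : RHat p R) ^ n • X.br i ⟨x, hi⟩ := by
  induction n generalizing j with
  | zero => rw [pow_zero, one_smul]; exact X.br_congr (by simpa using hij) _ _
  | succ n ih =>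
    have hi' := i.2
    have hj' := j.2
    let l : Set.Icc a b := ⟨j + 1, by have := hj'.1; omega, by have := hi'.2; omega⟩
    have hl : x ∈ X.Fil l := by
      have := X.fil_le i n hi
      rwa [show (l : ℤ) = i - n by simp only [l]; omega]
    rw [X.br_rel l j (by simp [l]) x hl hj, ih l (by simp only [l]; omega) hl, smul_smul, pow_succ']

/-- Each actual step down costs a factor `p`; once the index has reached `a` there are no further
steps and no further factors. -/
theorem br_trunc_eq_pow_smul (i : Set.Icc a b) {n m : ℕ} (h : n ≤ m) (x : X.V)
    (hn : x ∈ X.Fil (trunc i n)) (hm : x ∈ X.Fil (trunc i m)) :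
    X.br (trunc i m) ⟨x, hm⟩ =
      (p : RHat p R) ^ (min (height i) m - min (height i) n) • X.br (trunc i n) ⟨x, hn⟩ :=
  X.br_eq_pow_smul _ _ _ (by rw [coe_trunc, coe_trunc]; omega) x hn hm

theorem mixed_mem_trunc (I : Fin d → ℕ) (i : Set.Icc a b) {v : X.V} (hv : v ∈ X.Fil i) :
    X.mixed I v ∈ X.Fil (trunc i (weight I)) := X.mem_trunc i _ (X.mixed_mem I i hv)

/- The divided operators on `Ṽ` -/

/-- The map `[v]_i ↦ p ^ (|I| - min (i - a, |I|)) / I! [∇ ^ I v]_{max (a, i - |I|)}` on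
`⨁ Fil^i V`. -/
def preHasse (I : Fin d → ℕ) : X.FilSum →+ X.Tilde :=
  DirectSum.toAddMonoid fun i =>
    (DistribSMul.toAddMonoidHom X.Tilde (dividedCoef p (RHat p R) (height i) I)).comp
      ((X.br (trunc i (weight I))).toAddMonoidHom.comp
        (AddMonoidHom.mk' (fun v : X.Fil i => (⟨X.mixed I v, X.mixed_mem_trunc I i v.2⟩ :
          X.Fil (trunc i (weight I)))) fun _ _ => Subtype.ext (map_add (X.mixed I) _ _)))

theorem preHasse_lof (I : Fin d → ℕ) (i : Set.Icc a b) (v : X.Fil i) :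
    X.preHasse I (DirectSum.lof (RHat p R) _ (fun i : Set.Icc a b => X.Fil i) i v) =
      dividedCoef p (RHat p R) (height i) I •
        X.br (trunc i (weight I)) ⟨X.mixed I v, X.mixed_mem_trunc I i v.2⟩ := by
  rw [DirectSum.lof_eq_of, preHasse, DirectSum.toAddMonoid_of]
  rfl

theorem mixed_p_pow_smul (I : Fin d → ℕ) (n : ℕ) (v : X.V) :
    X.mixed I ((p : RHat p R) ^ n • v) = (p : RHat p R) ^ n • X.mixed I v := by
  have h : ∀ v : X.V, (p : RHat p R) ^ n • v = (p ^ n : ℕ) • v := fun v => by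
    rw [← Nat.cast_smul_eq_nsmul (RHat p R)]; push_cast; rfl
  rw [h, h, map_nsmul]

variable [CharP k p] [PerfectRing k p]

theorem tilde_induction {P : X.Tilde → Prop} (h0 : ∀ (i : Set.Icc a b) (v : X.V) (hv : v ∈ X.Fil i),
    P (X.br i ⟨v, hv⟩)) (hadd : ∀ x y, P x → P y → P (x + y)) (hz : P 0) (x : X.Tilde) : P x := by
  obtain ⟨x, rfl⟩ := X.tildeRel.mkQ_surjective x
  induction x using DirectSum.induction_on with
  | zero => rwa [map_zero]
  | add x y hx hy => rw [map_add]; exact hadd _ _ hx hy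
  | of i v => exact h0 i v v.2

theorem addHom_ext {G : Type*} [AddCommGroup G] {f g : X.Tilde →+ G}
    (h : ∀ (i : Set.Icc a b) (v : X.V) (hv : v ∈ X.Fil i),
      f (X.br i ⟨v, hv⟩) = g (X.br i ⟨v, hv⟩)) : f = g :=
  AddMonoidHom.ext fun x => X.tilde_induction (P := fun x => f x = g x) h
    (fun x y hx hy => by rw [map_add, map_add, hx, hy]) (by rw [map_zero, map_zero]) x

/-- The indices of a relation have heights `h` and `h - 1`. Both terms become multiples of the same
bracket, and `min (h, w + 1) = min (h - 1, w) + 1` with `w = |I|` balances the powers of `p`. -/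
theorem preHasse_eq_zero (hp : 2 < p) (hba : b - a ≤ (p : ℤ) - 1) (I : Fin d → ℕ) (z : X.FilSum)
    (hz : z ∈ X.tildeRel) : X.preHasse I z = 0 := by
  have := isPIntegral_RHat p k d R
  -- The map is only additive, so the induction over the span needs the vanishing on all scalar
  -- multiples of `z`.
  suffices h : ∀ r : RHat p R, X.preHasse I (r • z) = 0 by simpa using h 1
  induction hz using Submodule.span_induction with
  | zero => intro r; rw [smul_zero, map_zero]
  | add x y _ _ hx hy => intro r; rw [smul_add, map_add, hx, hy, add_zero]
  | smul t x _ hx => intro r; rw [smul_smul, hx]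
  | mem z hz =>
    obtain ⟨i, j, x, hi, hj, hij, rfl⟩ := hz
    intro r
    have h1 := (X.Fil i).smul_mem ((p : RHat p R) ^ 1) ((X.Fil i).smul_mem r hi)
    have h2 : r • ((p : RHat p R) • DirectSum.lof (RHat p R) _ (fun i : Set.Icc a b => X.Fil i) i
        ⟨x, hi⟩ - DirectSum.lof (RHat p R) _ (fun i : Set.Icc a b => X.Fil i) j ⟨x, hj⟩) =
        DirectSum.lof (RHat p R) _ (fun i : Set.Icc a b => X.Fil i) i ⟨_, h1⟩ -
        DirectSum.lof (RHat p R) _ (fun i : Set.Icc a b => X.Fil i) j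
          ⟨r • x, (X.Fil j).smul_mem r hj⟩ := by
      rw [smul_sub, smul_comm, ← map_smul, ← map_smul, ← map_smul]
      congr 2
      exact Subtype.ext (congrArg (· • r • x) (pow_one (p : RHat p R)).symm)
    have hh : height i = height j + 1 := by
      have := coe_eq_add_height i
      have := coe_eq_add_height j
      omega
    have h3 : trunc j (weight I) = trunc i (weight I + 1) := by
      rw [add_comm, ← trunc_trunc]
      congr 1
      refine Subtype.ext ?_
      rw [coe_trunc, hh]
      omega
    have h4 : X.mixed I (r • x) ∈ X.Fil (trunc i (weight I)) :=
      X.mixed_mem_trunc I i ((X.Fil i).smul_mem r hi)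
    have h5 : X.mixed I (r • x) ∈ X.Fil (trunc j (weight I)) :=
      X.mixed_mem_trunc I j ((X.Fil j).smul_mem r hj)
    have h5' := h5
    rw [h3] at h5'
    rw [h2, map_sub, preHasse_lof, preHasse_lof]
    have h6 : X.br (trunc i (weight I)) ⟨X.mixed I ((p : RHat p R) ^ 1 • r • x),
        X.mixed_mem_trunc I i h1⟩ = (p : RHat p R) • X.br (trunc i (weight I)) ⟨_, h4⟩ := by
      rw [← map_smul]
      congr 1
      exact Subtype.ext ((X.mixed_p_pow_smul I 1 _).trans (congrArg (· • _) (pow_one _)))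
    have h7 : X.br (trunc j (weight I)) ⟨X.mixed I (r • x), h5⟩ =
        (p : RHat p R) ^ (min (height i) (weight I + 1) - min (height i) (weight I)) •
          X.br (trunc i (weight I)) ⟨_, h4⟩ := by
      rw [X.br_congr (congrArg Subtype.val h3) h5 h5',
        X.br_trunc_eq_pow_smul i (Nat.le_succ (weight I)) _ h4 h5']
    rw [h6, h7, smul_smul, smul_smul, ← sub_smul]
    convert zero_smul (RHat p R) _
    rw [sub_eq_zero]
    refine natCast_mul_cancel p (multiFactorial_ne_zero I) ?_
    rw [← mul_assoc, ← mul_assoc, dividedCoef_spec hp (height_le hp hba i),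
      dividedCoef_spec hp (height_le hp hba j), ← pow_succ, ← pow_add]
    congr 1
    omega

/-- The divided operator on `Ṽ` with
`[v]_i ↦ p ^ (|I| - min (i - a, |I|)) / I! [∇ ^ I v]_{max (a, i - |I|)}`. -/
def hasseTilde (hp : 2 < p) (hba : b - a ≤ (p : ℤ) - 1) (I : Fin d → ℕ) : X.Tilde →+ X.Tilde :=
  QuotientAddGroup.lift X.tildeRel.toAddSubgroup (X.preHasse I) fun z hz =>
    X.preHasse_eq_zero hp hba I z hz

section

variable (hp : 2 < p) (hba : b - a ≤ (p : ℤ) - 1)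

theorem hasseTilde_br (I : Fin d → ℕ) (i : Set.Icc a b) (v : X.V) (hv : v ∈ X.Fil i) :
    X.hasseTilde hp hba I (X.br i ⟨v, hv⟩) = dividedCoef p (RHat p R) (height i) I •
      X.br (trunc i (weight I)) ⟨X.mixed I v, X.mixed_mem_trunc I i hv⟩ :=
  X.preHasse_lof I i ⟨v, hv⟩

theorem hasseTilde_zero (x : X.Tilde) : X.hasseTilde hp hba 0 x = x := by
  have := isPIntegral_RHat p k d R
  refine DFunLike.congr_fun (X.addHom_ext (f := X.hasseTilde hp hba 0) (g := AddMonoidHom.id _)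
    fun i v hv => ?_) x
  rw [hasseTilde_br, dividedCoef_zero hp (height_le hp hba i), one_smul]
  exact X.br_congr' (by rw [coe_trunc, weight_zero]; simp) (X.mixed_zero v) _ _

variable (p R) in
/-- The coefficient of a composite of two divided operators. -/
def compCoef (h : ℕ) (I J : Fin d → ℕ) : RHat p R :=
  dividedCoef p (RHat p R) h J * dividedCoef p (RHat p R) (h - min h (weight J)) I

/-- The second coefficient is taken at the height left after the first operator. The two truncations
combine into one that depends only on `|I| + |J|`, so the composite coefficient is symmetric in `I`
and `J`. -/
theorem compCoef_spec [IsPIntegral p (RHat p R)] (hp : 2 < p) {h : ℕ} (hh : h ≤ p - 1)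
    (I J : Fin d → ℕ) : (multiFactorial I * multiFactorial J : ℕ) * compCoef p R h I J =
      (p : RHat p R) ^ (weight I + weight J - min h (weight I + weight J)) := by
  have h1 := dividedCoef_spec (A := RHat p R) hp hh J
  have h2 := dividedCoef_spec (A := RHat p R) hp
    (show h - min h (weight J) ≤ p - 1 by omega) I
  rw [show weight I + weight J - min h (weight I + weight J) =
    (weight J - min h (weight J)) + (weight I - min (h - min h (weight J)) (weight I)) by omega,
    pow_add, ← h1, ← h2, compCoef]
  push_cast; ring

theorem mixed_mixed_mem_trunc (I J : Fin d → ℕ) (i : Set.Icc a b) {v : X.V} (hv : v ∈ X.Fil i) :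
    X.mixed I (X.mixed J v) ∈ X.Fil (trunc i (weight I + weight J)) := by
  have := X.mixed_mem_trunc I (trunc i (weight J)) (X.mixed_mem_trunc J i hv)
  rwa [trunc_trunc, add_comm] at this

theorem hasseTilde_hasseTilde_br (I J : Fin d → ℕ) (i : Set.Icc a b) (v : X.V)
    (hv : v ∈ X.Fil i) :
    X.hasseTilde hp hba I (X.hasseTilde hp hba J (X.br i ⟨v, hv⟩)) =
      compCoef p R (height i) I J • X.br (trunc i (weight I + weight J))
        ⟨X.mixed I (X.mixed J v), X.mixed_mixed_mem_trunc I J i hv⟩ := by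
  have := isPIntegral_RHat p k d R
  rw [hasseTilde_br, map_dividedCoef_smul hp (height_le hp hba i), hasseTilde_br, smul_smul,
    height_trunc, compCoef]
  congr 1
  exact X.br_congr (by rw [trunc_trunc, add_comm]) _ _

theorem hasseTilde_comm (I J : Fin d → ℕ) (x : X.Tilde) :
    X.hasseTilde hp hba I (X.hasseTilde hp hba J x) =
      X.hasseTilde hp hba J (X.hasseTilde hp hba I x) := by
  have := isPIntegral_RHat p k d R
  refine DFunLike.congr_fun (X.addHom_ext
    (f := (X.hasseTilde hp hba I).comp (X.hasseTilde hp hba J))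
    (g := (X.hasseTilde hp hba J).comp (X.hasseTilde hp hba I)) fun i v hv => ?_) x
  rw [AddMonoidHom.comp_apply, AddMonoidHom.comp_apply, hasseTilde_hasseTilde_br,
    hasseTilde_hasseTilde_br]
  have h1 : compCoef p R (height i) I J = compCoef p R (height i) J I := by
    refine natCast_mul_cancel p (mul_ne_zero (multiFactorial_ne_zero I)
      (multiFactorial_ne_zero J)) ?_
    rw [compCoef_spec hp (height_le hp hba i), mul_comm (multiFactorial I),
      compCoef_spec hp (height_le hp hba i), add_comm]
  rw [h1]
  congr 1
  exact X.br_congr' (by rw [add_comm]) (X.mixed_comm I J v) _ _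

/-- The effect of a divided operator on a multiple of a vector. -/
theorem hasseTilde_smul (I : Fin d → ℕ) (r : RHat p R) (x : X.Tilde) :
    X.hasseTilde hp hba I (r • x) = ∑ JK ∈ multiAntidiagonal I,
      hasse p k d s R JK.1 r • X.hasseTilde hp hba JK.2 x := by
  have := isPIntegral_RHat p k d R
  refine DFunLike.congr_fun (X.addHom_ext
    (f := (X.hasseTilde hp hba I).comp (DistribSMul.toAddMonoidHom _ r))
    (g := ∑ JK ∈ multiAntidiagonal I,
      (DistribSMul.toAddMonoidHom _ (hasse p k d s R JK.1 r)).comp (X.hasseTilde hp hba JK.2))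
    fun i v hv => ?_) x |>.trans (by rw [AddMonoidHom.finsetSum_apply]; rfl)
  rw [AddMonoidHom.finsetSum_apply]
  change X.hasseTilde hp hba I (r • X.br i ⟨v, hv⟩) = ∑ JK ∈ multiAntidiagonal I,
    hasse p k d s R JK.1 r • X.hasseTilde hp hba JK.2 (X.br i ⟨v, hv⟩)
  rw [← map_smul]
  refine (X.hasseTilde_br hp hba I i (r • v) ((X.Fil i).smul_mem r hv)).trans ?_
  -- All summands of the Leibniz rule are read in the step of weight `|I|`. The derivative of `v` of
  -- order `K` already lies in the step of weight `|K|`, and the difference is a power of `p`,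
  -- absorbed by `dividedCoef_add`.
  rw [X.br_eq_sum (trunc i (weight I)) (multiAntidiagonal I) _ (fun JK =>
    (∏ j, (I j).choose (JK.1 j)) • multiFalling (derEnd p k d s R) (logStep d s) JK.1 r •
      (p : RHat p R) ^ (min (height i) (weight I) - min (height i) (weight JK.2)) •
        X.br (trunc i (weight JK.2)) ⟨X.mixed JK.2 v, X.mixed_mem_trunc JK.2 i hv⟩)
    _ (X.mixed_smul I r v) ?_, Finset.smul_sum]
  · refine Finset.sum_congr rfl fun JK hJK => ?_
    obtain rfl := mem_multiAntidiagonal.1 hJK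
    rw [hasseTilde_br, hasse_apply, ← Nat.cast_smul_eq_nsmul (RHat p R), smul_smul, smul_smul,
      smul_smul, smul_smul]
    congr 1
    have h1 := dividedCoef_add (A := RHat p R) hp (height_le hp hba i) JK.1 JK.2
    linear_combination (multiFalling (derEnd p k d s R) (logStep d s) JK.1 r) * h1
  · intro JK hJK
    obtain rfl := mem_multiAntidiagonal.1 hJK
    have h1 : X.mixed JK.2 v ∈ X.Fil (trunc i (weight (JK.1 + JK.2))) := by
      have h2 := X.mixed_mem_trunc JK.2 i hv
      have h3 := X.fil_le _ (min (height i) (weight (JK.1 + JK.2)) - min (height i) (weight JK.2)) h2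
      rw [weight_add] at h3 ⊢
      rwa [coe_trunc, show (i : ℤ) - (min (height i) (weight JK.2) : ℕ) -
        (min (height i) (weight JK.1 + weight JK.2) - min (height i) (weight JK.2) : ℕ) =
        (trunc i (weight JK.1 + weight JK.2) : Set.Icc a b) by rw [coe_trunc]; omega] at h3
    refine ⟨Submodule.smul_of_tower_mem _ _ (Submodule.smul_mem _ _ h1), ?_⟩
    rw [← X.br_trunc_eq_pow_smul i (by rw [weight_add]; omega) _ _ h1]
    exact (map_nsmul (X.br _) _ (_ • (⟨_, h1⟩ : X.Fil _))).trans
      (congrArg (_ • ·) (map_smul (X.br _) _ _))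

/-- The effect of composing with a divided operator of weight one. -/
theorem hasseTilde_hasseTilde_single (I : Fin d → ℕ) (j : Fin d) (x : X.Tilde) :
    X.hasseTilde hp hba I (X.hasseTilde hp hba (Pi.single j 1) x) =
      (I j + 1) • X.hasseTilde hp hba (I + Pi.single j 1) x +
        (p * logStep d s j * I j) • X.hasseTilde hp hba I x := by
  have := isPIntegral_RHat p k d R
  induction x using X.tilde_induction
  case h0 i v hv =>
    rw [hasseTilde_hasseTilde_br, hasseTilde_br, hasseTilde_br]
    have h1 : X.mixed (I + Pi.single j 1) v ∈ X.Fil (trunc i (weight I + 1)) := by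
      have := X.mixed_mem_trunc (I + Pi.single j 1) i hv
      rwa [weight_add, weight_single] at this
    -- The term of weight `|I|` lies deeper than needed; reading it one step lower and comparing
    -- coefficients produces the factor `p` in front of `e_j I_j`.
    have h2 : X.mixed I v ∈ X.Fil (trunc i (weight I + 1)) := by
      have h3 := X.fil_le _ (min (height i) (weight I + 1) - min (height i) (weight I))
        (X.mixed_mem_trunc I i hv)
      rwa [coe_trunc, show (i : ℤ) - (min (height i) (weight I) : ℕ) -
        (min (height i) (weight I + 1) - min (height i) (weight I) : ℕ) =
        (trunc i (weight I + 1) : Set.Icc a b) by rw [coe_trunc]; omega] at h3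
    have h3 : X.br (trunc i (weight I + weight (Pi.single j 1 : Fin d → ℕ)))
        ⟨X.mixed I (X.mixed (Pi.single j 1) v), X.mixed_mixed_mem_trunc I _ i hv⟩ =
        X.br (trunc i (weight I + 1)) ⟨_, h1⟩ +
          (logStep d s j * I j) • X.br (trunc i (weight I + 1)) ⟨_, h2⟩ := by
      rw [← map_nsmul, ← map_add]
      exact X.br_congr' (by rw [weight_single]) (by rw [mixed_single, mixed_nabla]; rfl) _ _
    rw [h3, X.br_trunc_eq_pow_smul i (Nat.le_succ _) _ (X.mixed_mem_trunc I i hv) h2,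
      X.br_congr (j := trunc i (weight (I + Pi.single j 1))) (by rw [weight_add, weight_single])
        h1 (X.mixed_mem_trunc _ i hv), smul_add, ← Nat.cast_smul_eq_nsmul (RHat p R),
      ← Nat.cast_smul_eq_nsmul (RHat p R), ← Nat.cast_smul_eq_nsmul (RHat p R), smul_smul,
      smul_smul, smul_smul, smul_smul]
    have h4 := compCoef_spec (R := R) hp (height_le hp hba i) I (Pi.single j 1)
    have h5 := dividedCoef_spec (A := RHat p R) hp (height_le hp hba i) (I + Pi.single j 1)
    have h6 := dividedCoef_spec (A := RHat p R) hp (height_le hp hba i) I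
    have h7 : multiFactorial (Pi.single j 1 : Fin d → ℕ) = 1 := by
      refine Finset.prod_eq_one fun l _ => ?_
      rcases eq_or_ne l j with rfl | h <;> simp [*]
    rw [weight_single, h7, mul_one] at h4
    rw [weight_add, weight_single, multiFactorial_add_single] at h5
    congr 2
    · refine natCast_mul_cancel p (multiFactorial_ne_zero I) ?_
      rw [h4, ← h5]; push_cast; ring
    · refine natCast_mul_cancel p (multiFactorial_ne_zero I) ?_
      have h8 : (p : RHat p R) ^ (weight I + 1 - min (height i) (weight I + 1)) *
          p ^ (min (height i) (weight I + 1) - min (height i) (weight I)) =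
          p * p ^ (weight I - min (height i) (weight I)) := by
        rw [← pow_add, ← pow_succ']
        congr 1; omega
      rw [← h4, ← h6] at h8
      push_cast
      linear_combination (logStep d s j * I j : RHat p R) * h8
  case hadd x y hx hy =>
    simp only [map_add, smul_add, hx, hy]; abel
  case hz => simp

/-- The multinomial coefficient `(l + m + n)! / (l! m! n!)`. -/
def trinomial (l m n : ℕ) : ℕ := (l + m + n).choose m * (l + n).choose n

/-- Dividing the operators by factorials multiplies the structure constant of order `c` by `(I + J -
c)! / (I! J!)`; this turns the matching number into a trinomial coefficient. -/
theorem trinomial_mul_factorial (l m n : ℕ) :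
    trinomial l m n * (l + n).factorial * (m + n).factorial =
      matchings (l + n) (m + n) n * (l + m + n).factorial := by
  have h1 := Nat.choose_mul_factorial_mul_factorial (show m ≤ l + m + n by omega)
  have h2 := Nat.choose_mul_factorial_mul_factorial (show n ≤ m + n by omega)
  rw [show l + m + n - m = l + n by omega] at h1
  rw [show m + n - n = m by omega] at h2
  rw [trinomial, matchings, ← h1, ← h2]
  ring

/-- The composite of two divided operators. -/
theorem hasseTilde_hasseTilde (I J : Fin d → ℕ) (x : X.Tilde) :
    X.hasseTilde hp hba I (X.hasseTilde hp hba J x) = ∑ c ∈ Finset.Iic (I ⊓ J),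
      (∏ j, (trinomial (I j - c j) (J j - c j) (c j) * (p * logStep d s j) ^ c j)) •
        X.hasseTilde hp hba (I + J - c) x := by
  have := isPIntegral_RHat p k d R
  induction x using X.tilde_induction
  case h0 i v hv =>
    rw [hasseTilde_hasseTilde_br]
    have hw : ∀ c ∈ Finset.Iic (I ⊓ J), weight (I + J - c) + weight c = weight I + weight J :=
      fun c hc => by
        have hc := Finset.mem_Iic.1 hc
        rw [← weight_add, ← weight_add]
        congr 1
        exact tsub_add_cancel_of_le (hc.trans (inf_le_left.trans le_self_add))
    rw [X.br_eq_sum (trunc i (weight I + weight J)) (Finset.Iic (I ⊓ J)) _ (fun c =>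
      (∏ j, (matchings (I j) (J j) (c j) * logStep d s j ^ c j)) •
      (p : RHat p R) ^ (min (height i) (weight I + weight J) -
        min (height i) (weight (I + J - c))) •
        X.br (trunc i (weight (I + J - c))) ⟨X.mixed (I + J - c) v, X.mixed_mem_trunc _ i hv⟩)
      _ (X.mixed_mixed I J v) ?_, Finset.smul_sum]
    · refine Finset.sum_congr rfl fun c hc => ?_
      rw [hasseTilde_br, ← Nat.cast_smul_eq_nsmul (RHat p R), ← Nat.cast_smul_eq_nsmul (RHat p R),
        smul_smul, smul_smul, smul_smul]
      congr 1
      have h1 := compCoef_spec (R := R) hp (height_le hp hba i) I J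
      have h2 := dividedCoef_spec (A := RHat p R) hp (height_le hp hba i) (I + J - c)
      -- The factor `p ^ |c|` accounts for the drop from total weight `|I| + |J|` to `|I + J - c|`;
      -- the rest is the factorial identity in each coordinate.
      have h3 : (∏ j, (trinomial (I j - c j) (J j - c j) (c j) * (p * logStep d s j) ^ c j)) *
          (multiFactorial I * multiFactorial J) =
          p ^ weight c * (∏ j, (matchings (I j) (J j) (c j) * logStep d s j ^ c j)) *
            multiFactorial (I + J - c) := by
        simp only [multiFactorial, weight, ← Finset.prod_pow_eq_pow_sum, ← Finset.prod_mul_distrib]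
        refine Finset.prod_congr rfl fun j _ => ?_
        have hcj := (Finset.mem_Iic.1 hc) j
        simp only [Pi.inf_apply, le_inf_iff] at hcj
        obtain ⟨A, hA⟩ := Nat.exists_eq_add_of_le' hcj.1
        obtain ⟨B, hB⟩ := Nat.exists_eq_add_of_le' hcj.2
        rw [Pi.sub_apply, Pi.add_apply, hA, hB, Nat.add_sub_cancel, Nat.add_sub_cancel,
          show A + c j + (B + c j) - c j = A + B + c j by omega, mul_pow]
        linear_combination (p ^ c j * logStep d s j ^ c j) * trinomial_mul_factorial A B (c j)
      have h4 : (p : RHat p R) ^ (weight I + weight J - min (height i) (weight I + weight J)) *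
          p ^ (min (height i) (weight I + weight J) - min (height i) (weight (I + J - c))) =
          p ^ weight c * p ^ (weight (I + J - c) - min (height i) (weight (I + J - c))) := by
        rw [← pow_add, ← pow_add]
        have := hw c hc
        congr 1; omega
      refine natCast_mul_cancel p (mul_ne_zero (mul_ne_zero (multiFactorial_ne_zero I)
        (multiFactorial_ne_zero J)) (multiFactorial_ne_zero (I + J - c))) ?_
      rw [← h1, ← h2] at h4
      have h5 := congrArg (Nat.cast : ℕ → RHat p R) h3
      generalize (∏ j, (trinomial (I j - c j) (J j - c j) (c j) * (p * logStep d s j) ^ c j)) =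
        u at h5 ⊢
      generalize (∏ j, (matchings (I j) (J j) (c j) * logStep d s j ^ c j)) = t at h5 ⊢
      push_cast at h4 h5 ⊢
      linear_combination (t * multiFactorial (I + J - c) : RHat p R) * h4 -
        (multiFactorial (I + J - c) * dividedCoef p (RHat p R) (height i) (I + J - c)) * h5
    · intro c hc
      have hw := hw c hc
      have h1 : X.mixed (I + J - c) v ∈ X.Fil (trunc i (weight I + weight J)) := by
        have h3 := X.fil_le _ (min (height i) (weight I + weight J) -
          min (height i) (weight (I + J - c))) (X.mixed_mem_trunc (I + J - c) i hv)
        rwa [coe_trunc, show (i : ℤ) - (min (height i) (weight (I + J - c)) : ℕ) -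
          (min (height i) (weight I + weight J) - min (height i) (weight (I + J - c)) : ℕ) =
          (trunc i (weight I + weight J) : Set.Icc a b) by rw [coe_trunc]; omega] at h3
      refine ⟨Submodule.smul_of_tower_mem _ _ h1, ?_⟩
      rw [← X.br_trunc_eq_pow_smul i (by omega) _ _ h1]
      exact map_nsmul (X.br _) _ (⟨_, h1⟩ : X.Fil _)
  case hadd x y hx hy => simp only [map_add, smul_add, Finset.sum_add_distrib, hx, hy]
  case hz => simp

end

end FilDeRham

end Operators

/-! ### The increments between two Frobenius lifts -/

theorem derivation_prod {S A ι : Type*} [CommRing S] [CommRing A] [Algebra S A] [DecidableEq ι]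
    (D : Derivation S A A) (t : Finset ι) (f : ι → A) :
    D (∏ i ∈ t, f i) = ∑ i ∈ t, (∏ l ∈ t.erase i, f l) * D (f i) := by
  induction t using Finset.induction_on with
  | empty => simp
  | insert i t hi ih =>
    rw [Finset.prod_insert hi, D.leibniz, ih, Finset.sum_insert hi, Finset.erase_insert hi,
      smul_eq_mul, smul_eq_mul, Finset.mul_sum, add_comm]
    congr 1
    refine Finset.sum_congr rfl fun l hl => ?_
    have hne : i ≠ l := fun h => hi (h ▸ hl)
    rw [Finset.erase_insert_of_ne hne, Finset.prod_insert (fun h => hi (Finset.mem_of_mem_erase h)),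
      mul_assoc]

section Ratio

variable {p : ℕ} [Fact p.Prime] {k : Type u} [Field k] [CharP k p] [PerfectRing k p]
  {d s : ℕ} {R : Type v} [CommRing R]
  [Algebra (WittVector p k) R] [Algebra (MvPolynomial (Fin d) (WittVector p k)) R]
  [IsScalarTower (WittVector p k) (MvPolynomial (Fin d) (WittVector p k)) R]
  [Algebra.Etale (MvPolynomial (Fin d) (WittVector p k)) R]

namespace FrobLift

variable (Φ Ψ Ξ : FrobLift p k d R)

/-- The element `(Φ(T_j) / Ψ(T_j) - 1) / p`. -/
def logRatio (j : Fin d) : RHat p R := ((Ψ.w j)⁻¹ : (RHat p R)ˣ) * (Φ.u j - Ψ.u j)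

theorem p_mul_logRatio (j : Fin d) : (p : RHat p R) * logRatio Φ Ψ j =
    (Φ.w j * (Ψ.w j)⁻¹ : (RHat p R)ˣ) - 1 := by
  have h1 := Φ.w_eq j
  have h2 := Ψ.w_eq j
  have h3 : (Ψ.w j : RHat p R) * ((Ψ.w j)⁻¹ : (RHat p R)ˣ) = 1 := Units.mul_inv _
  rw [logRatio, Units.val_mul]
  linear_combination (-((Ψ.w j)⁻¹ : (RHat p R)ˣ) : RHat p R) * (h1 - h2) - h3

/-- The element `(Φ(T_j) / Ψ(T_j) - 1) / p` for the logarithmic coordinates and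
`(Φ(T_j) - Ψ(T_j)) / p` for the others. -/
def ratio (s : ℕ) (j : Fin d) : RHat p R :=
  if (j : ℕ) < s then logRatio Φ Ψ j else Ψ.toRingHom (coord p k d R j) * logRatio Φ Ψ j

/-- The factor `Ψ (logDer j T_j)` is `Ψ(T_j)` or `1`, so the first-order Taylor term of `Φ(T_j)`
around `Ψ` has the same shape for both kinds of coordinates. -/
theorem p_mul_ratio (j : Fin d) : (p : RHat p R) * (Ψ.toRingHom (logDer p k d s R j
    (coord p k d R j)) * ratio Φ Ψ s j) =
    Φ.toRingHom (coord p k d R j) - Ψ.toRingHom (coord p k d R j) := by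
  have h1 := p_mul_logRatio Φ Ψ j
  have h3 : (Ψ.w j : RHat p R) * ((Ψ.w j)⁻¹ : (RHat p R)ˣ) = 1 := Units.mul_inv _
  have h2 : (p : RHat p R) * (Ψ.toRingHom (coord p k d R j) * logRatio Φ Ψ j) =
      Φ.toRingHom (coord p k d R j) - Ψ.toRingHom (coord p k d R j) := by
    rw [Φ.map_coord, Ψ.map_coord]
    rw [Units.val_mul] at h1
    linear_combination ((Ψ.w j : RHat p R) * coord p k d R j ^ p) * h1 +
      (Φ.w j * coord p k d R j ^ p : RHat p R) * h3
  rw [← h2, logDer_coord, if_pos rfl, ratio]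
  split_ifs with hj
  · ring
  · rw [map_one]; ring

theorem one_add_p_mul_ratio (j : Fin d) (hj : (j : ℕ) < s) : 1 + (p : RHat p R) * ratio Φ Ψ s j =
    (Φ.w j * (Ψ.w j)⁻¹ : (RHat p R)ˣ) := by
  rw [ratio, if_pos hj, p_mul_logRatio]; ring

theorem ratio_self (j : Fin d) : ratio Φ Φ s j = 0 := by
  simp [ratio, logRatio]

/-- The elements `ratio` satisfy the cocycle identity for the additive, respectively the
multiplicative, group law. -/
theorem ratio_trans (j : Fin d) : ratio Φ Ξ s j = ratio Φ Ψ s j + ratio Ψ Ξ s j +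
    (p * logStep d s j : ℕ) * (ratio Φ Ψ s j * ratio Ψ Ξ s j) := by
  have := isPIntegral_RHat p k d R
  refine natCast_mul_cancel p (Fact.out : p.Prime).ne_zero ?_
  by_cases hj : (j : ℕ) < s
  · have h1 := one_add_p_mul_ratio Φ Ψ j hj
    have h2 := one_add_p_mul_ratio Ψ Ξ j hj
    have h3 := one_add_p_mul_ratio Φ Ξ j hj
    have h4 : ((Φ.w j * (Ξ.w j)⁻¹ : (RHat p R)ˣ) : RHat p R) =
        (Φ.w j * (Ψ.w j)⁻¹ : (RHat p R)ˣ) * (Ψ.w j * (Ξ.w j)⁻¹ : (RHat p R)ˣ) := by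
      rw [← Units.val_mul]; congr 1; group
    rw [← h1, ← h2, ← h3] at h4
    simp only [logStep, if_pos hj]
    push_cast
    linear_combination h4
  · have h1 := p_mul_ratio (s := s) Φ Ψ j
    have h2 := p_mul_ratio (s := s) Ψ Ξ j
    have h3 := p_mul_ratio (s := s) Φ Ξ j
    rw [logDer_coord, if_pos rfl, if_neg hj, map_one, one_mul] at h1 h2 h3
    simp only [logStep, if_neg hj]
    push_cast
    linear_combination h3 - h1 - h2

/-- The derivative of `ratio`. -/
theorem logDer_ratio (j m : Fin d) : logDer p k d s R m (ratio Φ Ψ s j) =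
    (1 + (p * logStep d s j : ℕ) * ratio Φ Ψ s j) * (Φ.lam s j m - Ψ.lam s j m) := by
  have := isPIntegral_RHat p k d R
  refine natCast_mul_cancel p (Fact.out : p.Prime).ne_zero ?_
  have hnat : ∀ x : RHat p R, logDer p k d s R m ((p : RHat p R) * x) =
      (p : RHat p R) * logDer p k d s R m x := fun x => by
    rw [← nsmul_eq_mul, map_nsmul, nsmul_eq_mul]
  have hw : ∀ Φ : FrobLift p k d R, logDer p k d s R m (Φ.w j : RHat p R) =
      (p : RHat p R) * logDer p k d s R m (Φ.u j) := fun Φ => by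
    rw [Φ.w_eq, map_add, hnat, Derivation.map_one_eq_zero, zero_add]
  by_cases hj : (j : ℕ) < s
  -- Logarithmic coordinate: differentiate `(1 + p z) w_Ψ = w_Φ` and multiply by `w_Ψ⁻¹`.
  · have h1 := one_add_p_mul_ratio Φ Ψ j hj
    have h2 : (ratio Φ Ψ s j * p + 1) * (Ψ.w j : RHat p R) = Φ.w j := by
      rw [add_comm, mul_comm _ (p : RHat p R), h1, ← Units.val_mul]
      congr 1; group
    have h3 := congrArg (logDer p k d s R m) h2
    have h4 : (Ψ.w j : RHat p R) * ((Ψ.w j)⁻¹ : (RHat p R)ˣ) = 1 := Units.mul_inv _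
    have h5 : (Φ.w j : RHat p R) * ((Φ.w j)⁻¹ : (RHat p R)ˣ) = 1 := Units.mul_inv _
    rw [Derivation.leibniz, map_add, mul_comm (ratio Φ Ψ s j), hnat, hw, hw,
      Derivation.map_one_eq_zero, add_zero, smul_eq_mul, smul_eq_mul] at h3
    simp only [logStep, if_pos hj, lam]
    have h6 : (1 + (p : RHat p R) * ratio Φ Ψ s j) * ((Φ.w j)⁻¹ : (RHat p R)ˣ) =
        ((Ψ.w j)⁻¹ : (RHat p R)ˣ) := by
      rw [h1, ← Units.val_mul, mul_right_comm, mul_inv_cancel, one_mul]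
    push_cast
    linear_combination ((Ψ.w j)⁻¹ : (RHat p R)ˣ) * h3 -
      p * logDer p k d s R m (ratio Φ Ψ s j) * h4 - p * logDer p k d s R m (Φ.u j) * h6
  -- Plain coordinate: differentiate `p z = Φ(T_j) - Ψ(T_j)`.
  · have h1 := p_mul_ratio (s := s) Φ Ψ j
    rw [logDer_coord, if_pos rfl, if_neg hj, map_one, one_mul, Φ.map_coord, Ψ.map_coord] at h1
    have h3 := congrArg (logDer p k d s R m) h1
    rw [hnat, map_sub, Derivation.leibniz, Derivation.leibniz, Derivation.leibniz_pow, hw, hw,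
      logDer_coord, if_neg hj] at h3
    rw [h3]
    simp only [logStep, if_neg hj, lam, smul_eq_mul, nsmul_eq_mul]
    have h4 := Φ.w_eq j
    have h5 := Ψ.w_eq j
    by_cases hm : m = j
    · simp only [hm, if_true]
      push_cast
      ring
    · simp only [hm, if_false]
      push_cast
      ring

/-- The monomials in the elements `ratio`. -/
def ratioPow (s : ℕ) (I : Fin d → ℕ) : RHat p R := ∏ j, ratio Φ Ψ s j ^ I j

theorem ratioPow_add (I J : Fin d → ℕ) :
    ratioPow Φ Ψ s (I + J) = ratioPow Φ Ψ s I * ratioPow Φ Ψ s J := by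
  simp [ratioPow, pow_add, Finset.prod_mul_distrib]

theorem ratioPow_zero : ratioPow Φ Ψ s 0 = 1 := by simp [ratioPow]

theorem ratioPow_single (j : Fin d) : ratioPow Φ Ψ s (Pi.single j 1) = ratio Φ Ψ s j := by
  rw [ratioPow, Finset.prod_eq_single j]
  · simp
  · intro i _ hi; simp [hi]
  · simp

theorem ratioPow_self {I : Fin d → ℕ} (hI : I ≠ 0) : ratioPow Φ Φ s I = 0 := by
  obtain ⟨j, hj⟩ := Function.ne_iff.1 hI
  exact Finset.prod_eq_zero (Finset.mem_univ j) (by rw [ratio_self, zero_pow hj])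

theorem logDer_ratioPow (I : Fin d → ℕ) (m : Fin d) :
    logDer p k d s R m (ratioPow Φ Ψ s I) = ∑ j, (I j : RHat p R) *
      ratioPow Φ Ψ s (I - Pi.single j 1) * logDer p k d s R m (ratio Φ Ψ s j) := by
  rw [ratioPow, derivation_prod]
  refine Finset.sum_congr rfl fun j _ => ?_
  have h : ratioPow Φ Ψ s (I - Pi.single j 1) =
      ratio Φ Ψ s j ^ (I j - 1) * ∏ i ∈ Finset.univ.erase j, ratio Φ Ψ s i ^ I i := by
    refine (Finset.mul_prod_erase _ _ (Finset.mem_univ j)).symm.trans ?_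
    congr 1
    · simp
    · refine Finset.prod_congr rfl fun i hi => ?_
      simp [Finset.ne_of_mem_erase hi]
  rw [h, Derivation.leibniz_pow, smul_eq_mul, nsmul_eq_mul]
  ring

end FrobLift

end Ratio

/-! ### Rigidity of endomorphisms of the completed ring -/

section Uniqueness

variable {p : ℕ} [Fact p.Prime] {k : Type u} [Field k] [CharP k p] [PerfectRing k p]
  {d : ℕ} {R : Type v} [CommRing R]
  [Algebra (WittVector p k) R] [Algebra (MvPolynomial (Fin d) (WittVector p k)) R]
  [IsScalarTower (WittVector p k) (MvPolynomial (Fin d) (WittVector p k)) R]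
  [Algebra.Etale (MvPolynomial (Fin d) (WittVector p k)) R]

/-- As `k` is perfect, `c = [b] ^ (p ^ n) + p z` with a Teichmüller representative. Taking `p ^
n`-th powers improves a congruence modulo `p` to one modulo `p ^ (n + 1)`, and the induction
hypothesis treats `z`. -/
theorem pow_dvd_sub_of_wittVector {B : Type*} [CommRing B] (f g : WittVector p k →+* B)
    (h : ∀ c, (p : B) ∣ f c - g c) (n : ℕ) (c : WittVector p k) : (p : B) ^ n ∣ f c - g c := by
  induction n generalizing c with
  | zero => simp
  | succ n ih =>
    obtain ⟨b, hb⟩ := (iterateFrobeniusEquiv k p n).surjective (c.coeff 0)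
    have hb' : b ^ p ^ n = c.coeff 0 := hb
    have hx : c - WittVector.teichmuller p b ^ p ^ n ∈ Ideal.span {(p : WittVector p k)} := by
      rw [← WittVector.ker_constantCoeff, RingHom.mem_ker, map_sub, map_pow]
      simp [WittVector.constantCoeff_apply, hb']
    obtain ⟨z, hz⟩ := Ideal.mem_span_singleton'.1 hx
    have hc : c = WittVector.teichmuller p b ^ p ^ n + (p : WittVector p k) * z := by
      rw [mul_comm, hz]; ring
    have h1 := dvd_sub_pow_of_dvd_sub (h (WittVector.teichmuller p b)) n
    have h2 := mul_dvd_mul_left (p : B) (ih z)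
    rw [← pow_succ'] at h2
    have h3 := dvd_add h1 h2
    rw [hc, map_add, map_add, map_mul, map_mul, map_pow, map_pow, map_natCast, map_natCast]
    convert h3 using 1
    ring

/-- An endomorphism of `R̂` is determined by its reduction modulo `p` and its values on the
coordinates. -/
theorem ringHom_eq_of_dvd_sub (f g : RHat p R →+* RHat p R)
    (h : ∀ x, (p : RHat p R) ∣ f x - g x)
    (hT : ∀ j, f (coord p k d R j) = g (coord p k d R j)) : f = g := by
  have hsep : ∀ x : RHat p R, (∀ n : ℕ, (p : RHat p R) ^ n ∣ x) → x = 0 := fun x hx =>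
    eq_zero_of_pow_dvd hx
  have hW : ∀ c : WittVector p k,
      f (algebraMap _ (RHat p R) c) = g (algebraMap _ (RHat p R) c) := fun c =>
    sub_eq_zero.1 (hsep _ fun n => pow_dvd_sub_of_wittVector
      (f.comp (algebraMap _ (RHat p R))) (g.comp (algebraMap _ (RHat p R))) (fun c => h _) n c)
  have hS : ∀ F : MvPolynomial (Fin d) (WittVector p k),
      f (algebraMap R (RHat p R) (algebraMap _ R F)) =
        g (algebraMap R (RHat p R) (algebraMap _ R F)) := by
    intro F
    induction F using MvPolynomial.induction_on with
    | C c =>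
      have : algebraMap R (RHat p R) (algebraMap (MvPolynomial (Fin d) (WittVector p k)) R
          (MvPolynomial.C c)) =
          algebraMap (WittVector p k) (RHat p R) c := by
        rw [← MvPolynomial.algebraMap_eq, ← IsScalarTower.algebraMap_apply (WittVector p k)
          (MvPolynomial (Fin d) (WittVector p k)) R]; rfl
      rw [this, hW]
    | add F G hF hG => simp only [map_add, hF, hG]
    | mul_X F j hF =>
      have := hT j
      rw [coord] at this
      rw [map_mul, map_mul, map_mul, map_mul, hF, this]
  have hR : ∀ r : R, f (algebraMap R (RHat p R) r) = g (algebraMap R (RHat p R) r) := by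
    -- The target becomes an algebra over the polynomial ring through `f`, which equals `g` there.
    -- Two algebra maps out of an unramified algebra that agree modulo `p` coincide when the target
    -- is `p`-adically separated.
    let : CommRing (PhiMod f) := inferInstanceAs (CommRing (RHat p R))
    let : Algebra (MvPolynomial (Fin d) (WittVector p k)) (PhiMod f) :=
      ((f.comp (algebraMap R (RHat p R))).comp (algebraMap _ R)).toAlgebra
    let f' : R →ₐ[MvPolynomial (Fin d) (WittVector p k)] PhiMod f :=
      { f.comp (algebraMap R (RHat p R)) with commutes' := fun _ => rfl }
    let g' : R →ₐ[MvPolynomial (Fin d) (WittVector p k)] PhiMod f :=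
      { g.comp (algebraMap R (RHat p R)) with commutes' := fun F => (hS F).symm }
    have hfg : f' = g' := by
      refine Algebra.FormallyUnramified.ext_of_iInf (I := Ideal.span {(p : PhiMod f)}) ?_ fun r => ?_
      · refine (Submodule.eq_bot_iff _).2 fun x hx => hsep x fun n => ?_
        have := (Ideal.mem_iInf.1 hx) n
        rw [Ideal.span_singleton_pow] at this
        exact Ideal.mem_span_singleton.1 this
      · rw [Ideal.Quotient.eq, Ideal.mem_span_singleton]
        exact h (algebraMap R (RHat p R) r)
    exact fun r => DFunLike.congr_fun hfg r
  refine RingHom.ext fun x => sub_eq_zero.1 (hsep _ fun n => ?_)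
  obtain ⟨r, y, rfl⟩ := exists_eq_add x n
  refine ⟨f y - g y, ?_⟩
  simp only [map_add, map_mul, map_pow, map_natCast, hR]
  ring

end Uniqueness

/-! ### Taylor expansion of one Frobenius lift around another -/

section Taylor

variable {p : ℕ} [Fact p.Prime] {k : Type u} [Field k] [CharP k p] [PerfectRing k p]
  {d s : ℕ} {R : Type v} [CommRing R]
  [Algebra (WittVector p k) R] [Algebra (MvPolynomial (Fin d) (WittVector p k)) R]
  [IsScalarTower (WittVector p k) (MvPolynomial (Fin d) (WittVector p k)) R]
  [Algebra.Etale (MvPolynomial (Fin d) (WittVector p k)) R]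

theorem derEnd_commute (i j : Fin d) : derEnd p k d s R i * derEnd p k d s R j =
    derEnd p k d s R j * derEnd p k d s R i :=
  AddMonoidHom.ext fun r => logDer_commute i j r

theorem hasse_zero (hp : 2 < p) (r : RHat p R) : hasse p k d s R 0 r = r := by
  have := isPIntegral_RHat p k d R
  rw [hasse_apply, dividedCoef_zero hp (Nat.zero_le _), multiFalling_zero, one_mul]
  rfl

/-- All coefficients are `1`: the divided operators form a Hasse–Schmidt system, so their generating
series is multiplicative. -/
theorem hasse_mul (hp : 2 < p) (I : Fin d → ℕ) (r t : RHat p R) : hasse p k d s R I (r * t) =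
    ∑ JK ∈ multiAntidiagonal I, hasse p k d s R JK.1 r * hasse p k d s R JK.2 t := by
  have := isPIntegral_RHat p k d R
  have h := multiFalling_smul (derEnd p k d s R) (derEnd p k d s R) derEnd_commute derEnd_commute
    (fun j r t => ((logDer p k d s R j).leibniz r t).trans (by
      rw [smul_eq_mul, smul_eq_mul, smul_eq_mul, add_comm, mul_comm t]; rfl)) (logStep d s) I r t
  rw [smul_eq_mul] at h
  rw [hasse_apply, h, Finset.mul_sum]
  refine Finset.sum_congr rfl fun JK hJK => ?_
  obtain rfl := mem_multiAntidiagonal.1 hJK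
  have h1 := dividedCoef_add (A := RHat p R) hp (Nat.zero_le (p - 1)) JK.1 JK.2
  simp only [Nat.zero_min, Nat.sub_zero, pow_zero, mul_one] at h1
  rw [hasse_apply, hasse_apply, nsmul_eq_mul, smul_eq_mul]
  linear_combination (multiFalling (derEnd p k d s R) (logStep d s) JK.1 r *
    multiFalling (derEnd p k d s R) (logStep d s) JK.2 t) * h1

theorem hasse_one {I : Fin d → ℕ} (hI : I ≠ 0) : hasse p k d s R I 1 = 0 := by
  obtain ⟨j, hj⟩ := Function.ne_iff.1 hI
  rw [hasse_apply, multiFalling_apply_eq_zero _ _ derEnd_commute I 1 j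
    (Or.inl ⟨hj, (logDer p k d s R j).map_one_eq_zero⟩), mul_zero]

theorem hasse_single (hp : 2 < p) (j : Fin d) (r : RHat p R) :
    hasse p k d s R (Pi.single j 1) r = (p : RHat p R) * logDer p k d s R j r := by
  have := isPIntegral_RHat p k d R
  rw [hasse_apply, dividedCoef_single hp, multiFalling_single _ _ derEnd_commute]
  rfl

/-- Derivations in other directions kill `T_j`. In its own direction, `T_j` is an eigenvector with
value `1` if logarithmic, and is sent to `1` and then to `0` otherwise; in both cases the falling
factorial of length two vanishes, so the Taylor series of `T_j` is linear. -/
theorem hasse_coord (I : Fin d → ℕ) (j : Fin d) (h0 : I ≠ 0) (h1 : I ≠ Pi.single j 1) :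
    hasse p k d s R I (coord p k d R j) = 0 := by
  have h : ∃ i, (I i ≠ 0 ∧ i ≠ j) ∨ (2 ≤ I i ∧ i = j) := by
    by_contra! hne
    have h2 : ∀ i, i ≠ j → I i = 0 := fun i hi => by
      by_contra h3
      exact hi ((hne i).1 h3)
    have h3 : I j < 2 := not_le.1 fun h => (hne j).2 h rfl
    rcases Nat.lt_succ_iff_lt_or_eq.1 h3 with h3 | h3
    · refine h0 (funext fun i => ?_)
      by_cases hi : i = j
      · subst hi; simpa using h3
      · exact h2 i hi
    · refine h1 (funext fun i => ?_)
      by_cases hi : i = j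
      · subst hi; simpa using h3
      · rw [h2 i hi, Pi.single_eq_of_ne hi]
  obtain ⟨i, hi⟩ := h
  rw [hasse_apply, multiFalling_apply_eq_zero _ _ derEnd_commute I _ i, mul_zero]
  rcases hi with ⟨hi, hij⟩ | ⟨hi, rfl⟩
  · refine Or.inl ⟨hi, ?_⟩
    change logDer p k d s R i (coord p k d R j) = 0
    rw [logDer_coord, if_neg hij]
  · refine Or.inr ⟨hi, ?_⟩
    change logDer p k d s R i (logDer p k d s R i (coord p k d R i)) =
      logStep d s i • logDer p k d s R i (coord p k d R i)
    rw [logDer_coord, if_pos rfl, logStep]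
    split_ifs with hs
    · rw [logDer_coord, if_pos rfl, if_pos hs, one_smul]
    · rw [Derivation.map_one_eq_zero, zero_smul]

theorem isPAdicNull_map_hasse (hp : 2 < p) (Ψ : FrobLift p k d R) (r : RHat p R)
    (c : (Fin d → ℕ) → RHat p R) : IsPAdicNull (RHat p R) p fun I : Fin d → ℕ =>
      Ψ.toRingHom (hasse p k d s R I r) * c I := by
  have := isPIntegral_RHat p k d R
  have h := isPAdicNull_dividedCoef_smul (p := p) (A := RHat p R) hp (Nat.zero_le (p - 1))
    fun I : Fin d → ℕ =>
      Ψ.toRingHom (multiFalling (derEnd p k d s R) (logStep d s) I r) * c I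
  convert h using 2 with I
  have h1 := map_dividedCoef_smul (A := RHat p R) hp (Nat.zero_le (p - 1)) I
    (Ψ.toRingHom : RHat p R →+ RHat p R) (multiFalling (derEnd p k d s R) (logStep d s) I r)
  rw [hasse_apply, smul_eq_mul, ← mul_assoc]
  congr 1

/-- The Taylor expansion of `Φ` around `Ψ`. -/
theorem hasPAdicSum_hasse (hp : 2 < p) (s : ℕ) (Φ Ψ : FrobLift p k d R) (r : RHat p R) :
    HasPAdicSum (A := RHat p R) p (fun I : Fin d → ℕ =>
      Ψ.toRingHom (hasse p k d s R I r) * Φ.ratioPow Ψ s I) (Φ.toRingHom r) := by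
  have := isPIntegral_RHat p k d R
  have hnull := fun r => isPAdicNull_map_hasse (s := s) hp Ψ r (Φ.ratioPow Ψ s)
  choose L hL using fun r => (hnull r).exists_hasPAdicSum
  have hadd : ∀ r t, L (r + t) = L r + L t := fun r t => by
    refine (hL _).unique ?_
    convert (hL r).add (hL t) using 2 with I
    rw [map_add, map_add, add_mul]
  have hmul : ∀ r t, L (r * t) = L r * L t := fun r t => by
    refine (hL _).unique ?_
    have h1 := ((hL r).smul_prod (hL t) (hnull r) (hnull t)).fiberwise_finite
      (fun JK : (Fin d → ℕ) × (Fin d → ℕ) => JK.1 + JK.2) multiAntidiagonal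
      fun _ _ => mem_multiAntidiagonal
    rw [← smul_eq_mul (L r)]
    convert h1 using 2 with I
    rw [hasse_mul hp, map_sum, Finset.sum_mul]
    refine Finset.sum_congr rfl fun JK hJK => ?_
    obtain rfl := mem_multiAntidiagonal.1 hJK
    rw [map_mul, FrobLift.ratioPow_add, smul_eq_mul]
    ring
  have hone : L 1 = 1 := by
    refine (hL _).unique ?_
    have h1 := HasPAdicSum.of_finite (A := RHat p R) (p := p) (f := fun I : Fin d → ℕ =>
      Ψ.toRingHom (hasse p k d s R I 1) * Φ.ratioPow Ψ s I) {0} fun I hI => by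
        rw [hasse_one (by simpa using hI), map_zero, zero_mul]
    rwa [Finset.sum_singleton, hasse_zero hp, map_one, FrobLift.ratioPow_zero, one_mul] at h1
  let f : RHat p R →+* RHat p R :=
    { toFun := L
      map_one' := hone
      map_mul' := hmul
      map_add' := hadd
      map_zero' := by simpa using hadd 0 0 }
  -- The terms with `I ≠ 0` are divisible by `p`, so the series is congruent to `Ψ`, hence to `Φ`,
  -- modulo `p`; on `T_j` it ends after the linear term, with value `Φ(T_j)`.
  have hf : f = Φ.toRingHom := by
    refine ringHom_eq_of_dvd_sub (k := k) (d := d) f _ (fun x => ?_) fun j => ?_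
    · obtain ⟨S, hS⟩ := hL x 1
      -- The index `0` is adjoined so that the constant term is certain to be among the summands.
      obtain ⟨y, hy⟩ := mem_span_pow_smul_top.1 (hS (insert 0 S) (Finset.subset_insert _ _))
      obtain ⟨y1, hy1⟩ := Φ.lifts x
      obtain ⟨y2, hy2⟩ := Ψ.lifts x
      have h1 : (p : RHat p R) ∣ ∑ I ∈ (insert 0 S).erase 0,
          Ψ.toRingHom (hasse p k d s R I x) * Φ.ratioPow Ψ s I := by
        refine Finset.dvd_sum fun I hI => ?_
        obtain ⟨t, ht⟩ := exists_dividedCoef_eq_p_mul (A := RHat p R) hp (Finset.ne_of_mem_erase hI)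
        rw [hasse_apply, ht, map_mul, map_mul, map_natCast, mul_assoc, mul_assoc]
        exact dvd_mul_right _ _
      rw [← Finset.add_sum_erase _ _ (Finset.mem_insert_self 0 S), hasse_zero hp,
        FrobLift.ratioPow_zero, mul_one, nsmul_eq_mul, pow_one] at hy
      obtain ⟨z, hz⟩ := h1
      refine ⟨y + z + y2 - y1, ?_⟩
      change L x - _ = _
      linear_combination hy + hz + hy2 - hy1
    · refine (hL _).unique ?_
      have h1 := HasPAdicSum.of_finite (A := RHat p R) (p := p) (f := fun I : Fin d → ℕ =>
        Ψ.toRingHom (hasse p k d s R I (coord p k d R j)) * Φ.ratioPow Ψ s I)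
        {0, Pi.single j 1} fun I hI => by
          simp only [Finset.mem_insert, Finset.mem_singleton, not_or] at hI
          rw [hasse_coord I j hI.1 hI.2, map_zero, zero_mul]
      have h0 : (0 : Fin d → ℕ) ≠ Pi.single j 1 := fun h => by simpa using congrFun h j
      rw [Finset.sum_pair h0, hasse_zero hp, hasse_single hp, FrobLift.ratioPow_zero, mul_one,
        FrobLift.ratioPow_single, map_mul, map_natCast, mul_assoc, FrobLift.p_mul_ratio] at h1
      rwa [add_sub_cancel] at h1
  have := hL r
  rwa [show L r = Φ.toRingHom r from DFunLike.congr_fun hf r] at this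

end Taylor

theorem IsPAdicNull.map_family {A : Type v} [CommRing A] {p : ℕ} {M : Type w} [AddCommGroup M]
    [Module A M] {N ι : Type*} [AddCommGroup N] [Module A N] {f : ι → M} (hf : IsPAdicNull A p f)
    (g : ι → M →+ N) : IsPAdicNull A p fun i => g i (f i) := fun n => by
  obtain ⟨S, hS⟩ := hf n
  exact ⟨S, fun i hi => map_mem_span_pow_smul_top (g i) (hS i hi)⟩

/-! ### Maps out of a Frobenius base change -/

section BaseChange

variable {p : ℕ} [Fact p.Prime] {k : Type u} [Field k]
  {d : ℕ} {R : Type v} [CommRing R]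
  [Algebra (WittVector p k) R] [Algebra (MvPolynomial (Fin d) (WittVector p k)) R]
  {Φ : FrobLift p k d R} {M : Type w} [AddCommGroup M] [Module (RHat p R) M]

namespace FrobBC

variable (Φ) in
/-- `x ↦ x ⊗_Φ r`. -/
def tmulLeft (r : RHat p R) : M →+ FrobBC Φ M :=
  AddMonoidHom.mk' (fun x => FrobBC.tmul Φ x r) fun _ _ => FrobBC.tmul_add _ _ _

variable (Φ) in
/-- `r ↦ x ⊗_Φ r`. -/
def tmulRight (x : M) : RHat p R →+ FrobBC Φ M :=
  AddMonoidHom.mk' (FrobBC.tmul Φ x) fun _ _ => FrobBC.tmul_add' _ _ _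

theorem nsmul_tmul (n : ℕ) (x : M) (r : RHat p R) :
    FrobBC.tmul Φ (n • x) r = FrobBC.tmul Φ x (n * r) := by
  rw [← Nat.cast_smul_eq_nsmul (RHat p R), FrobBC.tmul_smul, map_natCast]

theorem sum_tmul {ι : Type*} (S : Finset ι) (f : ι → M) (r : RHat p R) :
    FrobBC.tmul Φ (∑ i ∈ S, f i) r = ∑ i ∈ S, FrobBC.tmul Φ (f i) r :=
  map_sum (tmulLeft Φ r) _ _

theorem tmul_sum {ι : Type*} (S : Finset ι) (x : M) (r : ι → RHat p R) :
    FrobBC.tmul Φ x (∑ i ∈ S, r i) = ∑ i ∈ S, FrobBC.tmul Φ x (r i) :=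
  map_sum (tmulRight Φ x) _ _

theorem smul_tmul_one (x : M) (r : RHat p R) : r • FrobBC.tmul Φ x 1 = FrobBC.tmul Φ x r := by
  rw [FrobBC.smul_tmul, mul_one]

theorem induction {P : FrobBC Φ M → Prop} (h0 : P 0)
    (ht : ∀ (r : RHat p R) (x : M), P (r • FrobBC.tmul Φ x 1))
    (hadd : ∀ y z, P y → P z → P (y + z)) (y : FrobBC Φ M) : P y := by
  refine TensorProduct.induction_on (motive := P) y h0 (fun (r : RHat p R) x => ?_) hadd
  have := ht r x
  rwa [smul_tmul_one] at this

variable {N : Type*} [AddCommGroup N] [Module (RHat p R) N]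

/-- The linear map on `M ⊗_Φ R̂` induced by a `Φ`-semilinear map. -/
def lift (θ : M →+ N) (hθ : ∀ (a : RHat p R) (x : M), θ (a • x) = Φ.toRingHom a • θ x) :
    FrobBC Φ M →ₗ[RHat p R] N :=
  let f : FrobBC Φ M →+ N := TensorProduct.liftAddHom (R := RHat p R) (M := FrobTwist Φ) (N := M)
    { toFun := fun (r : RHat p R) => (DistribSMul.toAddMonoidHom N r).comp θ
      map_zero' := AddMonoidHom.ext fun x => zero_smul (RHat p R) (θ x)
      map_add' := fun (r t : RHat p R) => AddMonoidHom.ext fun x => add_smul r t (θ x) }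
    (fun a (r : RHat p R) x => by
      change (Φ.toRingHom a * r) • θ x = r • θ (a • x)
      rw [hθ, smul_smul, mul_comm])
  { f with
    map_smul' := fun a y => by
      change f (a • y) = a • f y
      induction y using FrobBC.induction with
      | h0 => simp
      | ht r x => rw [smul_smul]; exact mul_smul (a * r) 1 (θ x) |>.trans (by
          rw [mul_smul]; congr 1; exact (mul_smul r 1 (θ x)).symm)
      | hadd y z hy hz => rw [smul_add, map_add, map_add, hy, hz, smul_add] }

theorem linearMap_ext {f g : FrobBC Φ M →ₗ[RHat p R] N}
    (h : ∀ x, f (FrobBC.tmul Φ x 1) = g (FrobBC.tmul Φ x 1)) : f = g :=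
  LinearMap.ext fun y => by
    induction y using FrobBC.induction with
    | h0 => rw [map_zero, map_zero]
    | ht r x => rw [map_smul, map_smul, h]
    | hadd y z hy hz => rw [map_add, map_add, hy, hz]

theorem finite [Module.Finite (RHat p R) M] : Module.Finite (RHat p R) (FrobBC Φ M) :=
  inferInstanceAs (Module.Finite (FrobTwist Φ) (FrobTwist Φ ⊗[RHat p R] M))

end FrobBC

end BaseChange

/-! ### The comparison map and its semilinearity -/

section Alpha

variable {p : ℕ} [Fact p.Prime] {k : Type u} [Field k] [CharP k p] [PerfectRing k p]
  {d s : ℕ} {R : Type v} [CommRing R]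
  [Algebra (WittVector p k) R] [Algebra (MvPolynomial (Fin d) (WittVector p k)) R]
  [IsScalarTower (WittVector p k) (MvPolynomial (Fin d) (WittVector p k)) R]
  [Algebra.Etale (MvPolynomial (Fin d) (WittVector p k)) R]
  {a b : ℤ}

namespace FilDeRham

variable (X : FilDeRham.{u, v, w} p k d s R a b)

/-- The filtration steps are finitely generated because `R̂` is noetherian. -/
theorem finite_tilde : Module.Finite (RHat p R) X.Tilde := by
  have := isNoetherianRing_RHat_of_etale p k d R
  have := X.finite
  have : Module.Finite (RHat p R) X.FilSum :=
    Module.Finite.equiv (DirectSum.linearEquivFunOnFintype (RHat p R) (Set.Icc a b)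
      fun i : Set.Icc a b => X.Fil i).symm
  infer_instance

theorem isHausdorff_frobBC (Ψ : FrobLift p k d R) :
    IsHausdorff (Ideal.span {(p : RHat p R)}) (FrobBC Ψ X.Tilde) :=
  have := isNoetherianRing_RHat_of_etale p k d R
  have := X.finite_tilde
  have := FrobBC.finite (Φ := Ψ) (M := X.Tilde)
  isHausdorff_of_finite _

theorem isPrecomplete_frobBC (Ψ : FrobLift p k d R) :
    IsPrecomplete (Ideal.span {(p : RHat p R)}) (FrobBC Ψ X.Tilde) :=
  have := X.finite_tilde
  have := FrobBC.finite (Φ := Ψ) (M := X.Tilde)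
  isPrecomplete_of_finite _

variable (hp : 2 < p) (hba : b - a ≤ (p : ℤ) - 1)

/-- The threshold on `|I|` is independent of `x` and of the filtration index, so it yields null
families over multi-indices and over triples of them. -/
theorem hasseTilde_mem {n : ℕ} {I : Fin d → ℕ} (hI : 2 * (n + p) ≤ weight I) (x : X.Tilde) :
    X.hasseTilde hp hba I x ∈
      (Ideal.span {(p : RHat p R)}) ^ n • (⊤ : Submodule (RHat p R) X.Tilde) := by
  have := isPIntegral_RHat p k d R
  induction x using X.tilde_induction
  case h0 i v hv =>
    obtain ⟨t, ht⟩ := exists_dividedCoef_eq (A := RHat p R) hp (height_le hp hba i) I hI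
    rw [hasseTilde_br, ht]
    exact mul_smul_mem_span_pow_smul_top _ _
  case hadd x y hx hy => rw [map_add]; exact add_mem hx hy
  case hz => rw [map_zero]; exact zero_mem _

theorem isPAdicNull_hasseTilde (x : X.Tilde) :
    IsPAdicNull (RHat p R) p fun I : Fin d → ℕ => X.hasseTilde hp hba I x := fun n =>
  ⟨(finite_weight_lt (2 * (n + p))).toFinset, fun I hI =>
    X.hasseTilde_mem hp hba (by simpa using hI) x⟩

theorem isPAdicNull_tmul_hasseTilde (Ψ : FrobLift p k d R) (x : X.Tilde)
    (c : (Fin d → ℕ) → RHat p R) : IsPAdicNull (RHat p R) p fun I : Fin d → ℕ =>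
      FrobBC.tmul Ψ (X.hasseTilde hp hba I x) (c I) :=
  (X.isPAdicNull_hasseTilde hp hba x).map_family fun I => FrobBC.tmulLeft Ψ (c I)

theorem exists_hasPAdicSum_tmul_hasseTilde (Ψ : FrobLift p k d R) (x : X.Tilde)
    (c : (Fin d → ℕ) → RHat p R) : ∃ y, HasPAdicSum (A := RHat p R) p
      (fun I : Fin d → ℕ => FrobBC.tmul Ψ (X.hasseTilde hp hba I x) (c I)) y :=
  have := X.isPrecomplete_frobBC Ψ
  (X.isPAdicNull_tmul_hasseTilde hp hba Ψ x c).exists_hasPAdicSum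

variable (Φ Ψ Ξ : FrobLift p k d R)

/-- The `Φ`-semilinear map `x ↦ ∑_I E_I x ⊗_Ψ z ^ I`, where the `E_I` are the divided operators. -/
def transport : X.Tilde →+ FrobBC Ψ X.Tilde :=
  AddMonoidHom.mk' (fun x =>
      (X.exists_hasPAdicSum_tmul_hasseTilde hp hba Ψ x (Φ.ratioPow Ψ s)).choose) fun x y => by
    have := X.isHausdorff_frobBC Ψ
    have h := fun x =>
      (X.exists_hasPAdicSum_tmul_hasseTilde hp hba Ψ x (Φ.ratioPow Ψ s)).choose_spec
    refine (h (x + y)).unique ?_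
    convert (h x).add (h y) using 2 with I
    rw [map_add, FrobBC.tmul_add]

theorem hasPAdicSum_transport (x : X.Tilde) : HasPAdicSum (A := RHat p R) p
    (fun I : Fin d → ℕ => FrobBC.tmul Ψ (X.hasseTilde hp hba I x) (Φ.ratioPow Ψ s I))
    (X.transport hp hba Φ Ψ x) :=
  (X.exists_hasPAdicSum_tmul_hasseTilde hp hba Ψ x (Φ.ratioPow Ψ s)).choose_spec

/-- The Leibniz rule for `E_I` exhibits the series of `r • x` as the Cauchy product of the Taylor
series of `Φ(r)` around `Ψ` with the series of `x`. -/
theorem transport_smul (r : RHat p R) (x : X.Tilde) :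
    X.transport hp hba Φ Ψ (r • x) = Φ.toRingHom r • X.transport hp hba Φ Ψ x := by
  have := X.isHausdorff_frobBC Ψ
  have := X.isPrecomplete_frobBC Ψ
  refine (X.hasPAdicSum_transport hp hba Φ Ψ (r • x)).unique ?_
  have h1 := ((hasPAdicSum_hasse hp s Φ Ψ r).smul_prod (X.hasPAdicSum_transport hp hba Φ Ψ x)
    (isPAdicNull_map_hasse hp Ψ r _) (X.isPAdicNull_tmul_hasseTilde hp hba Ψ x _)).fiberwise_finite
    (fun JK : (Fin d → ℕ) × (Fin d → ℕ) => JK.1 + JK.2) multiAntidiagonal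
    fun _ _ => mem_multiAntidiagonal
  convert h1 using 2 with I
  rw [hasseTilde_smul, FrobBC.sum_tmul]
  refine Finset.sum_congr rfl fun JK hJK => ?_
  obtain rfl := mem_multiAntidiagonal.1 hJK
  rw [FrobBC.tmul_smul, FrobBC.smul_tmul, FrobLift.ratioPow_add, mul_assoc]

/-- The comparison map `Ṽ ⊗_Φ R̂ → Ṽ ⊗_Ψ R̂`. -/
def compare : FrobBC Φ X.Tilde →ₗ[RHat p R] FrobBC Ψ X.Tilde :=
  FrobBC.lift (X.transport hp hba Φ Ψ) (X.transport_smul hp hba Φ Ψ)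

theorem compare_tmul (x : X.Tilde) (r : RHat p R) :
    X.compare hp hba Φ Ψ (FrobBC.tmul Φ x r) = r • X.transport hp hba Φ Ψ x := rfl

theorem transport_self (x : X.Tilde) : X.transport hp hba Φ Φ x = FrobBC.tmul Φ x 1 := by
  have := X.isHausdorff_frobBC Φ
  refine (X.hasPAdicSum_transport hp hba Φ Φ x).unique ?_
  have h := HasPAdicSum.of_finite (A := RHat p R) (p := p) (f := fun I : Fin d → ℕ =>
    FrobBC.tmul Φ (X.hasseTilde hp hba I x) (Φ.ratioPow Φ s I)) {0} fun I hI => by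
      rw [FrobLift.ratioPow_self Φ (by simpa using hI), FrobBC.zero_tmul]
  rwa [Finset.sum_singleton, hasseTilde_zero, FrobLift.ratioPow_zero] at h

theorem compare_self : X.compare hp hba Φ Φ = LinearMap.id :=
  FrobBC.linearMap_ext fun x => by
    rw [compare_tmul, one_smul, transport_self, LinearMap.id_apply]

end FilDeRham

end Alpha

/-! ### The cocycle identity -/

section Cocycle

/-- The expansion of a power of the sum for a formal group law of degree two. -/
theorem groupLaw_pow {A : Type*} [CommRing A] (q : ℕ) (y z : A) (n : ℕ) :
    (y + z + q * (y * z)) ^ n = ∑ am ∈ Finset.HasAntidiagonal.antidiagonal n,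
      ∑ bc ∈ Finset.HasAntidiagonal.antidiagonal am.2,
        ((FilDeRham.trinomial bc.1 am.1 bc.2 * q ^ bc.2 : ℕ) : A) *
          (y ^ (am.1 + bc.2) * z ^ (bc.1 + bc.2)) := by
  rw [show y + z + q * (y * z) = y + z * (1 + q * y) by ring, (Commute.all _ _).add_pow']
  refine Finset.sum_congr rfl fun am ham => ?_
  rw [mul_pow, (Commute.all _ _).add_pow', Finset.mul_sum, Finset.mul_sum, Finset.smul_sum]
  refine Finset.sum_congr rfl fun bc hbc => ?_
  rw [← Finset.HasAntidiagonal.mem_antidiagonal.1 ham,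
    ← Finset.HasAntidiagonal.mem_antidiagonal.1 hbc, FilDeRham.trinomial,
    show bc.1 + am.1 + bc.2 = am.1 + (bc.1 + bc.2) by ring, ← Nat.choose_symm_add (b := bc.2)]
  simp only [nsmul_eq_mul, one_pow, mul_pow]
  push_cast
  ring

variable {p : ℕ} [Fact p.Prime] {k : Type u} [Field k] [CharP k p] [PerfectRing k p]
  {d s : ℕ} {R : Type v} [CommRing R]
  [Algebra (WittVector p k) R] [Algebra (MvPolynomial (Fin d) (WittVector p k)) R]
  [IsScalarTower (WittVector p k) (MvPolynomial (Fin d) (WittVector p k)) R]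
  [Algebra.Etale (MvPolynomial (Fin d) (WittVector p k)) R]
  {a b : ℤ}

/-- The coefficients in the expansion of a power of the composite of two group elements. -/
def cocycleCoef (p : ℕ) (s : ℕ) (A B C : Fin d → ℕ) : ℕ :=
  ∏ j, (FilDeRham.trinomial (B j) (A j) (C j) * (p * logStep d s j) ^ C j)

/-- In each coordinate the power of `y + z + p e_j y z` is expanded; the multi-indices `A`, `B`, `C`
count how often the three summands are chosen. -/
theorem FrobLift.ratioPow_trans (Φ Ψ Ξ : FrobLift p k d R) (K : Fin d → ℕ) :
    ratioPow Φ Ξ s K = ∑ AM ∈ multiAntidiagonal K, ∑ BC ∈ multiAntidiagonal AM.2,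
      (cocycleCoef p s AM.1 BC.1 BC.2 : RHat p R) *
        (ratioPow Φ Ψ s (AM.1 + BC.2) * ratioPow Ψ Ξ s (BC.1 + BC.2)) := by
  have h := prod_sum_antidiagonal K fun j α m =>
    ∑ bc ∈ Finset.HasAntidiagonal.antidiagonal m,
      ((FilDeRham.trinomial bc.1 α bc.2 * (p * logStep d s j) ^ bc.2 : ℕ) : RHat p R) *
        (ratio Φ Ψ s j ^ (α + bc.2) * ratio Ψ Ξ s j ^ (bc.1 + bc.2))
  simp only [← groupLaw_pow, ← ratio_trans] at h
  refine h.trans (Finset.sum_congr rfl fun AM _ => ?_)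
  have h2 := prod_sum_antidiagonal AM.2 fun j β γ =>
    ((FilDeRham.trinomial β (AM.1 j) γ * (p * logStep d s j) ^ γ : ℕ) : RHat p R) *
        (ratio Φ Ψ s j ^ (AM.1 j + γ) * ratio Ψ Ξ s j ^ (β + γ))
  refine h2.trans (Finset.sum_congr rfl fun BC _ => ?_)
  simp only [cocycleCoef, ratioPow, Nat.cast_prod, ← Finset.prod_mul_distrib, Pi.add_apply]

namespace FilDeRham

variable (X : FilDeRham.{u, v, w} p k d s R a b) (hp : 2 < p) (hba : b - a ≤ (p : ℤ) - 1)
  (Φ Ψ Ξ : FrobLift p k d R)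

/-- The common refinement of the two expansions in the cocycle identity. -/
def cocycleTerm (x : X.Tilde) (T : (Fin d → ℕ) × (Fin d → ℕ) × (Fin d → ℕ)) : FrobBC Ξ X.Tilde :=
  FrobBC.tmul Ξ (X.hasseTilde hp hba (T.1 + (T.2.1 + T.2.2)) x)
    ((cocycleCoef p s T.1 T.2.1 T.2.2 : RHat p R) *
      (Φ.ratioPow Ψ s (T.1 + T.2.2) * Ψ.ratioPow Ξ s (T.2.1 + T.2.2)))

theorem isPAdicNull_cocycleTerm (x : X.Tilde) :
    IsPAdicNull (RHat p R) p (X.cocycleTerm hp hba Φ Ψ Ξ x) := fun n => by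
  have hS := finite_weight_lt (d := d) (2 * (n + p))
  refine ⟨hS.toFinset ×ˢ hS.toFinset ×ˢ hS.toFinset, fun T hT => ?_⟩
  refine map_mem_span_pow_smul_top (FrobBC.tmulLeft Ξ _) (X.hasseTilde_mem hp hba ?_ x)
  simp only [Finset.mem_product, Set.Finite.mem_toFinset, Set.mem_ofPred_eq] at hT
  rw [weight_add, weight_add]
  omega

/-- One of the two expansions in the cocycle identity. -/
theorem sum_cocycleTerm (x : X.Tilde) (K : Fin d → ℕ) :
    ∑ AM ∈ multiAntidiagonal K, ∑ BC ∈ multiAntidiagonal AM.2,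
      X.cocycleTerm hp hba Φ Ψ Ξ x (AM.1, BC) =
      FrobBC.tmul Ξ (X.hasseTilde hp hba K x) (Φ.ratioPow Ξ s K) := by
  rw [Φ.ratioPow_trans Ψ Ξ, FrobBC.tmul_sum]
  refine Finset.sum_congr rfl fun AM hAM => ?_
  rw [FrobBC.tmul_sum]
  refine Finset.sum_congr rfl fun BC hBC => ?_
  rw [cocycleTerm, mem_multiAntidiagonal.1 hBC, mem_multiAntidiagonal.1 hAM]

/-- The other expansion in the cocycle identity. -/
theorem sum_cocycleTerm_image (x : X.Tilde) (I J : Fin d → ℕ) :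
    ∑ T ∈ (Finset.Iic (J ⊓ I)).image (fun c => (I - c, J - c, c)),
      X.cocycleTerm hp hba Φ Ψ Ξ x T =
      FrobBC.tmul Ξ (X.hasseTilde hp hba J (X.hasseTilde hp hba I x))
        (Φ.ratioPow Ψ s I * Ψ.ratioPow Ξ s J) := by
  rw [Finset.sum_image fun c _ c' _ h => congrArg (fun T => T.2.2) h, hasseTilde_hasseTilde,
    FrobBC.sum_tmul]
  refine Finset.sum_congr rfl fun c hc => ?_
  have hc := Finset.mem_Iic.1 hc
  have hI : I - c + c = I := tsub_add_cancel_of_le (hc.trans inf_le_right)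
  have hJ : J - c + c = J := tsub_add_cancel_of_le (hc.trans inf_le_left)
  have h1 : I - c + (J - c + c) = J + I - c := by
    rw [hJ, add_comm, add_tsub_assoc_of_le (hc.trans inf_le_right)]
  simp only [cocycleTerm]
  rw [h1, hI, hJ, FrobBC.nsmul_tmul]
  rfl

/-- Both sides are sums of one null family over triples `(A, B, C)`. Grouping by `A + B + C` gives
the direct map, by the group law of the increments; grouping by `(A + C, B + C)` gives the
composite, by the product formula for the divided operators. -/
theorem compare_transport (x : X.Tilde) :
    X.compare hp hba Ψ Ξ (X.transport hp hba Φ Ψ x) = X.transport hp hba Φ Ξ x := by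
  classical
  have := X.isHausdorff_frobBC Ξ
  have := X.isPrecomplete_frobBC Ξ
  obtain ⟨y, hy⟩ := (X.isPAdicNull_cocycleTerm hp hba Φ Ψ Ξ x).exists_hasPAdicSum
  have h1 := (hy.fiberwise_finite
    (fun T : (Fin d → ℕ) × (Fin d → ℕ) × (Fin d → ℕ) => (T.1, T.2.1 + T.2.2))
    (fun AM => {AM.1} ×ˢ multiAntidiagonal AM.2) fun AM T => by
      rw [Finset.mem_product, Finset.mem_singleton, mem_multiAntidiagonal, Prod.ext_iff]).fiberwise_finite
    (fun AM : (Fin d → ℕ) × (Fin d → ℕ) => AM.1 + AM.2) multiAntidiagonal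
    fun _ _ => mem_multiAntidiagonal
  simp only [Finset.sum_product, Finset.sum_singleton, sum_cocycleTerm] at h1
  have h2 := hy.fiberwise_finite
    (fun T : (Fin d → ℕ) × (Fin d → ℕ) × (Fin d → ℕ) => (T.1 + T.2.2, T.2.1 + T.2.2))
    (fun IJ => (Finset.Iic (IJ.2 ⊓ IJ.1)).image (fun c => (IJ.1 - c, IJ.2 - c, c))) fun IJ T => by
      rw [Finset.mem_image]
      constructor
      · rintro ⟨c, hc, rfl⟩
        have hc := Finset.mem_Iic.1 hc
        exact Prod.ext (tsub_add_cancel_of_le (hc.trans inf_le_right))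
          (tsub_add_cancel_of_le (hc.trans inf_le_left))
      · rintro rfl
        exact ⟨T.2.2, Finset.mem_Iic.2 (le_inf le_add_self le_add_self),
          Prod.ext (add_tsub_cancel_right _ _) (Prod.ext (add_tsub_cancel_right _ _) rfl)⟩
  simp only [sum_cocycleTerm_image] at h2
  have h3 := h2.prod_fiberwise fun I =>
    ((X.hasPAdicSum_transport hp hba Ψ Ξ (X.hasseTilde hp hba I x)).map
      (DistribSMul.toAddMonoidHom (FrobBC Ξ X.Tilde) (Φ.ratioPow Ψ s I)))
  have h4 := (X.hasPAdicSum_transport hp hba Φ Ψ x).map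
    (X.compare hp hba Ψ Ξ).toAddMonoidHom
  exact (h4.unique h3).trans (h1.unique (X.hasPAdicSum_transport hp hba Φ Ξ x))

theorem compare_comp_compare :
    (X.compare hp hba Ψ Ξ).comp (X.compare hp hba Φ Ψ) = X.compare hp hba Φ Ξ :=
  FrobBC.linearMap_ext fun x => by
    rw [LinearMap.comp_apply, compare_tmul, compare_tmul, one_smul, one_smul, compare_transport]

/-- The comparison isomorphism `Ṽ ⊗_Φ R̂ ≃ Ṽ ⊗_Ψ R̂`. -/
def compareEquiv : FrobBC Φ X.Tilde ≃ₗ[RHat p R] FrobBC Ψ X.Tilde :=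
  LinearEquiv.ofLinearMap (X.compare hp hba Φ Ψ) (X.compare hp hba Ψ Φ)
    ((X.compare_comp_compare hp hba Ψ Φ Ψ).trans (X.compare_self hp hba Ψ))
    ((X.compare_comp_compare hp hba Φ Ψ Φ).trans (X.compare_self hp hba Φ))

end FilDeRham

end Cocycle

/-! ### Compatibility with the connections and naturality -/

section Parallel

variable {p : ℕ} [Fact p.Prime] {k : Type u} [Field k] [CharP k p] [PerfectRing k p]
  {d s : ℕ} {R : Type v} [CommRing R]
  [Algebra (WittVector p k) R] [Algebra (MvPolynomial (Fin d) (WittVector p k)) R]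
  [IsScalarTower (WittVector p k) (MvPolynomial (Fin d) (WittVector p k)) R]
  [Algebra.Etale (MvPolynomial (Fin d) (WittVector p k)) R]
  {a b : ℤ}

namespace FilDeRham

variable (X : FilDeRham.{u, v, w} p k d s R a b) (hp : 2 < p) (hba : b - a ≤ (p : ℤ) - 1)
  (Φ Ψ : FrobLift p k d R)

theorem pullConn_smul (m : Fin d) (r : RHat p R) (y : FrobBC Φ X.Tilde) :
    X.pullConn Φ m (r • y) = r • X.pullConn Φ m y + logDer p k d s R m r • y := by
  induction y using FrobBC.induction with
  | h0 => simp
  | ht t x =>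
    rw [smul_smul, FrobBC.smul_tmul_one, FrobBC.smul_tmul_one, pullConn_tmul, pullConn_tmul,
      smul_add, smul_smul, FrobBC.smul_tmul, FrobBC.smul_tmul, Derivation.leibniz,
      FrobBC.tmul_add', add_assoc, smul_eq_mul, smul_eq_mul, mul_comm t]
  | hadd y z hy hz => rw [smul_add, map_add, map_add, hy, hz, smul_add, smul_add]; abel

/-- The connection in terms of the divided operators of weight one. -/
theorem brPred_nabla (i : Set.Icc a b) (j : Fin d) (v : X.V) (hv : v ∈ X.Fil i) :
    X.brPred i ⟨X.nabla j v, X.griffiths i j v hv⟩ =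
      X.hasseTilde hp hba (Pi.single j 1) (X.br i ⟨v, hv⟩) := by
  have := isPIntegral_RHat p k d R
  rw [brPred_apply, hasseTilde_br]
  have h1 := dividedCoef_spec (A := RHat p R) hp (height_le hp hba i) (Pi.single j 1 : Fin d → ℕ)
  have h2 : multiFactorial (Pi.single j 1 : Fin d → ℕ) = 1 := by
    simpa [multiFactorial] using multiFactorial_add_single (0 : Fin d → ℕ) j
  have h3 := coe_eq_add_height i
  rw [h2, Nat.cast_one, one_mul, weight_single] at h1
  congr 1
  · rw [h1]
    split_ifs with h
    -- At `i = a` the weight-one coefficient is `p`, in agreement with the convention `[x]_{a-1} = p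
    -- [x]_a`; for `i > a` it is `1`.
    · rw [show height i = 0 by omega]; simp
    · rw [show 1 - min (height i) 1 = 0 by omega, pow_zero]
  · exact X.br_congr' (by rw [weight_single]) (X.mixed_single j v).symm _ _

theorem preConnTilde_eq (m : Fin d) (x : X.Tilde) : X.preConnTilde Φ m x =
    ∑ j, FrobBC.tmul Φ (X.hasseTilde hp hba (Pi.single j 1) x) (Φ.lam s j m) := by
  refine DFunLike.congr_fun (X.addHom_ext (f := X.preConnTilde Φ m)
    (g := ∑ j, (FrobBC.tmulLeft Φ (Φ.lam s j m)).comp (X.hasseTilde hp hba (Pi.single j 1)))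
    fun i v hv => ?_) x |>.trans (by rw [AddMonoidHom.finsetSum_apply]; rfl)
  rw [AddMonoidHom.finsetSum_apply, preConnTilde_br]
  refine Finset.sum_congr rfl fun j _ => ?_
  exact congrArg (fun y => FrobBC.tmul Φ y (Φ.lam s j m)) (X.brPred_nabla hp hba i j v hv)

/-- The derivative of the sum that defines `transport` with respect to `ratio j`. -/
theorem exists_transport_deriv (j : Fin d) (x : X.Tilde) : ∃ y : FrobBC Ψ X.Tilde,
    HasPAdicSum (A := RHat p R) p (fun I : Fin d → ℕ => FrobBC.tmul Ψ (X.hasseTilde hp hba I x)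
      (I j * Φ.ratioPow Ψ s (I - Pi.single j 1))) y ∧
    X.transport hp hba Φ Ψ (X.hasseTilde hp hba (Pi.single j 1) x) =
      (1 + (p * logStep d s j : ℕ) * Φ.ratio Ψ s j) • y := by
  have := X.isHausdorff_frobBC Ψ
  obtain ⟨y, hy⟩ := X.exists_hasPAdicSum_tmul_hasseTilde hp hba Ψ x
    fun I => (I j * Φ.ratioPow Ψ s (I - Pi.single j 1) : RHat p R)
  refine ⟨y, hy, ?_⟩
  -- The terms with `I_j = 0` vanish, so the derived series may be reindexed by raising `I_j` by
  -- one.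
  have h1 := hy.comp_injective (fun I => I + Pi.single j 1) (add_left_injective _) fun I hI => by
    have h2 : I j = 0 := by
      by_contra h
      refine hI ⟨I - Pi.single j 1, tsub_add_cancel_of_le fun i => ?_⟩
      by_cases hi : i = j
      · subst hi; simpa using Nat.one_le_iff_ne_zero.2 h
      · simp [hi]
    rw [h2, Nat.cast_zero, zero_mul, FrobBC.zero_tmul]
  have h2 := hy.map (DistribSMul.toAddMonoidHom (FrobBC Ψ X.Tilde)
    ((p * logStep d s j : ℕ) * Φ.ratio Ψ s j))
  rw [add_smul, one_smul]
  refine (X.hasPAdicSum_transport hp hba Φ Ψ _).unique ?_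
  convert h1.add h2 using 2 with I
  · rw [hasseTilde_hasseTilde_single, FrobBC.tmul_add, FrobBC.nsmul_tmul, FrobBC.nsmul_tmul,
      add_tsub_cancel_right]
    congr 1
    · simp
    · refine Eq.trans ?_ (FrobBC.smul_tmul (Φ := Ψ) _ _ _).symm
      by_cases h : I j = 0
      · simp [h]
      · congr 1
        have h3 : I - Pi.single j 1 + Pi.single j 1 = I := tsub_add_cancel_of_le fun i => by
          by_cases hi : i = j
          · subst hi; simpa using Nat.one_le_iff_ne_zero.2 h
          · simp [hi]
        have h4 := Φ.ratioPow_add Ψ (s := s) (I - Pi.single j 1) (Pi.single j 1)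
        rw [h3, FrobLift.ratioPow_single] at h4
        rw [h4]
        push_cast
        ring
  · rfl

/-- Write `τ` for `transport` and `y_j` for the derivative of its series with respect to `z_j`.
Termwise differentiation gives `∑ⱼ (λ^Ψ_{jm} τ(E_j x) + logDer_m(z_j) y_j)`. As `τ(E_j x) = (1 + p
e_j z_j) y_j`, the second summand is `(λ^Φ_{jm} - λ^Ψ_{jm}) τ(E_j x)`, and `λ^Ψ` cancels. -/
theorem pullConn_transport (m : Fin d) (x : X.Tilde) :
    X.pullConn Ψ m (X.transport hp hba Φ Ψ x) =
      ∑ j, Φ.lam s j m • X.transport hp hba Φ Ψ (X.hasseTilde hp hba (Pi.single j 1) x) := by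
  have := X.isHausdorff_frobBC Ψ
  choose y hy hy' using fun j => X.exists_transport_deriv hp hba Φ Ψ j x
  have h1 := (X.hasPAdicSum_transport hp hba Φ Ψ x).map (X.pullConn Ψ m)
  have h2 := HasPAdicSum.finset_sum Finset.univ fun j _ =>
    ((X.hasPAdicSum_transport hp hba Φ Ψ (X.hasseTilde hp hba (Pi.single j 1) x)).map
      (DistribSMul.toAddMonoidHom (FrobBC Ψ X.Tilde) (Ψ.lam s j m))).add
    ((hy j).map (DistribSMul.toAddMonoidHom (FrobBC Ψ X.Tilde)
      (logDer p k d s R m (Φ.ratio Ψ s j))))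
  refine (h1.unique (x := _) (y := _) ?_).trans
    (b := ∑ j, (Ψ.lam s j m • X.transport hp hba Φ Ψ (X.hasseTilde hp hba (Pi.single j 1) x) +
      logDer p k d s R m (Φ.ratio Ψ s j) • y j)) ?_
  · convert h2 using 1
    · funext I
      rw [pullConn_tmul, X.preConnTilde_eq hp hba, FrobLift.logDer_ratioPow, FrobBC.tmul_sum,
        Finset.smul_sum, ← Finset.sum_add_distrib]
      refine Finset.sum_congr rfl fun j _ => ?_
      simp only [DistribSMul.toAddMonoidHom_apply, FrobBC.smul_tmul]
      rw [hasseTilde_comm, mul_comm (Φ.ratioPow Ψ s I), mul_comm (_ * Φ.ratioPow Ψ s _)]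
    · rfl
  · refine Finset.sum_congr rfl fun j _ => ?_
    rw [hy', FrobLift.logDer_ratio, smul_smul, smul_smul, ← add_smul]
    congr 1
    ring

theorem compare_pullConn (m : Fin d) (y : FrobBC Φ X.Tilde) :
    X.compare hp hba Φ Ψ (X.pullConn Φ m y) = X.pullConn Ψ m (X.compare hp hba Φ Ψ y) := by
  induction y using FrobBC.induction with
  | h0 => simp
  | ht r x =>
    rw [pullConn_smul, map_add, map_smul, map_smul, map_smul, pullConn_smul, compare_tmul,
      one_smul, pullConn_transport, pullConn_tmul, X.preConnTilde_eq hp hba,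
      Derivation.map_one_eq_zero, FrobBC.zero_tmul, add_zero, one_smul, map_sum]
    rfl
  | hadd y z hy hz => simp only [map_add, hy, hz]

variable {X} in
theorem tildeMap_hasseTilde {Y : FilDeRham.{u, v, w} p k d s R a b} (f : FilHom X Y)
    (I : Fin d → ℕ) (x : X.Tilde) :
    f.tildeMap (X.hasseTilde hp hba I x) = Y.hasseTilde hp hba I (f.tildeMap x) := by
  refine DFunLike.congr_fun (X.addHom_ext
    (f := f.tildeMap.toAddMonoidHom.comp (X.hasseTilde hp hba I))
    (g := (Y.hasseTilde hp hba I).comp f.tildeMap.toAddMonoidHom) fun i v hv => ?_) x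
  change f.tildeMap (X.hasseTilde hp hba I (X.br i ⟨v, hv⟩)) =
    Y.hasseTilde hp hba I (f.tildeMap (X.br i ⟨v, hv⟩))
  rw [hasseTilde_br, map_smul, FilHom.tildeMap_br, FilHom.tildeMap_br, hasseTilde_br]
  congr 1
  exact Y.br_congr' rfl (map_multiFalling_apply f.toLin.toAddMonoidHom X.nabla Y.nabla
    f.map_nabla _ _ _) _ _

variable {X} in
theorem compare_map {Y : FilDeRham.{u, v, w} p k d s R a b} (f : FilHom X Y)
    (y : FrobBC Φ X.Tilde) : Y.compare hp hba Φ Ψ (FrobBC.map Φ f.tildeMap y) =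
      FrobBC.map Ψ f.tildeMap (X.compare hp hba Φ Ψ y) := by
  have := Y.isHausdorff_frobBC Ψ
  refine LinearMap.congr_fun (f := (Y.compare hp hba Φ Ψ).comp (FrobBC.map Φ f.tildeMap))
    (g := (FrobBC.map Ψ f.tildeMap).comp (X.compare hp hba Φ Ψ))
    (FrobBC.linearMap_ext fun x => ?_) y
  rw [LinearMap.comp_apply, LinearMap.comp_apply, FrobBC.map_tmul, compare_tmul, compare_tmul,
    one_smul, one_smul]
  refine (Y.hasPAdicSum_transport hp hba Φ Ψ _).unique ?_
  convert (X.hasPAdicSum_transport hp hba Φ Ψ x).map (FrobBC.map Ψ f.tildeMap).toAddMonoidHom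
    using 2 with I
  · rw [← tildeMap_hasseTilde]
    rfl
  · rfl

end FilDeRham

/-- The gluing isomorphisms. -/
def parallelIso (hp : 2 < p) (hba : b - a ≤ (p : ℤ) - 1) (Φ Ψ : FrobLift p k d R) :
    ParallelIso.{u, v, w} s a b Φ Ψ where
  app X := X.compareEquiv hp hba Φ Ψ
  parallel X m x := X.compare_pullConn hp hba Φ Ψ m x
  natural f x := FilDeRham.compare_map hp hba Φ Ψ f x

theorem parallelIso_trans (hp : 2 < p) (hba : b - a ≤ (p : ℤ) - 1) (Φ₁ Φ₂ Φ₃ : FrobLift p k d R)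
    (X : FilDeRham.{u, v, w} p k d s R a b) : (parallelIso hp hba Φ₁ Φ₃).app X =
      ((parallelIso hp hba Φ₁ Φ₂).app X).trans ((parallelIso hp hba Φ₂ Φ₃).app X) :=
  LinearEquiv.ext fun y =>
    (LinearMap.congr_fun (X.compare_comp_compare hp hba Φ₁ Φ₂ Φ₃) y).symm

theorem parallelIso_self (hp : 2 < p) (hba : b - a ≤ (p : ℤ) - 1) (Φ : FrobLift p k d R)
    (X : FilDeRham.{u, v, w} p k d s R a b) :
    (parallelIso hp hba Φ Φ).app X = LinearEquiv.refl _ _ :=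
  LinearEquiv.ext fun y => LinearMap.congr_fun (X.compare_self hp hba Φ) y

end Parallel

/-! ### The logarithmic form of the Taylor series -/

theorem commute_falling {S : Type*} [Ring S] (x : S) (e n : ℕ) : Commute x (falling x e n) := by
  induction n with
  | zero => rw [falling_zero]; exact Commute.one_right x
  | succ n ih =>
    rw [falling_succ]
    exact ih.mul_right ((Commute.refl x).sub_right (Nat.cast_commute _ x).symm)

/-- The scalars move to the front one at a time. Since the list has no repetitions, `G i` only ever
has to pass scalars `t j` with `j ≠ i`. -/
theorem list_prod_apply_eq_smul {A V ι : Type*} [CommRing A] [AddCommGroup V] [Module A V]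
    (F G : ι → AddMonoid.End V) (t : ι → A) (hF : ∀ i v, F i v = t i • G i v)
    (hG : ∀ i j v, i ≠ j → G i (t j • v) = t j • G i v) (L : List ι) (hL : L.Nodup) (v : V) :
    (L.map F).prod v = (L.map t).prod • (L.map G).prod v := by
  induction L with
  | nil => exact (one_smul A v).symm
  | cons i L ih =>
    have h : ∀ (K : List ι) (w : V), (∀ j ∈ K, i ≠ j) →
        G i ((K.map t).prod • w) = (K.map t).prod • G i w := by
      intro K w hK
      induction K with
      | nil => simp
      | cons j K ihK =>
        rw [List.map_cons, List.prod_cons, mul_smul, hG i j _ (hK j (by simp)),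
          ihK fun l hl => hK l (by simp [hl]), mul_smul]
    obtain ⟨h1, h2⟩ := List.nodup_cons.1 hL
    simp only [List.map_cons, List.prod_cons]
    change F i ((L.map F).prod v) = _ • G i ((L.map G).prod v)
    rw [ih h2, hF, h L _ fun j hj hij => h1 (hij ▸ hj), smul_smul]

section LogTaylor

variable {p : ℕ} [Fact p.Prime] {k : Type u} [Field k] [CharP k p] [PerfectRing k p]
  {d s : ℕ} {R : Type v} [CommRing R]
  [Algebra (WittVector p k) R] [Algebra (MvPolynomial (Fin d) (WittVector p k)) R]
  [IsScalarTower (WittVector p k) (MvPolynomial (Fin d) (WittVector p k)) R]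
  [Algebra.Etale (MvPolynomial (Fin d) (WittVector p k)) R]
  {a b : ℤ}

variable (p k s R) in
/-- The coordinates that are not logarithmic, with the logarithmic ones replaced by `1`. -/
def plainCoord (j : Fin d) : RHat p R := if (j : ℕ) < s then 1 else coord p k d R j

theorem map_plainCoord_mul_logRatio (Φ Ψ : FrobLift p k d R) (j : Fin d) :
    Ψ.toRingHom (plainCoord p k s R j) * Φ.logRatio Ψ j = Φ.ratio Ψ s j := by
  rw [plainCoord, FrobLift.ratio]
  split_ifs
  · rw [map_one, one_mul]
  · rfl

namespace FilDeRham

variable (X : FilDeRham.{u, v, w} p k d s R a b)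

theorem nabla_plainCoord_pow_smul (i j : Fin d) (hij : i ≠ j) (n : ℕ) (v : X.V) :
    X.nabla i (plainCoord p k s R j ^ n • v) = plainCoord p k s R j ^ n • X.nabla i v := by
  have h : logDer p k d s R i (plainCoord p k s R j) = 0 := by
    rw [plainCoord]
    split_ifs
    · exact Derivation.map_one_eq_zero _
    · rw [logDer_coord, if_neg hij]
  rw [X.leibniz, Derivation.leibniz_pow, h, smul_zero, smul_zero, zero_smul, zero_add]

theorem falling_nabla_plainCoord_pow_smul (i j : Fin d) (hij : i ≠ j) (e m n : ℕ) (v : X.V) :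
    falling (X.nabla i) e m (plainCoord p k s R j ^ n • v) =
      plainCoord p k s R j ^ n • falling (X.nabla i) e m v := by
  induction m generalizing v with
  | zero => rw [falling_zero]; rfl
  | succ m ih =>
    rw [falling_succ]
    change falling (X.nabla i) e m (X.nabla i (plainCoord p k s R j ^ n • v) -
        (e * m : ℕ) • (plainCoord p k s R j ^ n • v)) =
      plainCoord p k s R j ^ n • falling (X.nabla i) e m (X.nabla i v - (e * m : ℕ) • v)
    rw [X.nabla_plainCoord_pow_smul i j hij, smul_comm, ← smul_sub, ih]

theorem nablaFalling_eq_falling (j : Fin d) (n : ℕ) :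
    X.nablaFalling j n = falling (X.nablaLog j) 1 n := by
  simp only [nablaFalling, falling, one_mul]

/-- For a logarithmic coordinate the two operators are the same; for a plain one this is `T∂ (T∂ -
1) ⋯ (T∂ - n + 1) = T ^ n ∂ ^ n`. -/
theorem nablaFalling_apply (j : Fin d) (n : ℕ) (v : X.V) : X.nablaFalling j n v =
    plainCoord p k s R j ^ n • falling (X.nabla j) (logStep d s j) n v := by
  rw [nablaFalling_eq_falling, plainCoord, logStep]
  split_ifs with hj
  · rw [one_pow, one_smul]
    congr 2
    ext v
    exact if_pos hj
  · have hlog : ∀ v, X.nablaLog j v = coord p k d R j • X.nabla j v := fun v => if_neg hj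
    induction n with
    | zero => simp [falling_zero]
    | succ n ih =>
      -- The new factor is moved to the front, so that it acts on `T ^ n ∂ ^ n v`, which the
      -- induction hypothesis provides.
      rw [falling_succ, falling_succ, ((commute_falling _ _ _).sub_left
        (Nat.cast_commute _ _)).symm.eq, ((commute_falling _ _ _).sub_left
        (Nat.cast_commute _ _)).symm.eq]
      change X.nablaLog j (falling (X.nablaLog j) 1 n v) -
        (1 * n : ℕ) • falling (X.nablaLog j) 1 n v = _ • (X.nabla j (falling (X.nabla j) 0 n v) -
          (0 * n : ℕ) • falling (X.nabla j) 0 n v)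
      rw [ih, hlog, X.leibniz, Derivation.leibniz_pow, logDer_coord, if_pos rfl, if_neg hj,
        zero_mul, zero_smul, sub_zero, one_mul, smul_add, smul_smul, smul_smul,
        ← Nat.cast_smul_eq_nsmul (RHat p R), ← Nat.cast_smul_eq_nsmul (RHat p R), smul_smul,
        smul_smul, pow_succ', add_sub_right_comm, ← sub_smul]
      convert zero_add _
      -- The derivative of `T ^ n` contains the truncated exponent `n - 1`, which is correct only
      -- for `n > 0`.
      rcases n with - | n
      · simp
      · rw [Nat.add_sub_cancel]
        convert zero_smul (RHat p R) _
        ring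

theorem nablaMulti_apply (I : Fin d → ℕ) (v : X.V) : X.nablaMulti I v =
    (∏ j, plainCoord p k s R j ^ I j) • X.mixed I v := by
  have h := list_prod_apply_eq_smul (fun j => X.nablaFalling j (I j))
    (fun j => falling (X.nabla j) (logStep d s j) (I j)) (fun j => plainCoord p k s R j ^ I j)
    (fun j v => X.nablaFalling_apply j (I j) v)
    (fun i j v hij => X.falling_nabla_plainCoord_pow_smul i j hij _ _ _ v)
    (List.finRange d) (List.nodup_finRange d) v
  rw [← List.ofFn_eq_map, ← List.ofFn_eq_map, ← List.ofFn_eq_map, List.prod_ofFn] at h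
  exact h

end FilDeRham

theorem parallelIso_app_tmul_one (hp : 2 < p) (hba : b - a ≤ (p : ℤ) - 1)
    (Φ Ψ : FrobLift p k d R) (X : FilDeRham.{u, v, w} p k d s R a b) (x : X.Tilde) :
    (parallelIso hp hba Φ Ψ).app X (FrobBC.tmul Φ x 1) = X.transport hp hba Φ Ψ x := by
  have h : (parallelIso hp hba Φ Ψ).app X (FrobBC.tmul Φ x 1) =
    X.compare hp hba Φ Ψ (FrobBC.tmul Φ x 1) := rfl
  rw [h, FilDeRham.compare_tmul, one_smul]

theorem taylorCoef_spec (hp : 2 < p) (hba : b - a ≤ (p : ℤ) - 1) (Φ Ψ : FrobLift p k d R)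
    (i : Set.Icc a b) (I : Fin d → ℕ) :
    (multiFactorial I : RHat p R) * (p : RHat p R) ^ min (FilDeRham.height i) (weight I) *
      (dividedCoef p (RHat p R) (FilDeRham.height i) I * ∏ j, Φ.logRatio Ψ j ^ I j) =
      ∏ j, ((Φ.w j * (Ψ.w j)⁻¹ : (RHat p R)ˣ) - 1 : RHat p R) ^ I j := by
  have := isPIntegral_RHat p k d R
  simp only [← FrobLift.p_mul_logRatio, mul_pow, Finset.prod_mul_distrib,
    Finset.prod_pow_eq_pow_sum]
  have h := dividedCoef_spec (A := RHat p R) hp (FilDeRham.height_le hp hba i) I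
  have h2 : (p : RHat p R) ^ (weight I - min (FilDeRham.height i) (weight I)) *
      p ^ min (FilDeRham.height i) (weight I) = p ^ weight I := by
    rw [← pow_add, Nat.sub_add_cancel (min_le_right _ _)]
  rw [show ∑ j, I j = weight I from rfl, ← h2, ← h]
  ring

/-- The monomial in the plain coordinates crosses the tensor sign as its image under `Ψ`, and there
turns `logRatio` into `ratio`; the rational coefficient crosses unchanged. -/
theorem FilDeRham.tmul_br_nablaMulti (X : FilDeRham.{u, v, w} p k d s R a b) (hp : 2 < p)
    (hba : b - a ≤ (p : ℤ) - 1) (Φ Ψ : FrobLift p k d R) (i : Set.Icc a b) (I : Fin d → ℕ)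
    (v : X.V) (hv : v ∈ X.Fil i) (hv' : X.nablaMulti I v ∈ X.Fil (trunc i (weight I))) :
    FrobBC.tmul Ψ (X.br (trunc i (weight I)) ⟨X.nablaMulti I v, hv'⟩)
      (dividedCoef p (RHat p R) (height i) I * ∏ j, Φ.logRatio Ψ j ^ I j) =
    FrobBC.tmul Ψ (X.hasseTilde hp hba I (X.br i ⟨v, hv⟩)) (Φ.ratioPow Ψ s I) := by
  have := isPIntegral_RHat p k d R
  have h1 : FrobBC.tmul Ψ (dividedCoef p (RHat p R) (height i) I •
      X.br (trunc i (weight I)) ⟨X.mixed I v, X.mixed_mem_trunc I i hv⟩) (Φ.ratioPow Ψ s I) =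
      dividedCoef p (RHat p R) (height i) I • FrobBC.tmul Ψ
        (X.br (trunc i (weight I)) ⟨X.mixed I v, X.mixed_mem_trunc I i hv⟩) (Φ.ratioPow Ψ s I) :=
    map_dividedCoef_smul (A := RHat p R) hp (height_le hp hba i) I
      (FrobBC.tmulLeft Ψ (Φ.ratioPow Ψ s I)) _
  have h2 : X.br (trunc i (weight I)) ⟨X.nablaMulti I v, hv'⟩ =
      (∏ j, plainCoord p k s R j ^ I j) • X.br (trunc i (weight I))
        ⟨X.mixed I v, X.mixed_mem_trunc I i hv⟩ := by
    rw [← map_smul]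
    exact X.br_congr' rfl (X.nablaMulti_apply I v) _ _
  rw [hasseTilde_br, h1, h2, FrobBC.tmul_smul, FrobBC.smul_tmul]
  congr 1
  simp only [FrobLift.ratioPow, ← map_plainCoord_mul_logRatio, mul_pow, map_prod, map_pow,
    Finset.prod_mul_distrib]
  ring

theorem parallelIso_isLogTaylor (hp : 2 < p) (hba : b - a ≤ (p : ℤ) - 1)
    (Φ Ψ : FrobLift p k d R) : (parallelIso.{u, v, w} (s := s) hp hba Φ Ψ).IsLogTaylor := by
  refine ⟨fun i I => dividedCoef p (RHat p R) (FilDeRham.height i) I *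
    ∏ j, Φ.logRatio Ψ j ^ I j, fun i I => taylorCoef_spec hp hba Φ Ψ i I, ?_⟩
  intro X i m hm
  rw [parallelIso_app_tmul_one]
  convert X.hasPAdicSum_transport hp hba Φ Ψ (X.br i ⟨m, hm⟩) using 1
  funext I
  exact X.tmul_br_nablaMulti hp hba Φ Ψ i I m hm _

end LogTaylor

/-! ### Equalities between the gluing functors -/

section Glue

variable {p : ℕ} [Fact p.Prime] {k : Type u} [Field k] [CharP k p] [PerfectRing k p]
  {d s : ℕ} {R : Type v} [CommRing R]
  [Algebra (WittVector p k) R] [Algebra (MvPolynomial (Fin d) (WittVector p k)) R]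
  [IsScalarTower (WittVector p k) (MvPolynomial (Fin d) (WittVector p k)) R]
  [Algebra.Etale (MvPolynomial (Fin d) (WittVector p k)) R]
  {a b : ℤ} {Φ Ψ Ξ : FrobLift p k d R}

namespace ParallelIso

/-- The functor between categories of Fontaine–Faltings modules that replaces the isomorphisms `φ`
and is the identity on underlying maps. -/
def reglue (e : ∀ M : LogFF.{u, v, w} s a b Ψ, FrobBC Φ M.X.Tilde ≃ₗ[RHat p R] M.X.V)
    (h : ∀ (M : LogFF.{u, v, w} s a b Ψ) (m : Fin d) (x : FrobBC Φ M.X.Tilde),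
      e M (M.X.pullConn Φ m x) = M.X.nabla m (e M x))
    (hc : ∀ {M N : LogFF.{u, v, w} s a b Ψ} (f : LogFF.Hom M N) (x : FrobBC Φ M.X.Tilde),
      f.hom.toLin (e M x) = e N (FrobBC.map Φ f.hom.tildeMap x))
    (hs : ∀ {M N : LogFF.{u, v, w} s a b Ψ} (f : M ⟶ N),
      (LogFF.strict s a b Ψ).multiplicativeClosure f →
      (LogFF.strict s a b Φ).multiplicativeClosure
        (X := ⟨M.X, e M, h M⟩) (Y := ⟨N.X, e N, h N⟩) ⟨f.hom, hc f⟩) :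
    MF.{u, v, w} s a b Ψ ⥤ MF.{u, v, w} s a b Φ where
  obj M := ⟨⟨M.obj.X, e M.obj, h M.obj⟩⟩
  map f := ⟨⟨f.hom.hom, hc f.hom⟩, hs f.hom f.property⟩

/-- With all functors in the form `reglue`, an equality of functors reduces to one of the families
of isomorphisms, and no transport of morphisms along equalities of objects is needed. -/
theorem reglue_congr {e e' : ∀ M : LogFF.{u, v, w} s a b Ψ, FrobBC Φ M.X.Tilde ≃ₗ[RHat p R] M.X.V}
    (he : e = e') (h hc hs h' hc' hs') : reglue e h hc hs = reglue e' h' hc' hs' := by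
  subst he; rfl

theorem glue_eq_reglue (α : ParallelIso.{u, v, w} s a b Φ Ψ) :
    α.glue = reglue (fun M => (α.app M.X).trans M.φ) (fun M => (α.glueObj M).horizontal)
      (fun f => (α.glueHom f).comm) (fun f => α.glueFF_closure f) := rfl

theorem glue_comp_eq_reglue (α : ParallelIso.{u, v, w} s a b Φ Ψ)
    (β : ParallelIso.{u, v, w} s a b Ψ Ξ) :
    β.glue ⋙ α.glue = reglue (fun M => (α.app M.X).trans ((β.app M.X).trans M.φ))
      (fun M => (α.glueObj (β.glueObj M)).horizontal)
      (fun f => (α.glueHom (β.glueHom f)).comm)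
      (fun f hf => α.glueFF_closure _ (β.glueFF_closure f hf)) := rfl

theorem glue_comp (α : ParallelIso.{u, v, w} s a b Φ Ψ) (β : ParallelIso.{u, v, w} s a b Ψ Ξ)
    (γ : ParallelIso.{u, v, w} s a b Φ Ξ) (h : ∀ X, γ.app X = (α.app X).trans (β.app X)) :
    β.glue ⋙ α.glue = γ.glue := by
  refine (glue_comp_eq_reglue α β).trans ((reglue_congr (funext fun M => ?_) ..).trans
    (glue_eq_reglue γ).symm)
  refine LinearEquiv.ext fun x => ?_
  simp only [LinearEquiv.trans_apply, h]

theorem glue_eq_id (α : ParallelIso.{u, v, w} s a b Φ Φ)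
    (h : ∀ X, α.app X = LinearEquiv.refl _ _) : α.glue = 𝟭 (MF.{u, v, w} s a b Φ) := by
  have h1 : 𝟭 (MF.{u, v, w} s a b Φ) = reglue (fun M => M.φ) (fun M => M.horizontal)
    (fun f => f.comm) (fun f hf => hf) := rfl
  rw [glue_eq_reglue, h1]
  congr 1
  funext M
  rw [h, LinearEquiv.refl_trans]

end ParallelIso

theorem isEquivalence_of_comp_eq_id {C D : Type*} [Category C] [Category D] (F : C ⥤ D) (G : D ⥤ C)
    (h₁ : F ⋙ G = 𝟭 C) (h₂ : G ⋙ F = 𝟭 D) : F.IsEquivalence :=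
  (CategoryTheory.Equivalence.mk F G (eqToIso h₁.symm) (eqToIso h₂)).isEquivalence_functor

theorem glue_parallelIso_self (hp : 2 < p) (hba : b - a ≤ (p : ℤ) - 1) (Φ : FrobLift p k d R) :
    (parallelIso hp hba Φ Φ).glue = 𝟭 (MF.{u, v, w} s a b Φ) :=
  ParallelIso.glue_eq_id _ (parallelIso_self hp hba Φ)

theorem glue_parallelIso_trans (hp : 2 < p) (hba : b - a ≤ (p : ℤ) - 1)
    (Φ₁ Φ₂ Φ₃ : FrobLift p k d R) :
    (parallelIso.{u, v, w} (s := s) hp hba Φ₂ Φ₃).glue ⋙ (parallelIso hp hba Φ₁ Φ₂).glue =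
      (parallelIso hp hba Φ₁ Φ₃).glue :=
  ParallelIso.glue_comp _ _ _ (parallelIso_trans hp hba Φ₁ Φ₂ Φ₃)

end Glue

end

end LogGluing

theorem mainTheorem3 {p : ℕ} [Fact p.Prime] (hp : 2 < p)
    (k : Type u) [Field k] [CharP k p] [PerfectRing k p]
    (d s : ℕ) (hs : s ≤ d) (R : Type v) [CommRing R] [Algebra (WittVector p k) R]
    [Algebra (MvPolynomial (Fin d) (WittVector p k)) R]
    [IsScalarTower (WittVector p k) (MvPolynomial (Fin d) (WittVector p k)) R]
    [Algebra.Etale (MvPolynomial (Fin d) (WittVector p k)) R]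
    (a b : ℤ) (hab : a ≤ b) (hba : b - a ≤ (p : ℤ) - 1) :
    ∃ α : ∀ Φ Ψ : FrobLift p k d R, ParallelIso.{u, v, w} s a b Φ Ψ,
      (∀ Φ Ψ, (α Φ Ψ).IsLogTaylor) ∧
      (∀ (Φ₁ Φ₂ Φ₃ : FrobLift p k d R) (X : FilDeRham.{u, v, w} p k d s R a b),
        (α Φ₁ Φ₃).app X = ((α Φ₁ Φ₂).app X).trans ((α Φ₂ Φ₃).app X)) ∧
      (∀ Φ Ψ, (α Φ Ψ).glue.IsEquivalence) ∧
      (∀ Φ, (α Φ Φ).glue = 𝟭 (MF.{u, v, w} s a b Φ)) ∧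
      (∀ Φ₁ Φ₂ Φ₃, (α Φ₂ Φ₃).glue ⋙ (α Φ₁ Φ₂).glue = (α Φ₁ Φ₃).glue) := by
  refine ⟨parallelIso hp hba, parallelIso_isLogTaylor hp hba, parallelIso_trans hp hba,
    fun Φ Ψ => ?_, glue_parallelIso_self hp hba, glue_parallelIso_trans hp hba⟩
  exact isEquivalence_of_comp_eq_id _ (parallelIso hp hba Ψ Φ).glue
    ((glue_parallelIso_trans hp hba Ψ Φ Ψ).trans (glue_parallelIso_self hp hba Ψ))
    ((glue_parallelIso_trans hp hba Φ Ψ Φ).trans (glue_parallelIso_self hp hba Φ))
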